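/- A walk on $\mathbb{Z}^2$ starting at $(0,0)$ with unit steps is *prudent* if no step points towards an already visited vertex (in particular it is self-avoiding). Its *box* is its minimal bounding rectangle. A prudent walk is *three-sided* if every step ends on the left, top or right side of the current box, and each left or right step that ends on the bottom side of the current box inflates the box. A *three-sided prudent polygon* is a three-sided prudent walk with more than one step whose last vertex is adjacent to $(0,0)$; its half-perimeter is half of (number of steps plus one). It is *generic* if it ends in $(1,0)$ and its last but one vertex is $(1,1)$. Let $PP_3(t)$ and $R(t,1,1)$ be the generating functions, by half-perimeter, of three-sided prudent polygons and of generic three-sided prudent polygons. A power series $f\in\mathbb{C}[[t]]$ is *D-finite* if $\sum_{i=0}^d p_i f^{(i)}=0$ for some $d\ge 0$ and polynomials $p_0,\dots,p_d\in\mathbb{C}[t]$, not all zero. Let $\rho=0.2955977\ldots$ be the unique real root of $1-3t-t^2-t^3$, and for $0<t<\rho$ put $$q(t)=\frac{t^2+1-\sqrt{1-4t+2t^2+t^4}}{2t},\qquad u(t)=\frac1t\cdot\frac{1-\sqrt t}{1+\sqrt t}.$$ **Theorem.** For every $N\ge 0$ the equation $u(t)=q(t)\,(q(t)^2t)^N$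 has a unique solution $\sigma_N$ in $(0,\rho)$. The sequence $(\sigma_N)$ is strictly increasing with limit $\rho$, and $\sigma:=\sigma_0=\tau^2=0.2441312\ldots$, where $\tau$ is the unique real root of $x^5+2x^2+3x-2$. The power series $R(t,1,1)$ converges in $\{|t|<\sigma\}$ to an analytic function, and this function continues to a meromorphic function $F$ on the slit disc $\{|t|<\rho\}\setminus[\sigma,\rho)$ such that: 1. $\sigma$ is the unique dominant singularity and is a square root singularity: $F$ is analytic at every point $t\ne\sigma$ with $|t|=\sigma$, and, in the slit disc near $\sigma$, $F(t)=f(t)+g(t)\sqrt{\sigma-t}$ with $f,g$ analytic at $\sigma$ and $g(\sigma)\neq0$. 2. For infinitely many $N$, $F$ has a square root singularity at $\sigma_N$: near $\sigma_N$, on each of the two sides $\operatorname{Im}t>0$ and $\operatorname{Im}t<0$ of the slit, $F(t)=f(t)+g(t)\sqrt{\sigma_N-t}$ with $f,g$ (depending on the side) analytic at $\sigma_N$ and $g(\sigma_N)\neq 0$. Neither $R(t,1,1)$ nor $PP_3(t)$ is D-finite. -/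

import Mathlib

namespace PrudentPolygon

/-- The four unit steps on the square lattice. -/
inductive Dir
  | left
  | right
  | up
  | down

/-- The displacement of a unit step. -/
def Dir.vec : Dir → ℤ × ℤ
  | .left => (-1, 0)
  | .right => (1, 0)
  | .up => (0, 1)
  | .down => (0, -1)

/-- A walk on the square lattice starting at the origin, given by its sequence of steps. -/
abbrev Walk := List Dir

/-- The vertex reached after the first `i` steps; the walk starts at `(0, 0)`. -/
def Walk.vertex (w : Walk) (i : ℕ) : ℤ × ℤ := ((w.take i).map Dir.vec).sum

/-- No step points towards an already occupied vertex: the ray leaving the current vertex in the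
direction of the step meets none of the vertices visited so far. The case `k = 1` says that
the walk is self-avoiding. -/
def Walk.IsPrudent (w : Walk) : Prop :=
  ∀ (i : ℕ) (hi : i < w.length), ∀ j ≤ i, ∀ k : ℕ, 1 ≤ k →
    w.vertex i + k • (w[i]).vec ≠ w.vertex j

/-- The vertex after `i` steps lies on the left side of the box of the first `i` steps. -/
def Walk.OnLeft (w : Walk) (i : ℕ) : Prop := ∀ j ≤ i, (w.vertex i).1 ≤ (w.vertex j).1

/-- The vertex after `i` steps lies on the right side of the box of the first `i` steps. -/
def Walk.OnRight (w : Walk) (i : ℕ) : Prop := ∀ j ≤ i, (w.vertex j).1 ≤ (w.vertex i).1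

/-- The vertex after `i` steps lies on the top side of the box of the first `i` steps. -/
def Walk.OnTop (w : Walk) (i : ℕ) : Prop := ∀ j ≤ i, (w.vertex j).2 ≤ (w.vertex i).2

/-- The vertex after `i` steps lies on the bottom side of the box of the first `i` steps. -/
def Walk.OnBottom (w : Walk) (i : ℕ) : Prop := ∀ j ≤ i, (w.vertex i).2 ≤ (w.vertex j).2

/-- The point `p` lies in the box (minimal bounding rectangle) of the first `i` steps. -/
def Walk.InBox (w : Walk) (i : ℕ) (p : ℤ × ℤ) : Prop :=
  (∃ a ≤ i, (w.vertex a).1 ≤ p.1) ∧ (∃ a ≤ i, p.1 ≤ (w.vertex a).1) ∧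
    (∃ a ≤ i, (w.vertex a).2 ≤ p.2) ∧ (∃ a ≤ i, p.2 ≤ (w.vertex a).2)

/-- Three-sided prudent walks: every step ends on the left, top or right side of the current box,
and each left or right step that ends on the bottom side of the current box inflates the box. -/
def Walk.IsThreeSided (w : Walk) : Prop :=
  w.IsPrudent ∧
  ∀ (i : ℕ) (hi : i < w.length),
    (w.OnLeft (i + 1) ∨ w.OnTop (i + 1) ∨ w.OnRight (i + 1)) ∧
    ((w[i] = Dir.left ∨ w[i] = Dir.right) → w.OnBottom (i + 1) →
      ¬ w.InBox i (w.vertex (i + 1)))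

/-- Three-sided prudent polygons: three-sided prudent walks whose last vertex is adjacent to the
initial vertex, single edges excluded. -/
def Walk.IsThreeSidedPolygon (w : Walk) : Prop :=
  w.IsThreeSided ∧ w.length ≠ 1 ∧ ∃ d : Dir, w.vertex w.length = d.vec

/-- Generic three-sided prudent polygons (ending on the right): they end in `(1, 0)` and
reach this vertex from above, via `(1, 1)`. -/
def Walk.IsGenericThreeSidedPolygon (w : Walk) : Prop :=
  w.IsThreeSidedPolygon ∧ w.vertex w.length = (1, 0) ∧ w.vertex (w.length - 1) = (1, 1)

/-- The number of three-sided prudent polygons of half-perimeter `n`; the perimeter is the number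
of steps of the walk plus one, for the edge from the last vertex back to the first. -/
noncomputable def threeSidedCount (n : ℕ) : ℕ :=
  {w : Walk | w.IsThreeSidedPolygon ∧ w.length + 1 = 2 * n}.ncard

/-- The number of generic three-sided prudent polygons of half-perimeter `n`. -/
noncomputable def genericCount (n : ℕ) : ℕ :=
  {w : Walk | w.IsGenericThreeSidedPolygon ∧ w.length + 1 = 2 * n}.ncard

/-- The half-perimeter generating function `PP₃(t)` of three-sided prudent polygons. -/
noncomputable def seriesPP3 : PowerSeries ℂ := PowerSeries.mk fun n => (threeSidedCount n : ℂ)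

/-- The half-perimeter generating function `R(t, 1, 1)` of generic three-sided
prudent polygons. -/
noncomputable def seriesR : PowerSeries ℂ := PowerSeries.mk fun n => (genericCount n : ℂ)

/-- A univariate power series is D-finite if it solves a nontrivial homogeneous linear ordinary
differential equation with polynomial coefficients. -/
def IsDFinite (f : PowerSeries ℂ) : Prop :=
  ∃ (d : ℕ) (p : Fin (d + 1) → Polynomial ℂ), p ≠ 0 ∧
    ∑ i : Fin (d + 1), (p i : PowerSeries ℂ) * (PowerSeries.derivative ℂ)^[(i : ℕ)] f = 0

/-- The series `q(t)`, for real `t` with nonnegative radicand. -/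
noncomputable def q (t : ℝ) : ℝ :=
  (t ^ 2 + 1 - Real.sqrt (1 - 4 * t + 2 * t ^ 2 + t ^ 4)) / (2 * t)

/-- `u(t) = (1 / t) (1 - √t) / (1 + √t)`, for real `t > 0`. -/
noncomputable def u (t : ℝ) : ℝ := (1 / t) * ((1 - Real.sqrt t) / (1 + Real.sqrt t))

/-- The slit disc `{|t| < ρ} ∖ [σ, ρ)`. -/
def slitDisc (σ ρ : ℝ) : Set ℂ := Metric.ball (0 : ℂ) ρ \ Complex.ofReal '' Set.Ico σ ρ

/-- Inside the region `S`, the function `F` has a square root singularity at the point `s`: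
`F(t) = f(t) + g(t) √(s - t)` near `s`, with `f` and `g` analytic at `s` and `g(s) ≠ 0`. The power
is the principal branch, which is analytic off the ray `s + [0, ∞)`. -/
def HasSqrtSingularityWithin (F : ℂ → ℂ) (S : Set ℂ) (s : ℂ) : Prop :=
  ∃ f g : ℂ → ℂ, AnalyticAt ℂ f s ∧ AnalyticAt ℂ g s ∧ g s ≠ 0 ∧
    ∀ᶠ t in nhdsWithin s S, F t = f t + g t * (s - t) ^ (1 / 2 : ℂ)

/-- Square root singularity at a real point `s` that may lie in the interior of a slit along the
real axis: it is one on approach from the upper and from the lower edge of the slit. -/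
def HasSqrtSingularityOnSlit (F : ℂ → ℂ) (s : ℝ) : Prop :=
  HasSqrtSingularityWithin F {t | 0 < t.im} s ∧ HasSqrtSingularityWithin F {t | t.im < 0} s

end PrudentPolygon

/-! A combinatorial half ends in a functional equation; an analytic half reads the singularities off
its iterated solution.

Combinatorics. Up to reflection a three-sided polygon is generic, or a one-column polygon below the
origin, or comes home along the first row above the origin (`threeSidedCount_eq`). The last two
kinds contribute functions analytic in |t| < ρ, so the generic ones decide. Removing its final right
step and straight descent, a generic polygon becomes a walk in the half-plane x ≤ 0 that ends on its
top row above the origin (`genericCount_eq`), and such walks are read by an automaton. With weight t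
for left and up steps and 1 for the others, walks are summed by potentials: if φ = next φ + δ, then
the total weight of δ is the initial value of φ (`total_of_eq_next_add`). One potential governs the
excursions down the leftmost column. Two more govern the motion along the top row, one for each root
q and 1/(tq) of t q² - (t² + 1) q + 1. Eliminating the auxiliary sums gives S(y) = a(y) + m(y) S(t
q² y) (`total_exitRight_rec`), and iteration from y = 1 gives the series `cS`. Its k-th coefficients
contain the square root of the discriminant `1 - cv k`, a kernel evaluated at X_k = t q (t q²)^k.

Continuation. For |t| < ρ one has |t q²| < 1, so X_k → 0 and m_k → c² with |c| < 1: the tail of the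
series is analytic, and finitely many kernels remain. The functions are dominated by their values at
|t|, where the k-th discriminant stays positive up to σ_k. Off the real axis the argument estimate
`cX_im_pos` keeps `1 - cv k` away from the cut of the square root, so the sum is meromorphic on the
slit disc.

Singularities. At σ_N the N-th kernel produces a square root (`exists_cS_eq`). Its coefficient is
nonzero because X_{N+1} S_{N+1} lies in [0, 1] (`cX_mul_cS_mem`). The kernels with j < N have passed
their branch points: their x_j is not real, so they neither create a pole nor cancel the singularity
(`hasSqrtSingularityWithin_cS_of_succ`). This needs an inequality in σ_N that is verified for N = 0
and, by a limit at ρ, for all large N.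

Consequence. A linear differential equation persists along the continuation, and at a square root
singularity its leading coefficient must vanish (`leading_eval_eq_zero`). A nonzero polynomial has
no infinite set of roots, so neither series is D-finite. -/

namespace PrudentPolygon

/-! ### Three-sided walks, one step at a time -/

/-- The last vertex of a walk. -/
def Walk.endpoint (w : Walk) : ℤ × ℤ := w.vertex w.length

/-- The set of vertices of a walk. -/
def Walk.support (w : Walk) : Set (ℤ × ℤ) := {p | ∃ j ≤ w.length, w.vertex j = p}

/-- `Admissible V p d` says that a three-sided prudent walk with vertex set `V` and last
vertex `p` may be extended by the step `d`. -/
def Admissible (V : Set (ℤ × ℤ)) (p : ℤ × ℤ) (d : Dir) : Prop :=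
  (∀ k : ℕ, 1 ≤ k → p + k • d.vec ∉ V) ∧
  ((∀ a ∈ V, (p + d.vec).1 ≤ a.1) ∨ (∀ a ∈ V, a.2 ≤ (p + d.vec).2) ∨
    (∀ a ∈ V, a.1 ≤ (p + d.vec).1)) ∧
  ((d = Dir.left ∨ d = Dir.right) → (∀ a ∈ V, (p + d.vec).2 ≤ a.2) →
    ¬ ((∃ a ∈ V, a.1 ≤ (p + d.vec).1) ∧ (∃ a ∈ V, (p + d.vec).1 ≤ a.1) ∧
      (∃ a ∈ V, a.2 ≤ (p + d.vec).2) ∧ (∃ a ∈ V, (p + d.vec).2 ≤ a.2)))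

theorem Walk.vertex_zero (w : Walk) : w.vertex 0 = 0 := by simp [Walk.vertex]

theorem Walk.vertex_append_of_le (w w' : Walk) {i : ℕ} (hi : i ≤ w.length) :
    Walk.vertex (w ++ w') i = w.vertex i := by
  simp [Walk.vertex, List.take_append_of_le_length hi]

theorem Walk.endpoint_concat (w : Walk) (d : Dir) :
    Walk.endpoint (w ++ [d]) = w.endpoint + d.vec := by
  simp [Walk.endpoint, Walk.vertex]

theorem Walk.vertex_concat_last (w : Walk) (d : Dir) :
    Walk.vertex (w ++ [d]) (w.length + 1) = w.endpoint + d.vec := by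
  rw [← Walk.endpoint_concat]; simp [Walk.endpoint]

theorem Walk.support_nil : Walk.support [] = {0} := by
  ext p; simp [Walk.support, Walk.vertex, eq_comm]

theorem Walk.support_concat (w : Walk) (d : Dir) :
    Walk.support (w ++ [d]) = insert (w.endpoint + d.vec) w.support := by
  ext p
  simp only [Walk.support, List.length_append, List.length_singleton, Set.mem_ofPred_eq,
    Set.mem_insert_iff]
  constructor
  · rintro ⟨j, hj, rfl⟩
    rcases Nat.lt_or_ge w.length j with h | h
    · left
      obtain rfl : j = w.length + 1 := by omega
      exact w.vertex_concat_last d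
    · right
      exact ⟨j, h, (w.vertex_append_of_le [d] h).symm⟩
  · rintro (rfl | ⟨j, hj, rfl⟩)
    · exact ⟨w.length + 1, le_rfl, w.vertex_concat_last d⟩
    · exact ⟨j, by omega, w.vertex_append_of_le [d] hj⟩

theorem Walk.endpoint_mem_support (w : Walk) : w.endpoint ∈ w.support := ⟨_, le_rfl, rfl⟩

theorem Walk.zero_mem_support (w : Walk) : (0 : ℤ × ℤ) ∈ w.support :=
  ⟨0, Nat.zero_le _, w.vertex_zero⟩

theorem Walk.support_append_subset (w w' : Walk) : w.support ⊆ Walk.support (w ++ w') := by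
  rintro p ⟨j, hj, rfl⟩
  exact ⟨j, by simp; omega, w.vertex_append_of_le w' hj⟩

theorem isThreeSided_nil : Walk.IsThreeSided [] := by
  simp [Walk.IsThreeSided, Walk.IsPrudent]

/-- Every condition on the last step involves only the set of earlier vertices and the last of them,
so three-sidedness can be checked step by step. This is what lets an automaton with an invariant on
(support, endpoint) recognize the walks. -/
theorem isThreeSided_concat (w : Walk) (d : Dir) :
    Walk.IsThreeSided (w ++ [d]) ↔ w.IsThreeSided ∧ Admissible w.support w.endpoint d := by
  have hv : ∀ i ≤ w.length, Walk.vertex (w ++ [d]) i = w.vertex i :=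
    fun i hi => w.vertex_append_of_le [d] hi
  have hlast := w.vertex_concat_last d
  have hsucc : ∀ i, i < w.length → ∀ j ≤ i + 1, Walk.vertex (w ++ [d]) j = w.vertex j :=
    fun i hi j hj => hv j (by omega)
  have hpr : Walk.IsPrudent (w ++ [d]) ↔ w.IsPrudent ∧
      ∀ k : ℕ, 1 ≤ k → w.endpoint + k • d.vec ∉ w.support := by
    constructor
    · intro h
      refine ⟨fun i hi j hj k hk => ?_, fun k hk ⟨j, hj, e⟩ => ?_⟩
      · have := h i (by simp; omega) j hj k hk
        rwa [hv i (by omega), hv j (by omega), List.getElem_append_left hi] at this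
      · have := h w.length (by simp) j hj k hk
        rw [hv _ le_rfl, hv j hj, List.getElem_append_right le_rfl] at this
        simp at this
        exact this e.symm
    · rintro ⟨h, h'⟩ i hi j hj k hk
      rcases Nat.lt_or_ge i w.length with hi' | hi'
      · rw [hv i (by omega), hv j (by omega), List.getElem_append_left hi']
        exact h i hi' j hj k hk
      · obtain rfl : i = w.length := by simp at hi; omega
        rw [hv _ le_rfl, hv j hj, List.getElem_append_right le_rfl]
        simp only [Nat.sub_self, List.getElem_cons_zero]
        exact fun e => h' k hk ⟨j, hj, e.symm⟩
  have hside : ∀ (i : ℕ), i < w.length →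
      ((Walk.OnLeft (w ++ [d]) (i + 1) ↔ w.OnLeft (i + 1)) ∧
      (Walk.OnTop (w ++ [d]) (i + 1) ↔ w.OnTop (i + 1)) ∧
      (Walk.OnRight (w ++ [d]) (i + 1) ↔ w.OnRight (i + 1)) ∧
      (Walk.OnBottom (w ++ [d]) (i + 1) ↔ w.OnBottom (i + 1)) ∧
      (Walk.InBox (w ++ [d]) i (Walk.vertex (w ++ [d]) (i + 1)) ↔
        w.InBox i (w.vertex (i + 1)))) := by
    intro i hi
    have e := hsucc i hi
    refine ⟨?_, ?_, ?_, ?_, ?_⟩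
    · exact forall₂_congr fun j hj => by rw [e _ le_rfl, e j hj]
    · exact forall₂_congr fun j hj => by rw [e _ le_rfl, e j hj]
    · exact forall₂_congr fun j hj => by rw [e _ le_rfl, e j hj]
    · exact forall₂_congr fun j hj => by rw [e _ le_rfl, e j hj]
    · rw [e _ le_rfl]
      have key : ∀ P : ℤ × ℤ → Prop, (∃ a ≤ i, P (Walk.vertex (w ++ [d]) a)) ↔
          ∃ a ≤ i, P (w.vertex a) := fun P =>
        exists_congr fun a => and_congr_right fun ha => by rw [e a (by omega)]
      unfold Walk.InBox
      rw [key (fun a => a.1 ≤ _), key (fun a => _ ≤ a.1), key (fun a => a.2 ≤ _),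
        key (fun a => _ ≤ a.2)]
  -- Once the new vertex satisfies `P`, quantifying over the longer walk is the same as quantifying
  -- over the old support.
  have hall : ∀ P : ℤ × ℤ → Prop, P (w.endpoint + d.vec) →
      ((∀ j ≤ w.length + 1, P (Walk.vertex (w ++ [d]) j)) ↔ ∀ a ∈ w.support, P a) := by
    intro P hP
    constructor
    · rintro h a ⟨j, hj, rfl⟩
      rw [← hv j hj]; exact h j (by omega)
    · intro h j hj
      rcases Nat.lt_or_ge w.length j with h' | h'
      · obtain rfl : j = w.length + 1 := by omega
        rwa [hlast]
      · rw [hv j h']; exact h _ ⟨j, h', rfl⟩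
  have hex : ∀ P : ℤ × ℤ → Prop, (∃ j ≤ w.length, P (Walk.vertex (w ++ [d]) j)) ↔
      ∃ a ∈ w.support, P a := by
    intro P
    constructor
    · rintro ⟨j, hj, h⟩
      exact ⟨_, ⟨j, hj, rfl⟩, by rwa [hv j hj] at h⟩
    · rintro ⟨_, ⟨j, hj, rfl⟩, h⟩
      exact ⟨j, hj, by rwa [hv j hj]⟩
  have hL : Walk.OnLeft (w ++ [d]) (w.length + 1) ↔
      ∀ a ∈ w.support, (w.endpoint + d.vec).1 ≤ a.1 := by
    unfold Walk.OnLeft; rw [hlast]; exact hall (fun a => _ ≤ a.1) le_rfl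
  have hT : Walk.OnTop (w ++ [d]) (w.length + 1) ↔
      ∀ a ∈ w.support, a.2 ≤ (w.endpoint + d.vec).2 := by
    unfold Walk.OnTop; rw [hlast]; exact hall (fun a => a.2 ≤ _) le_rfl
  have hR : Walk.OnRight (w ++ [d]) (w.length + 1) ↔
      ∀ a ∈ w.support, a.1 ≤ (w.endpoint + d.vec).1 := by
    unfold Walk.OnRight; rw [hlast]; exact hall (fun a => a.1 ≤ _) le_rfl
  have hB : Walk.OnBottom (w ++ [d]) (w.length + 1) ↔
      ∀ a ∈ w.support, (w.endpoint + d.vec).2 ≤ a.2 := by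
    unfold Walk.OnBottom; rw [hlast]; exact hall (fun a => _ ≤ a.2) le_rfl
  have hI : Walk.InBox (w ++ [d]) w.length (Walk.vertex (w ++ [d]) (w.length + 1)) ↔
      ((∃ a ∈ w.support, a.1 ≤ (w.endpoint + d.vec).1) ∧
      (∃ a ∈ w.support, (w.endpoint + d.vec).1 ≤ a.1) ∧
      (∃ a ∈ w.support, a.2 ≤ (w.endpoint + d.vec).2) ∧
      (∃ a ∈ w.support, (w.endpoint + d.vec).2 ≤ a.2)) := by
    unfold Walk.InBox
    rw [hlast, hex (fun a => a.1 ≤ _), hex (fun a => _ ≤ a.1), hex (fun a => a.2 ≤ _),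
      hex (fun a => _ ≤ a.2)]
  unfold Walk.IsThreeSided
  rw [hpr]
  constructor
  · rintro ⟨⟨h1, h2⟩, h3⟩
    refine ⟨⟨h1, fun i hi => ?_⟩, h2, ?_⟩
    · have := h3 i (by simp; omega)
      obtain ⟨e1, e2, e3, e4, e5⟩ := hside i hi
      rwa [e1, e2, e3, e4, e5, List.getElem_append_left hi] at this
    · have := h3 w.length (by simp)
      rw [hL, hT, hR, hB, hI, List.getElem_append_right le_rfl] at this
      simpa only [Nat.sub_self, List.getElem_cons_zero] using this
  · rintro ⟨⟨h1, h2⟩, h3, h4⟩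
    refine ⟨⟨h1, h3⟩, fun i hi => ?_⟩
    rcases Nat.lt_or_ge i w.length with hi' | hi'
    · obtain ⟨e1, e2, e3, e4, e5⟩ := hside i hi'
      rw [e1, e2, e3, e4, e5, List.getElem_append_left hi']
      exact h2 i hi'
    · obtain rfl : i = w.length := by simp at hi; omega
      rw [hL, hT, hR, hB, hI, List.getElem_append_right le_rfl]
      simpa only [Nat.sub_self, List.getElem_cons_zero] using h4

theorem isThreeSided_of_append {w w' : Walk} (h : Walk.IsThreeSided (w ++ w')) :
    w.IsThreeSided := by
  induction w' using List.reverseRecOn with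
  | nil => simpa using h
  | append_singleton l d ih =>
    rw [← List.append_assoc, isThreeSided_concat] at h
    exact ih h.1

/-- The ray meets `V` exactly when a vertex of the same row lies strictly to the left; its distance
is the `k`. -/
theorem admissible_left_iff (V : Set (ℤ × ℤ)) (p : ℤ × ℤ) :
    Admissible V p .left ↔ (∀ a ∈ V, a.2 = p.2 → p.1 ≤ a.1) ∧
      ((∀ a ∈ V, p.1 - 1 ≤ a.1) ∨ (∀ a ∈ V, a.2 ≤ p.2) ∨ (∀ a ∈ V, a.1 ≤ p.1 - 1)) ∧
      ((∀ a ∈ V, p.2 ≤ a.2) → ¬ ((∃ a ∈ V, a.1 ≤ p.1 - 1) ∧ (∃ a ∈ V, p.1 - 1 ≤ a.1) ∧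
        (∃ a ∈ V, a.2 ≤ p.2) ∧ (∃ a ∈ V, p.2 ≤ a.2))) := by
  have : (∀ k : ℕ, 1 ≤ k → p + k • Dir.vec .left ∉ V) ↔ ∀ a ∈ V, a.2 = p.2 → p.1 ≤ a.1 := by
    constructor
    · intro h a ha e
      by_contra! hlt
      refine h (p.1 - a.1).toNat (by omega) ?_
      convert ha using 1
      ext
      · simp [Dir.vec]; omega
      · simp [Dir.vec, e]
    · intro h k hk hV
      have := h _ hV (by simp [Dir.vec])
      simp [Dir.vec] at this
      omega
  unfold Admissible
  rw [this]
  simp [Dir.vec, ← sub_eq_add_neg]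

theorem admissible_right_iff (V : Set (ℤ × ℤ)) (p : ℤ × ℤ) :
    Admissible V p .right ↔ (∀ a ∈ V, a.2 = p.2 → a.1 ≤ p.1) ∧
      ((∀ a ∈ V, p.1 + 1 ≤ a.1) ∨ (∀ a ∈ V, a.2 ≤ p.2) ∨ (∀ a ∈ V, a.1 ≤ p.1 + 1)) ∧
      ((∀ a ∈ V, p.2 ≤ a.2) → ¬ ((∃ a ∈ V, a.1 ≤ p.1 + 1) ∧ (∃ a ∈ V, p.1 + 1 ≤ a.1) ∧
        (∃ a ∈ V, a.2 ≤ p.2) ∧ (∃ a ∈ V, p.2 ≤ a.2))) := by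
  have : (∀ k : ℕ, 1 ≤ k → p + k • Dir.vec .right ∉ V) ↔ ∀ a ∈ V, a.2 = p.2 → a.1 ≤ p.1 := by
    constructor
    · intro h a ha e
      by_contra! hlt
      refine h (a.1 - p.1).toNat (by omega) ?_
      convert ha using 1
      ext
      · simp [Dir.vec]; omega
      · simp [Dir.vec, e]
    · intro h k hk hV
      have := h _ hV (by simp [Dir.vec])
      simp [Dir.vec] at this
      omega
  unfold Admissible
  rw [this]
  simp [Dir.vec]

theorem admissible_up_iff (V : Set (ℤ × ℤ)) (p : ℤ × ℤ) :
    Admissible V p .up ↔ (∀ a ∈ V, a.1 = p.1 → a.2 ≤ p.2) ∧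
      ((∀ a ∈ V, p.1 ≤ a.1) ∨ (∀ a ∈ V, a.2 ≤ p.2 + 1) ∨ (∀ a ∈ V, a.1 ≤ p.1)) := by
  have : (∀ k : ℕ, 1 ≤ k → p + k • Dir.vec .up ∉ V) ↔ ∀ a ∈ V, a.1 = p.1 → a.2 ≤ p.2 := by
    constructor
    · intro h a ha e
      by_contra! hlt
      refine h (a.2 - p.2).toNat (by omega) ?_
      convert ha using 1
      ext
      · simp [Dir.vec, e]
      · simp [Dir.vec]; omega
    · intro h k hk hV
      have := h _ hV (by simp [Dir.vec])
      simp [Dir.vec] at this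
      omega
  unfold Admissible
  rw [this]
  simp [Dir.vec]

theorem admissible_down_iff (V : Set (ℤ × ℤ)) (p : ℤ × ℤ) :
    Admissible V p .down ↔ (∀ a ∈ V, a.1 = p.1 → p.2 ≤ a.2) ∧
      ((∀ a ∈ V, p.1 ≤ a.1) ∨ (∀ a ∈ V, a.2 ≤ p.2 - 1) ∨ (∀ a ∈ V, a.1 ≤ p.1)) := by
  have : (∀ k : ℕ, 1 ≤ k → p + k • Dir.vec .down ∉ V) ↔ ∀ a ∈ V, a.1 = p.1 → p.2 ≤ a.2 := by
    constructor
    · intro h a ha e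
      by_contra! hlt
      refine h (p.2 - a.2).toNat (by omega) ?_
      convert ha using 1
      ext
      · simp [Dir.vec, e]
      · simp [Dir.vec]; omega
    · intro h k hk hV
      have := h _ hV (by simp [Dir.vec])
      simp [Dir.vec] at this
      omega
  unfold Admissible
  rw [this]
  simp [Dir.vec, ← sub_eq_add_neg]

end PrudentPolygon

/-! ### An automaton for the walks in the half-plane x ≤ 0 -/

namespace PrudentPolygon

/-- The last step of a walk that is below its top row or on its first visit to the left
side. -/
inductive LowMark
  | left
  | up
  | down

/-- The last step of a walk that is on its top row. -/
inductive TopMark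
  | left
  | up
  | right

/-- The states of an automaton that recognizes the three-sided prudent walks in the half-plane
`x ≤ 0`. In state `low h m k ℓ` the walk is in `(-m, h - k)`, in the leftmost column, which it
has not left since it reached it, and the top row has height `h`. In state `top h i m ℓ`
it is in `(-i, h + 1)`, on the top row, which it has not left since it reached it, and `-m` is
the abscissa of the leftmost column. -/
inductive State
  | low (h m k : ℕ) (l : LowMark)
  | top (h i m : ℕ) (l : TopMark)

/-- The transitions of the automaton. -/
def State.step : State → Dir → Option State
  | .low h m k _, .left => some (.low h (m + 1) k .left)
  | .low _ _ _ .down, .up => none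
  | .low h m 0 _, .up => some (.top h m m .up)
  | .low h m (k + 1) _, .up => some (.low h m k .up)
  | .low _ _ _ .up, .down => none
  | .low h m k _, .down => some (.low h m (k + 1) .down)
  | .low _ _ _ _, .right => none
  | .top h i m _, .up => some (.top (h + 1) i m .up)
  | .top _ _ _ .right, .left => none
  | .top h i m _, .left =>
    if i < m then some (.top h (i + 1) m .left) else some (.low (h + 1) (m + 1) 0 .left)
  | .top _ _ _ .left, .right => none
  | .top _ 0 _ _, .right => none
  | .top h (i + 1) m _, .right => some (.top h i m .right)
  | .top _ _ _ _, .down => none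

/-- The state of the automaton after reading a walk. -/
def Walk.run (w : Walk) : Option State :=
  w.foldl (fun o d => o.bind (·.step d)) (some (.low 0 0 0 .left))

theorem Walk.run_nil : Walk.run [] = some (.low 0 0 0 .left) := rfl

theorem Walk.run_concat (w : Walk) (d : Dir) :
    Walk.run (w ++ [d]) = w.run.bind (·.step d) := by
  simp [Walk.run]

/-- What the state of the automaton says about the vertex set `V` and the last vertex `p` of a
walk. -/
def State.Describes (V : Set (ℤ × ℤ)) (p : ℤ × ℤ) : State → Prop
  | .low h m k l =>
    p = (-(m : ℤ), (h : ℤ) - k) ∧ p ∈ V ∧ (0, 0) ∈ V ∧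
    (∀ a ∈ V, -(m : ℤ) ≤ a.1 ∧ a.1 ≤ 0 ∧ a.2 ≤ h) ∧
    (∀ a ∈ V, ∀ y, a.2 ≤ y → y ≤ h → ∃ b ∈ V, b.2 = y) ∧
    (∀ a ∈ V, -(m : ℤ) < a.1 → ∀ y, a.2 ≤ y → y ≤ h → ∃ b ∈ V, -(m : ℤ) < b.1 ∧ b.2 = y) ∧
    (m = 0 → h = 0) ∧
    match l with
    | .left => (∀ a ∈ V, a.1 = -(m : ℤ) → a.2 = h - k) ∧ (m = 0 → k = 0) ∧
        (m ≠ 0 → (-(m : ℤ) + 1, (h : ℤ) - k) ∈ V)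
    | .down => (∀ a ∈ V, a.1 = -(m : ℤ) → (h : ℤ) - k ≤ a.2) ∧ (-(m : ℤ), (h : ℤ) - k + 1) ∈ V
    | .up => (∀ a ∈ V, a.1 = -(m : ℤ) → a.2 ≤ (h : ℤ) - k) ∧ (-(m : ℤ), (h : ℤ) - k - 1) ∈ V ∧
        (∃ a ∈ V, -(m : ℤ) < a.1 ∧ a.2 ≤ (h : ℤ) - k) ∧ m ≠ 0
  | .top h i m l =>
    p = (-(i : ℤ), (h : ℤ) + 1) ∧ i ≤ m ∧ p ∈ V ∧ (0, 0) ∈ V ∧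
    (∀ a ∈ V, -(m : ℤ) ≤ a.1 ∧ a.1 ≤ 0 ∧ a.2 ≤ h + 1) ∧
    (∀ a ∈ V, ∀ y, a.2 ≤ y → y ≤ h + 1 → ∃ b ∈ V, b.2 = y) ∧
    (∃ a ∈ V, a.1 = -(m : ℤ) ∧ 1 ≤ a.2) ∧ (∃ a ∈ V, a.1 = -(m : ℤ) ∧ a.2 ≤ h) ∧
    match l with
    | .up => ∀ a ∈ V, a.2 = h + 1 → a.1 = -(i : ℤ)
    | .left => (∀ a ∈ V, a.2 = h + 1 → -(i : ℤ) ≤ a.1) ∧ (-(i : ℤ) + 1, (h : ℤ) + 1) ∈ V ∧ 1 ≤ i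
    | .right => (∀ a ∈ V, a.2 = h + 1 → a.1 ≤ -(i : ℤ)) ∧ (-(i : ℤ) - 1, (h : ℤ) + 1) ∈ V ∧ i < m

theorem describes_init : State.Describes {0} 0 (.low 0 0 0 .left) := by
  simp [State.Describes]
  exact ⟨rfl, fun y h1 h2 => le_antisymm h1 h2⟩

/-- A left step out of the leftmost column always inflates the box, so no rule can forbid it. -/
theorem State.Describes.low_left {V : Set (ℤ × ℤ)} {p : ℤ × ℤ} {h m k : ℕ} {l : LowMark}
    (H : State.Describes V p (.low h m k l)) :
    Admissible V p .left ∧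
      State.Describes (insert (p + Dir.vec .left) V) (p + Dir.vec .left)
        (.low h (m + 1) k .left) := by
  obtain ⟨rfl, hp, h0, hb, hr, hr', hm, hl⟩ := H
  constructor
  · rw [admissible_left_iff]
    refine ⟨fun a ha _ => (hb a ha).1, .inl fun a ha => ?_, ?_⟩
    · have := (hb a ha).1; simp only; omega
    · rintro _ ⟨⟨a, ha, h1⟩, _⟩
      have := (hb a ha).1; simp only at h1; omega
  · have e : ((-(m : ℤ), (h : ℤ) - k) : ℤ × ℤ) + Dir.vec .left = (-((m + 1 : ℕ) : ℤ), (h : ℤ) - k) := by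
      simp [Dir.vec]; ring
    rw [e]
    refine ⟨rfl, Set.mem_insert _ _, Set.mem_insert_of_mem _ h0, ?_, ?_, ?_, by simp, ?_, by simp, ?_⟩
    · rintro a (rfl | ha)
      · simp
      · have := hb a ha; push_cast; omega
    · rintro a (rfl | ha) y h1 h2
      · obtain ⟨b, hb1, hb2⟩ := hr _ hp y h1 h2
        exact ⟨b, .inr hb1, hb2⟩
      · obtain ⟨b, hb1, hb2⟩ := hr _ ha y h1 h2
        exact ⟨b, .inr hb1, hb2⟩
    · rintro a (rfl | ha) h3 y h1 h2
      · simp at h3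
      · obtain ⟨b, hb1, hb2⟩ := hr _ ha y h1 h2
        refine ⟨b, .inr hb1, ?_, hb2⟩
        have := hb b hb1; push_cast; omega
    · rintro a (rfl | ha) h3
      · rfl
      · have := hb a ha; push_cast at h3; omega
    · intro _
      right
      convert hp using 2
      push_cast; ring

theorem State.Describes.low_down {V : Set (ℤ × ℤ)} {p : ℤ × ℤ} {h m k : ℕ} {l : LowMark}
    (H : State.Describes V p (.low h m k l)) (hne : l ≠ .up) :
    Admissible V p .down ∧
      State.Describes (insert (p + Dir.vec .down) V) (p + Dir.vec .down)
        (.low h m (k + 1) .down) := by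
  obtain ⟨rfl, hp, h0, hb, hr, hr', hm, hl⟩ := H
  have hcol : ∀ a ∈ V, a.1 = -(m : ℤ) → (h : ℤ) - k ≤ a.2 := by
    cases l with
    | left => exact fun a ha e => (hl.1 a ha e).ge
    | up => exact absurd rfl hne
    | down => exact hl.1
  constructor
  · rw [admissible_down_iff]
    exact ⟨hcol, .inl fun a ha => (hb a ha).1⟩
  · have e : ((-(m : ℤ), (h : ℤ) - k) : ℤ × ℤ) + Dir.vec .down =
        (-(m : ℤ), (h : ℤ) - (k + 1 : ℕ)) := by
      simp [Dir.vec]; ring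
    rw [e]
    refine ⟨rfl, Set.mem_insert _ _, Set.mem_insert_of_mem _ h0, ?_, ?_, ?_, hm, ?_, ?_⟩
    · rintro a (rfl | ha)
      · simp; omega
      · exact hb a ha
    · rintro a (rfl | ha) y h1 h2
      · rcases h1.eq_or_lt with h1 | h1
        · exact ⟨_, .inl rfl, h1⟩
        · obtain ⟨b, hb1, hb2⟩ := hr _ hp y (by push_cast at h1 ⊢; omega) h2
          exact ⟨b, .inr hb1, hb2⟩
      · obtain ⟨b, hb1, hb2⟩ := hr _ ha y h1 h2
        exact ⟨b, .inr hb1, hb2⟩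
    · rintro a (rfl | ha) h3 y h1 h2
      · simp at h3
      · obtain ⟨b, hb1, hb2⟩ := hr' _ ha h3 y h1 h2
        exact ⟨b, .inr hb1, hb2⟩
    · rintro a (rfl | ha) h3
      · exact le_rfl
      · have := hcol a ha h3; push_cast; omega
    · right
      convert hp using 2
      push_cast; ring

theorem State.Describes.low_up_succ {V : Set (ℤ × ℤ)} {p : ℤ × ℤ} {h m k : ℕ} {l : LowMark}
    (H : State.Describes V p (.low h m (k + 1) l)) (hne : l ≠ .down) :
    Admissible V p .up ∧
      State.Describes (insert (p + Dir.vec .up) V) (p + Dir.vec .up) (.low h m k .up) := by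
  obtain ⟨rfl, hp, h0, hb, hr, hr', hm, hl⟩ := H
  have hcol : ∀ a ∈ V, a.1 = -(m : ℤ) → a.2 ≤ (h : ℤ) - (k + 1 : ℕ) := by
    cases l with
    | left => exact fun a ha e => (hl.1 a ha e).le
    | down => exact absurd rfl hne
    | up => exact hl.1
  -- Climbing below the top row happens only to the left of the origin: with mark `left`, `m = 0` is
  -- the starting state, whose depth is 0.
  have hm0 : m ≠ 0 := by
    cases l with
    | left => intro e; simpa using hl.2.1 e
    | down => exact absurd rfl hne
    | up => exact hl.2.2.2
  have hlow : ∃ a ∈ V, -(m : ℤ) < a.1 ∧ a.2 ≤ (h : ℤ) - (k + 1 : ℕ) := by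
    cases l with
    | left => exact ⟨_, hl.2.2 hm0, by simp, le_rfl⟩
    | down => exact absurd rfl hne
    | up => exact hl.2.2.1
  constructor
  · rw [admissible_up_iff]
    exact ⟨hcol, .inl fun a ha => (hb a ha).1⟩
  · have e : ((-(m : ℤ), (h : ℤ) - (k + 1 : ℕ)) : ℤ × ℤ) + Dir.vec .up =
        (-(m : ℤ), (h : ℤ) - k) := by
      simp [Dir.vec]; ring
    rw [e]
    refine ⟨rfl, Set.mem_insert _ _, Set.mem_insert_of_mem _ h0, ?_, ?_, ?_, hm, ?_, ?_, ?_, hm0⟩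
    · rintro a (rfl | ha)
      · simp
      · exact hb a ha
    · rintro a (rfl | ha) y h1 h2
      · obtain ⟨b, hb1, hb2⟩ := hr _ hp y (by push_cast at h1 ⊢; omega) h2
        exact ⟨b, .inr hb1, hb2⟩
      · obtain ⟨b, hb1, hb2⟩ := hr _ ha y h1 h2
        exact ⟨b, .inr hb1, hb2⟩
    · rintro a (rfl | ha) h3 y h1 h2
      · simp at h3
      · obtain ⟨b, hb1, hb2⟩ := hr' _ ha h3 y h1 h2
        exact ⟨b, .inr hb1, hb2⟩
    · rintro a (rfl | ha) h3
      · exact le_rfl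
      · have := hcol a ha h3; push_cast at this; omega
    · right
      convert hp using 2
      push_cast; ring
    · obtain ⟨a, ha, h1, h2⟩ := hlow
      exact ⟨a, .inr ha, h1, by push_cast at h2; omega⟩

theorem State.Describes.low_up_zero {V : Set (ℤ × ℤ)} {p : ℤ × ℤ} {h m : ℕ} {l : LowMark}
    (H : State.Describes V p (.low h m 0 l)) :
    Admissible V p .up ∧
      State.Describes (insert (p + Dir.vec .up) V) (p + Dir.vec .up) (.top h m m .up) := by
  obtain ⟨rfl, hp, h0, hb, hr, hr', hm, hl⟩ := H
  constructor
  · rw [admissible_up_iff]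
    exact ⟨fun a ha _ => by simpa using (hb a ha).2.2, .inl fun a ha => (hb a ha).1⟩
  · have e : ((-(m : ℤ), (h : ℤ) - (0 : ℕ)) : ℤ × ℤ) + Dir.vec .up = (-(m : ℤ), (h : ℤ) + 1) := by
      simp [Dir.vec]
    rw [e]
    refine ⟨rfl, le_rfl, Set.mem_insert _ _, Set.mem_insert_of_mem _ h0, ?_, ?_,
      ⟨_, .inl rfl, rfl, by simp⟩, ⟨_, .inr hp, rfl, by simp⟩, ?_⟩
    · rintro a (rfl | ha)
      · simp
      · have := hb a ha; omega
    · rintro a (rfl | ha) y h1 h2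
      · exact ⟨_, .inl rfl, by simp at h1; omega⟩
      · rcases h2.eq_or_lt with h2 | h2
        · exact ⟨_, .inl rfl, h2.symm⟩
        · obtain ⟨b, hb1, hb2⟩ := hr _ ha y h1 (by omega)
          exact ⟨b, .inr hb1, hb2⟩
    · rintro a (rfl | ha) h3
      · rfl
      · have := hb a ha; omega

theorem State.Describes.top_up {V : Set (ℤ × ℤ)} {p : ℤ × ℤ} {h i m : ℕ} {l : TopMark}
    (H : State.Describes V p (.top h i m l)) :
    Admissible V p .up ∧
      State.Describes (insert (p + Dir.vec .up) V) (p + Dir.vec .up) (.top (h + 1) i m .up) := by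
  obtain ⟨rfl, him, hp, h0, hb, hr, ⟨a₁, ha₁, h₁, h₁'⟩, ⟨a₂, ha₂, h₂, h₂'⟩, hl⟩ := H
  constructor
  · rw [admissible_up_iff]
    refine ⟨fun a ha _ => (hb a ha).2.2, .inr (.inl fun a ha => ?_)⟩
    have := (hb a ha).2.2
    simp only; omega
  · have e : ((-(i : ℤ), (h : ℤ) + 1) : ℤ × ℤ) + Dir.vec .up =
        (-(i : ℤ), ((h + 1 : ℕ) : ℤ) + 1) := by
      simp [Dir.vec]
    rw [e]
    refine ⟨rfl, him, Set.mem_insert _ _, Set.mem_insert_of_mem _ h0, ?_, ?_,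
      ⟨_, .inr ha₁, h₁, h₁'⟩, ⟨_, .inr ha₂, h₂, by push_cast; omega⟩, ?_⟩
    · rintro a (rfl | ha)
      · simpa using him
      · have := hb a ha; push_cast; omega
    · rintro a (rfl | ha) y h1 h2
      · exact ⟨_, .inl rfl, by simp at h1; push_cast at *; omega⟩
      · rcases h2.eq_or_lt with h2 | h2
        · exact ⟨_, .inl rfl, h2.symm⟩
        · obtain ⟨b, hb1, hb2⟩ := hr _ ha y h1 (by push_cast at h2; omega)
          exact ⟨b, .inr hb1, hb2⟩
    · rintro a (rfl | ha) h3
      · rfl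
      · have := hb a ha; push_cast at h3; omega

theorem State.Describes.top_row {V : Set (ℤ × ℤ)} {p : ℤ × ℤ} {h i m : ℕ} {l : TopMark}
    (H : State.Describes V p (.top h i m l)) (hne : l ≠ .right) :
    ∀ a ∈ V, a.2 = h + 1 → -(i : ℤ) ≤ a.1 := by
  obtain ⟨rfl, him, hp, h0, hb, hr, _, _, hl⟩ := H
  cases l with
  | left => exact hl.1
  | up => exact fun a ha e => (hl a ha e).ge
  | right => exact absurd rfl hne

theorem State.Describes.top_row' {V : Set (ℤ × ℤ)} {p : ℤ × ℤ} {h i m : ℕ} {l : TopMark}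
    (H : State.Describes V p (.top h i m l)) (hne : l ≠ .left) :
    ∀ a ∈ V, a.2 = h + 1 → a.1 ≤ -(i : ℤ) := by
  obtain ⟨rfl, him, hp, h0, hb, hr, _, _, hl⟩ := H
  cases l with
  | right => exact hl.1
  | up => exact fun a ha e => (hl a ha e).le
  | left => exact absurd rfl hne

theorem State.Describes.top_left_lt {V : Set (ℤ × ℤ)} {p : ℤ × ℤ} {h i m : ℕ} {l : TopMark}
    (H : State.Describes V p (.top h i m l)) (hne : l ≠ .right) (hi : i < m) :
    Admissible V p .left ∧
      State.Describes (insert (p + Dir.vec .left) V) (p + Dir.vec .left)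
        (.top h (i + 1) m .left) := by
  have hrow := H.top_row hne
  obtain ⟨rfl, him, hp, h0, hb, hr, ⟨a₁, ha₁, h₁, h₁'⟩, ⟨a₂, ha₂, h₂, h₂'⟩, hl⟩ := H
  constructor
  · rw [admissible_left_iff]
    refine ⟨hrow, .inr (.inl fun a ha => (hb a ha).2.2), fun h1 => ?_⟩
    have := h1 _ h0
    simp only at this; omega
  · have e : ((-(i : ℤ), (h : ℤ) + 1) : ℤ × ℤ) + Dir.vec .left =
        (-((i + 1 : ℕ) : ℤ), (h : ℤ) + 1) := by
      simp [Dir.vec]; ring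
    rw [e]
    refine ⟨rfl, hi, Set.mem_insert _ _, Set.mem_insert_of_mem _ h0, ?_, ?_,
      ⟨_, .inr ha₁, h₁, h₁'⟩, ⟨_, .inr ha₂, h₂, h₂'⟩, ?_, ?_, by omega⟩
    · rintro a (rfl | ha)
      · simp; omega
      · exact hb a ha
    · rintro a (rfl | ha) y h1 h2
      · exact ⟨_, .inl rfl, by simp at h1; omega⟩
      · obtain ⟨b, hb1, hb2⟩ := hr _ ha y h1 h2
        exact ⟨b, .inr hb1, hb2⟩
    · rintro a (rfl | ha) h3
      · exact le_rfl
      · have := hrow a ha h3; push_cast; omega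
    · right
      convert hp using 2
      push_cast; ring

/-- Passing the left end of the top row opens a new column, entered at depth 0; the top row at
height `h + 1` is now the reference height of a low state. -/
theorem State.Describes.top_left_eq {V : Set (ℤ × ℤ)} {p : ℤ × ℤ} {h i m : ℕ} {l : TopMark}
    (H : State.Describes V p (.top h i m l)) (hi : ¬ i < m) :
    Admissible V p .left ∧
      State.Describes (insert (p + Dir.vec .left) V) (p + Dir.vec .left)
        (.low (h + 1) (m + 1) 0 .left) := by
  obtain ⟨rfl, him, hp, h0, hb, hr, ⟨a₁, ha₁, h₁, h₁'⟩, ⟨a₂, ha₂, h₂, h₂'⟩, hl⟩ := H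
  obtain rfl : i = m := by omega
  constructor
  · rw [admissible_left_iff]
    refine ⟨fun a ha _ => (hb a ha).1, .inl fun a ha => ?_, fun h1 => ?_⟩
    · have := (hb a ha).1; simp only; omega
    · have := h1 _ h0
      simp only at this; omega
  · have e : ((-(i : ℤ), (h : ℤ) + 1) : ℤ × ℤ) + Dir.vec .left =
        (-((i + 1 : ℕ) : ℤ), ((h + 1 : ℕ) : ℤ) - (0 : ℕ)) := by
      simp [Dir.vec]; ring
    rw [e]
    refine ⟨rfl, Set.mem_insert _ _, Set.mem_insert_of_mem _ h0, ?_, ?_, ?_, by simp, ?_, by simp, ?_⟩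
    · rintro a (rfl | ha)
      · simp
      · have := hb a ha; push_cast; omega
    · rintro a (rfl | ha) y h1 h2
      · exact ⟨_, .inl rfl, by simp at h1 ⊢; push_cast at *; omega⟩
      · obtain ⟨b, hb1, hb2⟩ := hr _ ha y h1 (by push_cast at h2; omega)
        exact ⟨b, .inr hb1, hb2⟩
    · rintro a (rfl | ha) h3 y h1 h2
      · simp at h3
      · obtain ⟨b, hb1, hb2⟩ := hr _ ha y h1 (by push_cast at h2; omega)
        refine ⟨b, .inr hb1, ?_, hb2⟩
        have := hb b hb1; push_cast; omega
    · rintro a (rfl | ha) h3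
      · rfl
      · have := hb a ha; push_cast at h3; omega
    · intro _
      right
      convert hp using 2
      · push_cast; ring
      · push_cast; ring

theorem State.Describes.top_right_succ {V : Set (ℤ × ℤ)} {p : ℤ × ℤ} {h i m : ℕ} {l : TopMark}
    (H : State.Describes V p (.top h (i + 1) m l)) (hne : l ≠ .left) :
    Admissible V p .right ∧
      State.Describes (insert (p + Dir.vec .right) V) (p + Dir.vec .right)
        (.top h i m .right) := by
  have hrow := H.top_row' hne
  obtain ⟨rfl, him, hp, h0, hb, hr, ⟨a₁, ha₁, h₁, h₁'⟩, ⟨a₂, ha₂, h₂, h₂'⟩, hl⟩ := H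
  constructor
  · rw [admissible_right_iff]
    refine ⟨hrow, .inr (.inl fun a ha => (hb a ha).2.2), fun h1 => ?_⟩
    have := h1 _ h0
    simp only at this; omega
  · have e : ((-((i + 1 : ℕ) : ℤ), (h : ℤ) + 1) : ℤ × ℤ) + Dir.vec .right =
        (-(i : ℤ), (h : ℤ) + 1) := by
      simp [Dir.vec]
    rw [e]
    refine ⟨rfl, by omega, Set.mem_insert _ _, Set.mem_insert_of_mem _ h0, ?_, ?_,
      ⟨_, .inr ha₁, h₁, h₁'⟩, ⟨_, .inr ha₂, h₂, h₂'⟩, ?_, ?_, by omega⟩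
    · rintro a (rfl | ha)
      · simp; omega
      · exact hb a ha
    · rintro a (rfl | ha) y h1 h2
      · exact ⟨_, .inl rfl, by simp at h1; omega⟩
      · obtain ⟨b, hb1, hb2⟩ := hr _ ha y h1 h2
        exact ⟨b, .inr hb1, hb2⟩
    · rintro a (rfl | ha) h3
      · exact le_rfl
      · have := hrow a ha h3; push_cast at this; omega
    · right
      convert hp using 2
      push_cast; ring

theorem State.Describes.step {V : Set (ℤ × ℤ)} {p : ℤ × ℤ} {st st' : State} {d : Dir}
    (H : st.Describes V p) (hs : st.step d = some st') :
    Admissible V p d ∧ st'.Describes (insert (p + d.vec) V) (p + d.vec) := by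
  rcases st with ⟨h, m, k, l⟩ | ⟨h, i, m, l⟩
  · cases d with
    | left =>
      simp only [State.step, Option.some.injEq] at hs
      subst hs; exact H.low_left
    | right => simp [State.step] at hs
    | up =>
      rcases k with _ | k <;> cases l <;> simp only [State.step, Option.some.injEq, reduceCtorEq] at hs
        <;> subst hs
      exacts [H.low_up_zero, H.low_up_zero, H.low_up_succ (by simp), H.low_up_succ (by simp)]
    | down =>
      cases l <;> simp only [State.step, Option.some.injEq, reduceCtorEq] at hs <;> subst hs
      exacts [H.low_down (by simp), H.low_down (by simp)]
  · cases d with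
    | up =>
      simp only [State.step, Option.some.injEq] at hs
      subst hs; exact H.top_up
    | down => simp [State.step] at hs
    | left =>
      by_cases hi : i < m
      · cases l <;> simp only [State.step, if_pos hi, Option.some.injEq, reduceCtorEq] at hs <;> subst hs
        exacts [H.top_left_lt (by simp) hi, H.top_left_lt (by simp) hi]
      · cases l <;> simp only [State.step, if_neg hi, Option.some.injEq, reduceCtorEq] at hs <;> subst hs
        exacts [H.top_left_eq hi, H.top_left_eq hi]
    | right =>
      rcases i with _ | i <;> cases l <;> simp only [State.step, Option.some.injEq, reduceCtorEq] at hs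
        <;> subst hs
      exacts [H.top_right_succ (by simp), H.top_right_succ (by simp)]

/-- If the automaton refuses a step that is admissible, then this step leaves the
half-plane `x ≤ 0`. -/
theorem State.Describes.eq_right {V : Set (ℤ × ℤ)} {p : ℤ × ℤ} {st : State} {d : Dir}
    (H : st.Describes V p) (hs : st.step d = none) (had : Admissible V p d) :
    d = .right ∧ p.1 = 0 := by
  rcases st with ⟨h, m, k, l⟩ | ⟨h, i, m, l⟩
  · obtain ⟨rfl, hp, h0, hb, hr, hr', hm, hl⟩ := H
    cases d with
    | left => simp [State.step] at hs
    | up =>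
      rcases k with _ | k <;> cases l <;> simp only [State.step, reduceCtorEq] at hs
      all_goals
        rw [admissible_up_iff] at had
        have := had.1 _ hl.2 rfl
        simp only at this
        omega
    | down =>
      cases l <;> simp only [State.step, reduceCtorEq] at hs
      rw [admissible_down_iff] at had
      have := had.1 _ hl.2.1 rfl
      simp only at this
      omega
    | right =>
      refine ⟨rfl, ?_⟩
      by_contra hm0
      have hm0 : m ≠ 0 := by simpa using hm0
      rw [admissible_right_iff] at had
      obtain ⟨h1, h2, h3⟩ := had
      -- A vertex off the leftmost column at or below the current height would, by the row
      -- invariant, force one in the current row to the right, which blocks the right step. Marks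
      -- `left` and `up` supply such a vertex.
      have hno : ∀ a ∈ V, -(m : ℤ) < a.1 → (h : ℤ) - k < a.2 := by
        intro a ha h4
        by_contra! h5
        obtain ⟨b, hb1, hb2, hb3⟩ := hr' a ha h4 _ h5 (by omega)
        have := h1 b hb1 hb3
        simp only at this; omega
      cases l with
      | left => have := hno _ (hl.2.2 hm0) (by simp); simp at this
      | up =>
        obtain ⟨a, ha, h4, h5⟩ := hl.2.2.1
        have := hno a ha h4; omega
      | down =>
        -- With mark `down` the walk is on the bottom side and its right step stays inside the box:
        -- the extra rule for bottom steps forbids it.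
        refine h3 (fun a ha => ?_) ⟨⟨_, hp, by simp⟩, ⟨_, h0, by simp; omega⟩, ⟨_, hp, le_rfl⟩,
          ⟨_, hp, le_rfl⟩⟩
        rcases (hb a ha).1.eq_or_lt with h4 | h4
        · exact hl.1 a ha h4.symm
        · exact (hno a ha h4).le
  · obtain ⟨rfl, him, hp, h0, hb, hr, ⟨a₁, ha₁, h₁, h₁'⟩, ⟨a₂, ha₂, h₂, h₂'⟩, hl⟩ := H
    cases d with
    | up => simp [State.step] at hs
    | left =>
      cases l <;> simp only [State.step] at hs
      · split_ifs at hs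
      · split_ifs at hs
      · rw [admissible_left_iff] at had
        have := had.1 _ hl.2.1 rfl
        simp only at this; omega
    | right =>
      rcases i with _ | i
      · exact ⟨rfl, by simp⟩
      · cases l <;> simp only [State.step, reduceCtorEq] at hs
        rw [admissible_right_iff] at had
        have := had.1 _ hl.2.1 rfl
        simp only at this; omega
    | down =>
      rw [admissible_down_iff] at had
      -- On the left side a vertex of the leftmost column lies below and blocks; the top side is
      -- left by going down; on the right side the walk is above the origin, which blocks.
      obtain ⟨h1, h2 | h2 | h2⟩ := had
      · have h3 := h2 _ ha₂
        have h4 := hb _ ha₂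
        simp only at h3
        have := h1 _ ha₂ (by simp only; omega)
        simp only at this; omega
      · have := h2 _ hp; simp only at this; omega
      · have h3 := h2 _ h0
        simp only at h3
        have := h1 _ h0 (by simp only; omega)
        simp only at this; omega

theorem Walk.describes_of_run {w : Walk} {st : State} (h : w.run = some st) :
    w.IsThreeSided ∧ st.Describes w.support w.endpoint := by
  induction w using List.reverseRecOn generalizing st with
  | nil =>
    obtain rfl : State.low 0 0 0 .left = st := by simpa [Walk.run_nil] using h
    refine ⟨isThreeSided_nil, ?_⟩
    rw [Walk.support_nil]
    exact describes_init
  | append_singleton l d ih =>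
    rw [Walk.run_concat] at h
    obtain ⟨st₀, h₀, h₁⟩ := Option.bind_eq_some_iff.mp h
    obtain ⟨h2, h3⟩ := ih h₀
    obtain ⟨h4, h5⟩ := h3.step h₁
    rw [isThreeSided_concat, Walk.support_concat, Walk.endpoint_concat]
    exact ⟨⟨h2, h4⟩, h5⟩

/-- Completeness of the automaton: by `State.Describes.eq_right` a refused admissible step would
enter the column x = 1. -/
theorem Walk.IsThreeSided.exists_run {w : Walk} (hw : w.IsThreeSided)
    (hx : ∀ a ∈ w.support, a.1 ≤ 0) : ∃ st, w.run = some st := by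
  induction w using List.reverseRecOn with
  | nil => exact ⟨_, Walk.run_nil⟩
  | append_singleton l d ih =>
    rw [isThreeSided_concat] at hw
    rw [Walk.support_concat] at hx
    obtain ⟨st, hst⟩ := ih hw.1 fun a ha => hx a (.inr ha)
    rw [Walk.run_concat, hst]
    have hD := (Walk.describes_of_run hst).2
    cases hs : st.step d with
    | some st' => exact ⟨st', hs⟩
    | none =>
      obtain ⟨rfl, h0⟩ := hD.eq_right hs hw.2
      have := hx _ (.inl rfl)
      simp [Dir.vec, h0] at this

end PrudentPolygon

/-! ### Reflection, the cost of a walk, and first exits from x ≤ 0 or x ≥ 0 -/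

namespace PrudentPolygon

instance : DecidableEq Dir := fun a b => by
  cases a <;> cases b <;> first | exact isTrue rfl | exact isFalse (by simp)

instance : Fintype Dir :=
  ⟨{Dir.left, Dir.right, Dir.up, Dir.down}, fun d => by cases d <;> simp⟩

/-- The mirror image of a step in the vertical axis. -/
def Dir.mirror : Dir → Dir
  | .left => .right
  | .right => .left
  | .up => .up
  | .down => .down

theorem Dir.mirror_mirror (d : Dir) : d.mirror.mirror = d := by cases d <;> rfl

theorem Dir.vec_mirror (d : Dir) : d.mirror.vec = (-d.vec.1, d.vec.2) := by cases d <;> rfl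

/-- The mirror image of a walk in the vertical axis. -/
def Walk.mirror (w : Walk) : Walk := w.map Dir.mirror

theorem Walk.mirror_mirror (w : Walk) : w.mirror.mirror = w := by
  simp [Walk.mirror, Function.comp_def, Dir.mirror_mirror]

theorem Walk.mirror_injective : Function.Injective Walk.mirror :=
  Function.LeftInverse.injective Walk.mirror_mirror

theorem Walk.length_mirror (w : Walk) : w.mirror.length = w.length := by simp [Walk.mirror]

theorem Walk.vertex_mirror (w : Walk) (i : ℕ) :
    w.mirror.vertex i = (-(w.vertex i).1, (w.vertex i).2) := by
  unfold Walk.vertex Walk.mirror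
  rw [← List.map_take]
  induction w.take i with
  | nil => simp [Prod.ext_iff]
  | cons d l ih =>
    simp only [List.map_cons, List.sum_cons, ih, Dir.vec_mirror, Prod.mk_add_mk, Prod.fst_add,
      Prod.snd_add, neg_add]

theorem Walk.endpoint_mirror (w : Walk) :
    w.mirror.endpoint = (-w.endpoint.1, w.endpoint.2) := by
  rw [Walk.endpoint, Walk.length_mirror, Walk.vertex_mirror, Walk.endpoint]

theorem Walk.mem_support_mirror {w : Walk} {a : ℤ × ℤ} :
    a ∈ w.mirror.support ↔ (-a.1, a.2) ∈ w.support := by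
  simp only [Walk.support, Walk.length_mirror, Walk.vertex_mirror, Set.mem_ofPred_eq]
  refine exists_congr fun j => and_congr_right fun _ => ?_
  simp only [Prod.ext_iff]
  constructor <;> rintro ⟨h1, h2⟩ <;> exact ⟨by omega, h2⟩

theorem Walk.IsThreeSided.mirror {w : Walk} (hw : w.IsThreeSided) : w.mirror.IsThreeSided := by
  obtain ⟨h1, h2⟩ := hw
  refine ⟨fun i hi j hj k hk e => ?_, fun i hi => ?_⟩
  · have hi' := hi
    rw [Walk.length_mirror] at hi'
    have hg : w.mirror[i] = (w[i]).mirror := by simp [Walk.mirror]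
    rw [hg, Dir.vec_mirror, Walk.vertex_mirror, Walk.vertex_mirror, Prod.ext_iff] at e
    refine h1 i hi' j hj k hk (Prod.ext ?_ ?_)
    · have := e.1
      simp only [Prod.fst_add, Prod.smul_fst, smul_neg] at this ⊢
      linarith
    · simpa using e.2
  · have hi' := hi
    rw [Walk.length_mirror] at hi'
    obtain ⟨h3, h4⟩ := h2 i hi'
    refine ⟨?_, fun h5 h6 h7 => h4 ?_ ?_ ?_⟩
    · simp only [Walk.OnLeft, Walk.OnTop, Walk.OnRight, Walk.vertex_mirror, neg_le_neg_iff] at h3 ⊢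
      rcases h3 with h3 | h3 | h3
      exacts [.inr (.inr h3), .inr (.inl h3), .inl h3]
    · simp only [Walk.mirror, List.getElem_map] at h5
      revert h5
      generalize w[i] = d
      cases d <;> simp [Dir.mirror]
    · simpa only [Walk.OnBottom, Walk.vertex_mirror] using h6
    · simp only [Walk.InBox, Walk.vertex_mirror, neg_le_neg_iff] at h7 ⊢
      obtain ⟨⟨a, ha, h⟩, ⟨b, hb, h'⟩, h8⟩ := h7
      exact ⟨⟨b, hb, h'⟩, ⟨a, ha, h⟩, h8⟩

/-- A bookkeeping weight: the number of left and up steps. -/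
def Dir.cost : Dir → ℕ
  | .left => 1
  | .right => 0
  | .up => 1
  | .down => 0

/-- The number of left and up steps of a walk. -/
def Walk.cost (w : Walk) : ℕ := (w.map Dir.cost).sum

theorem Walk.cost_concat (w : Walk) (d : Dir) :
    Walk.cost (w ++ [d]) = w.cost + d.cost := by simp [Walk.cost]

/-- Right minus left steps give the abscissa, up minus down steps the ordinate, so right and down
steps can be traded for left and up ones. Hence for closed walks the cost measures the
half-perimeter up to a constant. -/
theorem Walk.length_eq (w : Walk) :
    (w.length : ℤ) = 2 * w.cost + w.endpoint.1 - w.endpoint.2 := by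
  induction w using List.reverseRecOn with
  | nil => simp [Walk.cost, Walk.endpoint, Walk.vertex]
  | append_singleton l d ih =>
    rw [Walk.endpoint_concat, Walk.cost_concat]
    cases d <;> simp [Dir.vec, Dir.cost] <;> linarith

theorem Walk.endpoint_ne_zero {w : Walk} {d : Dir} (h : Walk.IsThreeSided (w ++ [d])) :
    Walk.endpoint (w ++ [d]) ≠ 0 := by
  rw [isThreeSided_concat] at h
  rw [Walk.endpoint_concat]
  intro e
  have := h.2.1 1 le_rfl
  rw [one_smul, e] at this
  exact this w.zero_mem_support

theorem Walk.run_replicate_down (k : ℕ) :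
    Walk.run (List.replicate (k + 1) Dir.down) = some (.low 0 0 (k + 1) .down) := by
  induction k with
  | zero => rfl
  | succ k ih => rw [List.replicate_succ', Walk.run_concat, ih]; rfl

/-- Without a left step a low state is reached only by going down: the first up step leads to the
top row, and up after down is refused. -/
theorem Walk.eq_replicate_of_run {w : Walk} {h k : ℕ} {l : LowMark}
    (hw : w.run = some (.low h 0 k l)) : w = List.replicate k .down := by
  induction w using List.reverseRecOn generalizing h k l with
  | nil =>
    simp only [Walk.run_nil, Option.some.injEq, State.low.injEq] at hw
    obtain ⟨-, -, rfl, -⟩ := hw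
    rfl
  | append_singleton w d ih =>
    rw [Walk.run_concat] at hw
    obtain ⟨st, h₀, h₁⟩ := Option.bind_eq_some_iff.mp hw
    rcases st with ⟨h', m', k', l'⟩ | ⟨h', i', m', l'⟩
    · cases d with
      | left => simp [State.step] at h₁
      | right => simp [State.step] at h₁
      | up =>
        rcases k' with _ | k' <;> cases l' <;>
          simp only [State.step, Option.some.injEq, reduceCtorEq, State.low.injEq] at h₁
        all_goals
          obtain ⟨rfl, rfl, rfl, rfl⟩ := h₁
          have := ih h₀
          subst this
          rw [Walk.run_replicate_down] at h₀
          simp at h₀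
      | down =>
        cases l' <;> simp only [State.step, Option.some.injEq, reduceCtorEq, State.low.injEq] at h₁
        all_goals
          obtain ⟨rfl, rfl, rfl, rfl⟩ := h₁
          rw [ih h₀, List.replicate_succ']
    · cases d with
      | left =>
        cases l' <;> simp only [State.step, reduceCtorEq] at h₁
        all_goals split_ifs at h₁ <;> simp at h₁
      | up => simp [State.step] at h₁
      | down => simp [State.step] at h₁
      | right => rcases i' with _ | i' <;> cases l' <;> simp [State.step] at h₁

/-- Entering the column x = -1 from a top row happens at depth 0. Positive depth with mark `left`,
and likewise any later climb, therefore traces back to a straight descent followed by one left step.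
-/
theorem Walk.eq_of_run_low_one {w : Walk} {h k : ℕ} {l : LowMark}
    (hw : w.run = some (.low h 1 k l)) :
    (l = .left → k ≠ 0 → w = List.replicate k .down ++ [.left]) ∧
    (l = .up → ∃ j, w = List.replicate (k + (j + 1)) .down ++ .left :: List.replicate (j + 1) .up) := by
  induction w using List.reverseRecOn generalizing h k l with
  | nil => simp [Walk.run_nil] at hw
  | append_singleton w d ih =>
    rw [Walk.run_concat] at hw
    obtain ⟨st, h₀, h₁⟩ := Option.bind_eq_some_iff.mp hw
    rcases st with ⟨h', m', k', l'⟩ | ⟨h', i', m', l'⟩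
    · cases d with
      | left =>
        simp only [State.step, Option.some.injEq, State.low.injEq] at h₁
        obtain ⟨rfl, hm, rfl, rfl⟩ := h₁
        obtain rfl : m' = 0 := by omega
        rw [Walk.eq_replicate_of_run h₀]
        simp
      | right => simp [State.step] at h₁
      | up =>
        rcases k' with _ | k' <;> cases l' <;>
          simp only [State.step, Option.some.injEq, reduceCtorEq, State.low.injEq] at h₁
        · obtain ⟨rfl, rfl, rfl, rfl⟩ := h₁
          refine ⟨by simp, fun _ => ⟨0, ?_⟩⟩
          rw [(ih h₀).1 rfl (by simp)]
          simp
        · obtain ⟨rfl, rfl, rfl, rfl⟩ := h₁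
          obtain ⟨j, hj⟩ := (ih h₀).2 rfl
          refine ⟨by simp, fun _ => ⟨j + 1, ?_⟩⟩
          rw [hj, List.replicate_succ' (n := j + 1)]
          simp only [List.append_assoc, List.cons_append]
          congr 2
          omega
      | down =>
        cases l' <;> simp only [State.step, Option.some.injEq, reduceCtorEq, State.low.injEq] at h₁
        all_goals
          obtain ⟨rfl, rfl, rfl, rfl⟩ := h₁
          simp
    · cases d with
      | left =>
        cases l' <;> simp only [State.step, reduceCtorEq] at h₁
        all_goals
          split_ifs at h₁ <;> simp only [Option.some.injEq, reduceCtorEq, State.low.injEq] at h₁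
          obtain ⟨rfl, hm, rfl, rfl⟩ := h₁
          simp
      | up => simp [State.step] at h₁
      | down => simp [State.step] at h₁
      | right => rcases i' with _ | i' <;> cases l' <;> simp [State.step] at h₁

/-- A walk that leaves the half-plane `x ≤ 0` does so by a right step from the column
`x = 0`. -/
theorem Walk.exists_first_exit {w : Walk} (hx : ∃ a ∈ w.support, 1 ≤ a.1) :
    ∃ v w' : Walk, w = v ++ .right :: w' ∧ (∀ a ∈ v.support, a.1 ≤ 0) ∧ v.endpoint.1 = 0 := by
  induction w using List.reverseRecOn with
  | nil => simp [Walk.support_nil] at hx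
  | append_singleton l d ih =>
    by_cases h : ∃ a ∈ Walk.support l, 1 ≤ a.1
    · obtain ⟨v, w', e, h'⟩ := ih h
      exact ⟨v, w' ++ [d], by simp [e], h'⟩
    · push Not at h
      rw [Walk.support_concat] at hx
      obtain ⟨a, rfl | ha, h1⟩ := hx
      · have h2 := h _ (Walk.endpoint_mem_support l)
        cases d <;> simp [Dir.vec] at h1
        · omega
        · exact ⟨l, [], rfl, fun a ha => by have := h a ha; omega, by omega⟩
        · omega
        · omega
      · have := h a ha; omega

/-- A low state is in the leftmost column; if that is x = 0, the walk has never gone left. Otherwise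
the walk has returned to x = 0 along its top row. -/
theorem Walk.IsThreeSided.run_of_endpoint {v : Walk} (hv : v.IsThreeSided)
    (hx : ∀ a ∈ v.support, a.1 ≤ 0) (h0 : v.endpoint.1 = 0) :
    (∃ k l, v.run = some (.low 0 0 k l) ∧ v.endpoint = (0, -(k : ℤ)) ∧
      ∀ a ∈ v.support, 0 ≤ a.1) ∨
    ∃ h m l, v.run = some (.top h 0 m l) ∧ v.endpoint = (0, (h : ℤ) + 1) := by
  obtain ⟨st, hst⟩ := hv.exists_run hx
  have hD := (Walk.describes_of_run hst).2
  rcases st with ⟨h, m, k, l⟩ | ⟨h, i, m, l⟩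
  · left
    obtain ⟨e, -, -, hb, -, -, hm, -⟩ := hD
    rw [e] at h0
    obtain rfl : m = 0 := by simpa using h0
    obtain rfl := hm rfl
    exact ⟨k, l, hst, by simpa using e, fun a ha => by simpa using (hb a ha).1⟩
  · right
    have e := hD.1
    rw [e] at h0
    obtain rfl : i = 0 := by simpa using h0
    exact ⟨h, m, l, hst, by simpa using e⟩

theorem Walk.endpoint_append_singleton_mem (v w' : Walk) (d : Dir) :
    v.endpoint + d.vec ∈ Walk.support (v ++ d :: w') := by
  rw [← Walk.endpoint_concat, show v ++ d :: w' = (v ++ [d]) ++ w' by simp]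
  exact Walk.support_append_subset _ _ (Walk.endpoint_mem_support _)

/-- The possible ways for a walk to visit the column `x = 1` for the first time. -/
theorem Walk.IsThreeSided.exit_cases {w : Walk} (hw : w.IsThreeSided)
    (hx : ∃ a ∈ w.support, 1 ≤ a.1) :
    ∃ v w' : Walk, w = v ++ .right :: w' ∧ (∀ a ∈ v.support, a.1 ≤ 0) ∧
      ((∃ k l, v.run = some (.low 0 0 k l) ∧ v.endpoint = (0, -(k : ℤ)) ∧
        ∀ a ∈ v.support, 0 ≤ a.1) ∨
      ∃ h m l, v.run = some (.top h 0 m l) ∧ v.endpoint = (0, (h : ℤ) + 1)) := by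
  obtain ⟨v, w', rfl, h1, h2⟩ := Walk.exists_first_exit hx
  exact ⟨v, w', rfl, h1, (isThreeSided_of_append hw).run_of_endpoint h1 h2⟩

/-- The possible ways for a walk to visit the column `x = -1` for the first time. -/
theorem Walk.IsThreeSided.exit_cases' {w : Walk} (hw : w.IsThreeSided)
    (hx : ∃ a ∈ w.support, a.1 ≤ -1) :
    ∃ v w' : Walk, w = v ++ .left :: w' ∧ (∀ a ∈ v.support, 0 ≤ a.1) ∧
      ((∃ k : ℕ, v.endpoint = (0, -(k : ℤ)) ∧ v = List.replicate k .down) ∨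
      ∃ h : ℕ, v.endpoint = (0, (h : ℤ) + 1)) := by
  obtain ⟨a, ha, ha1⟩ := hx
  obtain ⟨v, w', e, h1, h2⟩ := hw.mirror.exit_cases
    ⟨(-a.1, a.2), by rw [Walk.mem_support_mirror]; simpa using ha, by simp only; omega⟩
  refine ⟨v.mirror, w'.mirror, ?_, fun a ha => ?_, ?_⟩
  · rw [← w.mirror_mirror, e]
    simp [Walk.mirror, Dir.mirror]
  · have := h1 _ (Walk.mem_support_mirror.mp ha)
    simp only at this; omega
  · rw [Walk.endpoint_mirror]
    rcases h2 with ⟨k, l, h3, h4, -⟩ | ⟨h, m, l, -, h4⟩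
    · left
      refine ⟨k, by simp [h4], ?_⟩
      rw [Walk.eq_replicate_of_run h3]
      simp [Walk.mirror, Dir.mirror]
    · exact .inr ⟨h, by simp [h4]⟩

/-- If a walk first leaves the column `x = 0` downwards and to the left, then it has visited
`x = -1` before it visits `x = 1`. -/
theorem Walk.exists_neg_of_append_eq {v w' w'' : Walk} {k : ℕ}
    (e : List.replicate k Dir.down ++ .left :: w' = v ++ .right :: w'') :
    ∃ a ∈ v.support, a.1 ≤ -1 := by
  rcases List.append_eq_append_iff.mp e with ⟨c, rfl, e'⟩ | ⟨c, e₀, e'⟩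
  · rcases c with _ | ⟨d, c⟩
    · simp at e'
    · obtain ⟨rfl, e'⟩ := List.cons.inj e'
      refine ⟨_, Walk.endpoint_append_singleton_mem _ _ _, ?_⟩
      have : (Walk.endpoint (List.replicate k Dir.down)).1 = 0 := by
        simp [Walk.endpoint, Walk.vertex, Dir.vec]
      simp [this, Dir.vec]
  · rcases c with _ | ⟨d, c⟩
    · simp at e'
    · obtain ⟨rfl, e'⟩ := List.cons.inj e'
      have : Dir.right ∈ List.replicate k Dir.down := by rw [e₀]; simp
      simp at this

theorem replicate_append_cons_inj {α : Type*} {x y : α} (hxy : x ≠ y) {a b : ℕ} {l l' : List α}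
    (h : List.replicate a x ++ y :: l = List.replicate b x ++ y :: l') : a = b ∧ l = l' := by
  induction a generalizing b with
  | zero =>
    rcases b with _ | b
    · simpa using h
    · simp [List.replicate_succ] at h
      exact absurd h.1.symm hxy
  | succ a ih =>
    rcases b with _ | b
    · simp [List.replicate_succ] at h
      exact absurd h.1 hxy
    · simp only [List.replicate_succ, List.cons_append, List.cons.injEq, true_and] at h
      obtain ⟨rfl, h'⟩ := ih h
      exact ⟨rfl, h'⟩

end PrudentPolygon

/-! ### How three-sided polygons close -/

namespace PrudentPolygon

theorem Walk.endpoint_append (w w' : Walk) :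
    Walk.endpoint (w ++ w') = w.endpoint + w'.endpoint := by
  simp only [Walk.endpoint, Walk.vertex, List.take_length, List.map_append, List.sum_append]

theorem Walk.endpoint_replicate (k : ℕ) (d : Dir) :
    Walk.endpoint (List.replicate k d) = k • d.vec := by
  simp [Walk.endpoint, Walk.vertex]

/-- A polygon that reaches `(-1, 0)` from below. -/
theorem Walk.eq_of_endpoint_left_up {v : Walk} (hw : Walk.IsThreeSided (v ++ [.up]))
    (he : Walk.endpoint (v ++ [.up]) = (-1, 0)) :
    ∃ k, v ++ [.up] = List.replicate (k + 1) .down ++ .left :: List.replicate (k + 1) .up := by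
  have had := ((isThreeSided_concat v .up).mp hw).2
  have hve : v.endpoint = (-1, -1) := by
    rw [Walk.endpoint_concat, Prod.ext_iff] at he
    simp [Dir.vec] at he
    exact Prod.ext he.1 (by simp only; omega)
  have hray : ∀ a ∈ v.support, a.1 = -1 → a.2 ≤ -1 := by
    have := ((admissible_up_iff _ _).mp had).1
    rwa [hve] at this
  have hsupp : ∀ a ∈ Walk.support (v ++ [.up]), a = (-1, 0) ∨ a ∈ v.support := by
    rw [Walk.support_concat, ← Walk.endpoint_concat, he]
    exact fun a ha => ha
  by_cases hx : ∃ a ∈ Walk.support (v ++ [.up]), 1 ≤ a.1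
  -- Suppose the walk visits x = 1. It cannot enter x = -1 above the origin, where the final up step
  -- would see that vertex; so it goes left below the origin first and reaches x = 1 later, from a
  -- top row. That top row, and a vertex of the left column at positive height, defeat all three
  -- ways for the last step to be admissible.
  · exfalso
    obtain ⟨v₀, w₀, e₀, h₀, h₀'⟩ := hw.exit_cases hx
    obtain ⟨v₁, w₁, e₁, h₁, h₁'⟩ := hw.exit_cases'
      ⟨_, Walk.endpoint_mem_support _, by rw [he]⟩
    rcases h₁' with ⟨k, -, rfl⟩ | ⟨h, h₂⟩
    · obtain ⟨a, ha, ha1⟩ := Walk.exists_neg_of_append_eq (e₁.symm.trans e₀)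
      rcases h₀' with ⟨k', l, -, -, h3⟩ | ⟨h, m, l, h3, h4⟩
      · have := h3 a ha; omega
      · have hD := (Walk.describes_of_run h3).2
        obtain ⟨-, -, -, -, hb, -, ⟨c, hc, hc1, hc2⟩, -, -⟩ := hD
        have hm := (hb a ha).1
        have hsub : ∀ a ∈ v₀.support, a ∈ Walk.support (v ++ [.up]) := by
          rw [e₀]; exact fun a ha => Walk.support_append_subset _ _ ha
        have hv0 : (0, (h : ℤ) + 1) ∈ v.support := by
          have := hsub _ v₀.endpoint_mem_support
          rw [h4] at this
          rcases hsupp _ this with e | e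
          · simp at e
          · exact e
        have hcv : c ∈ v.support := by
          rcases hsupp _ (hsub c hc) with rfl | e
          · simp at hc2
          · exact e
        rcases ((admissible_up_iff _ _).mp had).2 with h5 | h5 | h5
        · have := h5 c hcv
          rw [hve] at this
          simp only at this
          have := hray c hcv (by omega)
          omega
        · have := h5 _ hv0
          rw [hve] at this
          simp only at this; omega
        · have := h5 _ hv0
          rw [hve] at this
          simp at this
    · have h3 : v₁.endpoint + Dir.vec .left ∈ Walk.support (v ++ [.up]) := by
        rw [e₁]; exact Walk.endpoint_append_singleton_mem _ _ _
      rw [h₂] at h3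
      rcases hsupp _ h3 with e | e
      · simp [Dir.vec] at e; omega
      · have := hray _ e (by simp [Dir.vec])
        simp [Dir.vec] at this; omega
  · push Not at hx
    obtain ⟨st, hst⟩ := hw.exists_run fun a ha => by have := hx a ha; omega
    have hD := (Walk.describes_of_run hst).2
    rcases st with ⟨h, m, k, l⟩ | ⟨h, i, m, l⟩
    · have e := hD.1
      rw [he, Prod.ext_iff] at e
      obtain rfl : m = 1 := by have := e.1; simp only at this; omega
      have hl : l = .up := by
        rw [Walk.run_concat] at hst
        obtain ⟨st, -, h₁⟩ := Option.bind_eq_some_iff.mp hst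
        rcases st with ⟨h', m', k', l'⟩ | ⟨h', i', m', l'⟩
        · rcases k' with _ | k' <;> cases l' <;> simp [State.step] at h₁ <;> exact h₁.2.2.2.symm
        · simp [State.step] at h₁
      obtain ⟨j, hj⟩ := (Walk.eq_of_run_low_one hst).2 hl
      rw [hj, ← List.singleton_append, Walk.endpoint_append, Walk.endpoint_append,
        Walk.endpoint_replicate, Walk.endpoint_replicate] at he
      simp [Dir.vec, Prod.ext_iff, Walk.endpoint, Walk.vertex] at he
      obtain rfl : k = 0 := by omega
      exact ⟨j, by rw [hj, zero_add]⟩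
    · have e := hD.1
      rw [he, Prod.ext_iff] at e
      have := e.2
      simp only at this; omega

theorem Walk.run_down_left_up (k j : ℕ) :
    Walk.run (List.replicate (k + (j + 1)) .down ++ .left :: List.replicate (j + 1) .up) =
      some (.low 0 1 k .up) := by
  induction j generalizing k with
  | zero =>
    rw [show List.replicate (k + (0 + 1)) Dir.down ++ .left :: List.replicate (0 + 1) .up =
      (List.replicate (k + 1) Dir.down ++ [.left]) ++ [.up] by simp]
    rw [Walk.run_concat, Walk.run_concat, Walk.run_replicate_down]
    rfl
  | succ j ih =>
    rw [List.replicate_succ' (n := j + 1), ← List.cons_append, ← List.append_assoc,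
      show k + (j + 1 + 1) = (k + 1) + (j + 1) by ring, Walk.run_concat, ih]
    rfl

/-- A polygon that reaches `(0, 1)` from the left. -/
theorem Walk.run_of_endpoint_up {v : Walk} (hw : Walk.IsThreeSided (v ++ [.right]))
    (he : Walk.endpoint (v ++ [.right]) = (0, 1)) :
    ∃ m, Walk.run (v ++ [.right]) = some (.top 0 0 m .right) := by
  have had := ((isThreeSided_concat v .right).mp hw).2
  have hve : v.endpoint = (-1, 1) := by
    rw [Walk.endpoint_concat, Prod.ext_iff] at he
    simp [Dir.vec] at he
    exact Prod.ext (by simp only; omega) he.2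
  have hray : ∀ a ∈ v.support, a.2 = 1 → a.1 ≤ -1 := by
    have := ((admissible_right_iff _ _).mp had).1
    rwa [hve] at this
  -- An earlier visit to (0, 1) would lie on the ray of the last step.
  have hnot : ∀ (v' w' : Walk) (d : Dir), v ++ [.right] = v' ++ d :: w' → v'.endpoint ≠ (0, 1) := by
    intro v' w' d e e'
    have : v'.support ⊆ v.support := by
      have hl := congrArg List.length e
      simp at hl
      obtain ⟨c, rfl⟩ : v' <+: v :=
        List.prefix_of_prefix_length_le (List.prefix_append v' (d :: w'))
          (e ▸ List.prefix_append v _) (by omega)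
      exact Walk.support_append_subset _ _
    have h1 := this v'.endpoint_mem_support
    rw [e'] at h1
    have := hray _ h1 rfl
    simp at this
  by_cases hx : ∃ a ∈ Walk.support (v ++ [.right]), 1 ≤ a.1
  · exfalso
    -- The last step is not on the left side, and a vertex with x ≥ 1 excludes the right side, so it
    -- ends on the top side. Hence a crossing above the origin is at height 1, that is in (0, 1),
    -- which `hnot` excludes.
    have htop : ∀ a ∈ v.support, a.2 ≤ 1 := by
      rcases ((admissible_right_iff _ _).mp had).2.1 with h | h | h
      · have := h _ v.endpoint_mem_support
        omega
      · rwa [hve] at h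
      · obtain ⟨a, ha, h1⟩ := hx
        rw [Walk.support_concat, ← Walk.endpoint_concat, he] at ha
        rcases ha with rfl | ha
        · simp at h1
        · have := h a ha; rw [hve] at this; simp only at this; omega
    have htop' : ∀ a ∈ Walk.support (v ++ [.right]), a.2 ≤ 1 := by
      rw [Walk.support_concat, ← Walk.endpoint_concat, he]
      rintro a (rfl | ha)
      · exact le_rfl
      · exact htop a ha
    obtain ⟨v₀, w₀, e₀, h₀, h₀'⟩ := hw.exit_cases hx
    obtain ⟨v₁, w₁, e₁, h₁, h₁'⟩ := hw.exit_cases'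
      ⟨v.endpoint, Walk.support_append_subset _ _ v.endpoint_mem_support, by rw [hve]⟩
    have hmem : ∀ (v' w' : Walk) (d : Dir), v ++ [.right] = v' ++ d :: w' → v'.endpoint.2 ≤ 1 :=
      fun v' w' d e => htop' _ (by
        rw [e]; exact Walk.support_append_subset _ _ v'.endpoint_mem_support)
    rcases h₁' with ⟨k, -, rfl⟩ | ⟨h, h₂⟩
    · obtain ⟨a, ha, ha1⟩ := Walk.exists_neg_of_append_eq (e₁.symm.trans e₀)
      rcases h₀' with ⟨k', l, -, -, h3⟩ | ⟨h, m, l, h3, h4⟩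
      · have := h3 a ha; omega
      · have h5 := hmem _ _ _ e₀
        rw [h4] at h5
        obtain rfl : h = 0 := by simp only at h5; omega
        exact hnot _ _ _ e₀ (by simpa using h4)
    · have h5 := hmem _ _ _ e₁
      rw [h₂] at h5
      obtain rfl : h = 0 := by simp only at h5; omega
      exact hnot _ _ _ e₁ (by simpa using h₂)
  · push Not at hx
    rcases hw.run_of_endpoint (fun a ha => by have := hx a ha; omega) (by rw [he]) with
      ⟨k, l, -, h4, -⟩ | ⟨h, m, l, h3, h4⟩
    · rw [he] at h4; simp at h4; omega
    · rw [he] at h4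
      obtain rfl : h = 0 := by simpa using h4
      refine ⟨m, ?_⟩
      rw [h3]
      congr 2
      rw [Walk.run_concat] at h3
      obtain ⟨st, -, h₁⟩ := Option.bind_eq_some_iff.mp h3
      rcases st with ⟨h', m', k', l'⟩ | ⟨h', i', m', l'⟩
      · simp [State.step] at h₁
      · rcases i' with _ | i' <;> cases l' <;> simp [State.step] at h₁ <;> exact h₁.2.2.2.symm

theorem Walk.concat_of_run_top_right {w : Walk} {h i m : ℕ}
    (hw : w.run = some (.top h i m .right)) : ∃ v, w = v ++ [.right] := by
  rcases List.eq_nil_or_concat w with rfl | ⟨v, d, rfl⟩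
  · simp [Walk.run_nil] at hw
  · refine ⟨v, ?_⟩
    rw [List.concat_eq_append, Walk.run_concat] at hw
    obtain ⟨st, -, h₁⟩ := Option.bind_eq_some_iff.mp hw
    rcases st with ⟨h', m', k', l'⟩ | ⟨h', i', m', l'⟩
    · cases d <;> rcases k' with _ | k' <;> cases l' <;> simp [State.step] at h₁
    · cases d <;> rcases i' with _ | i' <;> cases l' <;> simp [State.step] at h₁
      all_goals first | (split_ifs at h₁ <;> simp at h₁) | simp

/-- No polygon ends in `(0, -1)` with a right step. -/
theorem Walk.endpoint_ne_down {v : Walk} (hw : Walk.IsThreeSided (v ++ [.right])) :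
    Walk.endpoint (v ++ [.right]) ≠ (0, -1) := by
  intro he
  have had := ((isThreeSided_concat v .right).mp hw).2
  have hve : v.endpoint = (-1, -1) := by
    rw [Walk.endpoint_concat, Prod.ext_iff] at he
    simp [Dir.vec] at he
    exact Prod.ext (by simp only; omega) he.2
  have hx : ∀ a ∈ Walk.support (v ++ [.right]), a.1 ≤ 0 := by
    rcases ((admissible_right_iff _ _).mp had).2.1 with h | h | h
    · have := h _ v.endpoint_mem_support
      omega
    · have := h _ v.zero_mem_support
      rw [hve] at this
      simp at this
    · rw [Walk.support_concat, ← Walk.endpoint_concat, he]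
      rintro a (rfl | ha)
      · simp
      · have := h a ha; rw [hve] at this; simpa using this
  rcases hw.run_of_endpoint hx (by rw [he]) with ⟨k, l, h3, h4, -⟩ | ⟨h, m, l, h3, h4⟩
  · have h5 := Walk.eq_replicate_of_run h3
    have : Dir.right ∈ List.replicate k Dir.down := by rw [← h5]; simp
    simp at this
  · rw [he] at h4; simp at h4; omega

/-- Going back in time in the rightmost column x = 1: a down step cannot follow an up step, and a
left step would come from x = 2. So the descent extends back to the right step that enters the
column. -/
theorem Walk.exists_final_descent {v : Walk} {j : ℕ} (hj : 1 ≤ j)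
    (hw : Walk.IsThreeSided (v ++ List.replicate j .down)) (he : v.endpoint = (1, (j : ℤ)))
    (hx : ∀ a ∈ v.support, a.1 ≤ 1) :
    ∃ (u : Walk) (i : ℕ), 1 ≤ i ∧ u.endpoint = (0, (i : ℤ)) ∧
      v ++ List.replicate j .down = u ++ .right :: List.replicate i .down := by
  induction v using List.reverseRecOn generalizing j with
  | nil => simp [Walk.endpoint, Walk.vertex, Prod.ext_iff] at he
  | append_singleton u d ih =>
    have hsub : ∀ a ∈ Walk.support u, a.1 ≤ 1 :=
      fun a ha => hx a (Walk.support_append_subset _ _ ha)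
    have hu := hsub _ (Walk.endpoint_mem_support u)
    rw [Walk.endpoint_concat, Prod.ext_iff] at he
    cases d with
    | left => simp [Dir.vec] at he; omega
    | right =>
      refine ⟨u, j, hj, ?_, by simp⟩
      simpa [Dir.vec, Prod.ext_iff] using he
    | up =>
      exfalso
      obtain ⟨j, rfl⟩ : ∃ i, j = i + 1 := ⟨j - 1, by omega⟩
      rw [show u ++ [Dir.up] ++ List.replicate (j + 1) Dir.down =
        (u ++ [.up] ++ [.down]) ++ List.replicate j Dir.down by simp [List.replicate_succ]] at hw
      have had := ((isThreeSided_concat _ _).mp (isThreeSided_of_append hw)).2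
      have := ((admissible_down_iff _ _).mp had).1 _
        (Walk.support_append_subset _ _ (Walk.endpoint_mem_support u))
        (by simp [Walk.endpoint_concat, Dir.vec])
      simp [Walk.endpoint_concat, Dir.vec] at this
    | down =>
      have e : u ++ [Dir.down] ++ List.replicate j .down = u ++ List.replicate (j + 1) .down := by
        simp [List.replicate_succ]
      rw [e] at hw ⊢
      refine ih (by omega) hw (Prod.ext ?_ ?_) hsub
      · simpa [Dir.vec] using he.1
      · have := he.2; simp [Dir.vec] at this; push_cast; omega

/-- A polygon that reaches `(1, 0)` from above ends with a straight descent in the column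
`x = 1`, which it visits for the first time. -/
theorem Walk.eq_of_endpoint_right_down {v : Walk} (hw : Walk.IsThreeSided (v ++ [.down]))
    (he : Walk.endpoint (v ++ [.down]) = (1, 0)) :
    ∃ (u : Walk) (h m : ℕ) (l : TopMark), u.run = some (.top h 0 m l) ∧
      v ++ [.down] = u ++ .right :: List.replicate (h + 1) .down := by
  have had := ((isThreeSided_concat v .down).mp hw).2
  have hve : v.endpoint = (1, 1) := by
    rw [Walk.endpoint_concat, Prod.ext_iff] at he
    simp [Dir.vec] at he
    exact Prod.ext he.1 (by simp only; omega)
  have hx : ∀ a ∈ v.support, a.1 ≤ 1 := by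
    rcases ((admissible_down_iff _ _).mp had).2 with h | h | h
    · have := h _ v.zero_mem_support
      rw [hve] at this; simp at this
    · have := h _ v.endpoint_mem_support
      omega
    · rwa [hve] at h
  obtain ⟨u, j, hj, hue, e⟩ := Walk.exists_final_descent le_rfl (j := 1) hw (by simpa using hve) hx
  rw [show List.replicate 1 Dir.down = [.down] from rfl] at e
  rw [e] at hw
  obtain ⟨i, rfl⟩ : ∃ i, j = i + 1 := ⟨j - 1, by omega⟩
  have hw' := hw
  rw [List.replicate_succ, show u ++ Dir.right :: Dir.down :: List.replicate i Dir.down =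
    (u ++ [.right] ++ [.down]) ++ List.replicate i Dir.down by simp] at hw'
  have h1 := (isThreeSided_concat _ _).mp (isThreeSided_of_append hw')
  have h2 := (isThreeSided_concat _ _).mp h1.1
  have hu := h2.1
  have hdown := ((admissible_down_iff _ _).mp h1.2).1
  have hright := ((admissible_right_iff _ _).mp h2.2).1
  rw [Walk.endpoint_concat, hue] at hdown
  rw [hue] at hright
  -- If `u` had visited x = 1 before, it would have done so from a vertex of x = 0 strictly above
  -- its endpoint. Then each of the four possible last steps of `u` contradicts the box or points at
  -- a visited vertex.
  have hxu : ∀ a ∈ u.support, a.1 ≤ 0 := by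
    by_contra! hx0
    obtain ⟨v₀, w₀, e₀, h₀, h₀'⟩ := hu.exit_cases (by
      obtain ⟨a, ha, h⟩ := hx0; exact ⟨a, ha, h⟩)
    have hmem : v₀.endpoint + Dir.vec .right ∈ u.support := by
      rw [e₀]; exact Walk.endpoint_append_singleton_mem _ _ _
    have hd := hdown _ (Walk.support_append_subset _ _ hmem)
    have hmem0 : v₀.endpoint ∈ u.support := by
      rw [e₀]; exact Walk.support_append_subset _ _ v₀.endpoint_mem_support
    rcases h₀' with ⟨k, l, -, h4, -⟩ | ⟨h, m, l, -, h4⟩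
    · rw [h4] at hd
      simp [Dir.vec] at hd; omega
    rw [h4] at hmem hmem0 hd
    have hne : (h : ℤ) + 1 ≠ (i + 1 : ℕ) := by
      intro e
      have := hright _ hmem (by simpa [Dir.vec] using e)
      simp [Dir.vec] at this
    have hlt : ((i + 1 : ℕ) : ℤ) < h + 1 := by
      have := hd (by simp [Dir.vec])
      simp [Dir.vec] at this
      push_cast at hne ⊢; omega
    rcases List.eq_nil_or_concat u with rfl | ⟨u', d, rfl⟩
    · simp [Walk.endpoint, Walk.vertex, Prod.ext_iff] at hue; omega
    rw [List.concat_eq_append] at *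
    have h5 := ((isThreeSided_concat _ _).mp hu).2
    have hsup : ∀ a ∈ Walk.support (u' ++ [d]), a.2 ≠ (i + 1 : ℕ) → a ∈ Walk.support u' := by
      intro a ha hne
      rw [Walk.support_concat, ← Walk.endpoint_concat, hue] at ha
      rcases ha with rfl | ha
      · exact absurd rfl hne
      · exact ha
    have hm1 := hsup _ hmem (by simp [Dir.vec]; push_cast at hlt; omega)
    have hm0 := hsup _ hmem0 (by simp; push_cast at hlt; omega)
    rw [Walk.endpoint_concat, Prod.ext_iff] at hue
    simp only [Prod.fst_add, Prod.snd_add] at hue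
    have hleft : ∀ a ∈ Walk.support u', 0 ≤ a.1 := by
      rcases h5.2.1 with h6 | h6 | h6
      · simpa [hue.1] using h6
      · have := h6 _ hm1
        simp only [Prod.snd_add, hue.2, show Dir.right.vec = (1, 0) from rfl] at this
        omega
      · have := h6 _ hm1
        simp only [Prod.fst_add, hue.1, show Dir.right.vec = (1, 0) from rfl] at this
        omega
    cases d with
    | right =>
      have := hleft _ (Walk.endpoint_mem_support u')
      simp [Dir.vec] at hue; omega
    | left =>
      have := hright _ (Walk.support_append_subset _ _ (Walk.endpoint_mem_support u'))
        (by simpa [Dir.vec] using hue.2)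
      simp [Dir.vec] at hue this; omega
    | down =>
      have := ((admissible_down_iff _ _).mp h5).1 _ (Walk.zero_mem_support u')
        (by simpa [Dir.vec] using hue.1.symm)
      simp [Dir.vec] at hue this; omega
    | up =>
      have := ((admissible_up_iff _ _).mp h5).1 _ hm0 (by simpa [Dir.vec] using hue.1.symm)
      simp [Dir.vec] at hue this; push_cast at hlt; omega
  rcases hu.run_of_endpoint hxu (by rw [hue]) with ⟨k, l, -, h4, -⟩ | ⟨h, m, l, h3, h4⟩
  · rw [hue] at h4; simp at h4; omega
  · rw [hue] at h4
    obtain rfl : i = h := by simpa using h4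
    exact ⟨u, i, m, l, h3, e⟩

/-- The right step ends on the top side and opens a new rightmost column; every down step ends on
the right side, with nothing of that column below it. -/
theorem Walk.isThreeSided_descent {u : Walk} {h m : ℕ} {l : TopMark}
    (hu : u.run = some (.top h 0 m l)) {i : ℕ} (hi : i ≤ h + 1) :
    Walk.IsThreeSided (u ++ .right :: List.replicate i .down) ∧
    Walk.endpoint (u ++ .right :: List.replicate i .down) = (1, (h : ℤ) + 1 - i) ∧
    ∀ a ∈ Walk.support (u ++ .right :: List.replicate i .down), a.1 ≤ 1 ∧
      (a.1 = 1 → (h : ℤ) + 1 - i ≤ a.2) := by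
  obtain ⟨h1, hD⟩ := Walk.describes_of_run hu
  have hl : l ≠ .left := by
    rintro rfl
    obtain ⟨-, -, -, -, -, -, -, -, -, -, h2⟩ := hD
    simp at h2
  have hrow := hD.top_row' hl
  obtain ⟨e, -, -, h0, hb, -⟩ := hD
  induction i with
  | zero =>
    simp only [List.replicate_zero]
    rw [isThreeSided_concat, Walk.endpoint_concat, Walk.support_concat, admissible_right_iff]
    rw [e]
    refine ⟨⟨h1, hrow, .inr (.inl fun a ha => (hb a ha).2.2), fun h2 => ?_⟩, ?_, ?_⟩
    · have := h2 _ h0; simp only at this; omega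
    · simp [Dir.vec]
    · rintro a (rfl | ha)
      · simp [Dir.vec]
      · have := hb a ha
        exact ⟨by omega, by omega⟩
  | succ i ih =>
    obtain ⟨h2, h3, h4⟩ := ih (by omega)
    rw [List.replicate_succ', ← List.cons_append, ← List.append_assoc]
    rw [isThreeSided_concat, Walk.endpoint_concat, Walk.support_concat, admissible_down_iff, h3]
    refine ⟨⟨h2, fun a ha => (h4 a ha).2, .inr (.inr fun a ha => (h4 a ha).1)⟩, ?_, ?_⟩
    · simp [Dir.vec]; ring
    · rintro a (rfl | ha)
      · simp [Dir.vec]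
      · have := h4 a ha
        exact ⟨this.1, fun h5 => by have := this.2 h5; push_cast; omega⟩

end PrudentPolygon

/-! ### Polygon counts in terms of automaton runs -/

namespace PrudentPolygon

theorem Walk.vertex_pred_concat (v : Walk) (d : Dir) :
    Walk.vertex (v ++ [d]) ((v ++ [d]).length - 1) = v.endpoint := by
  simp [Walk.endpoint, Walk.vertex]

theorem Walk.eq_nil_or_concat (w : Walk) : w = [] ∨ ∃ (v : Walk) (d : Dir), w = v ++ [d] := by
  rcases List.eq_nil_or_concat w with h | ⟨v, d, h⟩
  · exact .inl h
  · exact .inr ⟨v, d, by rw [h, List.concat_eq_append]⟩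

theorem Walk.isGeneric_iff (w : Walk) : w.IsGenericThreeSidedPolygon ↔
    w.IsThreeSided ∧ w.endpoint = (1, 0) ∧ ∃ v : Walk, w = v ++ [.down] := by
  constructor
  · rintro ⟨⟨h1, -, -⟩, h2, h3⟩
    refine ⟨h1, h2, ?_⟩
    rcases w.eq_nil_or_concat with rfl | ⟨v, d, rfl⟩
    · simp [Walk.vertex, Prod.ext_iff] at h2
    · refine ⟨v, ?_⟩
      rw [Walk.vertex_pred_concat] at h3
      have : v.endpoint + d.vec = (1, 0) := by rw [← Walk.endpoint_concat]; exact h2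
      rw [h3] at this
      cases d <;> simp [Dir.vec, Prod.ext_iff] at this ⊢
  · rintro ⟨h1, h2, v, rfl⟩
    have h3 : v.endpoint = (1, 1) := by
      rw [Walk.endpoint_concat, Prod.ext_iff] at h2
      simp [Dir.vec] at h2
      exact Prod.ext h2.1 (by simp only; omega)
    refine ⟨⟨h1, ?_, .right, h2⟩, h2, by rw [Walk.vertex_pred_concat, h3]⟩
    intro h4
    obtain rfl : v = [] := by simpa using h4
    simp [Walk.endpoint, Walk.vertex, Prod.ext_iff] at h3

theorem Walk.finite_length_eq (n : ℕ) : {w : Walk | w.length + 1 = 2 * n}.Finite :=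
  (List.finite_length_eq Dir (2 * n - 1)).subset fun w (hw : w.length + 1 = 2 * n) => by
    change w.length = _; omega

/-- Appending a right step and the descent to the x-axis is a bijection onto generic polygons. The
appended steps have cost 0, and the closed walk has half-perimeter cost + 1. -/
theorem genericCount_eq (n : ℕ) : genericCount n =
    {u : Walk | (∃ h m l, u.run = some (.top h 0 m l)) ∧ u.cost + 1 = n}.ncard := by
  let f : Walk → Walk := fun u => u ++ .right :: List.replicate u.endpoint.2.toNat .down
  have hend : ∀ {u : Walk} {h m l}, u.run = some (.top h 0 m l) →
      f u = u ++ .right :: List.replicate (h + 1) .down := by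
    intro u h m l hu
    have e : u.endpoint = _ := (Walk.describes_of_run hu).2.1
    have : u.endpoint.2.toNat = h + 1 := by rw [e]; simp only; omega
    simp only [f, this]
  have hcost : ∀ u, (f u).cost = u.cost := by
    intro u
    simp [f, Walk.cost, Dir.cost]
  -- Read backwards, the word is a run of down steps, then a right step, then `u`.
  have hinj : Function.Injective f := by
    intro u u' h
    have h' := congrArg List.reverse h
    simp only [f, List.reverse_append, List.reverse_cons, List.reverse_replicate,
      List.append_assoc, List.singleton_append] at h'
    exact List.reverse_injective (replicate_append_cons_inj (by simp) h').2
  unfold genericCount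
  refine Eq.trans ?_ (Set.ncard_image_of_injective _ hinj)
  congr 1
  ext w
  simp only [Set.mem_ofPred_eq, Set.mem_image, Walk.isGeneric_iff]
  constructor
  · rintro ⟨⟨h1, h2, v, rfl⟩, h3⟩
    obtain ⟨u, h, m, l, hu, e⟩ := Walk.eq_of_endpoint_right_down h1 h2
    have e' := (hend hu).trans e.symm
    refine ⟨u, ⟨⟨h, m, l, hu⟩, ?_⟩, e'⟩
    have := Walk.length_eq (v ++ [.down])
    rw [h2, ← e', hcost, e'] at this
    simp only at this; omega
  · rintro ⟨u, ⟨⟨h, m, l, hu⟩, h3⟩, rfl⟩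
    obtain ⟨h4, h5, -⟩ := Walk.isThreeSided_descent hu le_rfl
    rw [← hend hu] at h4 h5
    have h6 : (f u).endpoint = (1, 0) := by rw [h5]; simp
    refine ⟨⟨h4, h6, u ++ .right :: List.replicate h .down, ?_⟩, ?_⟩
    · rw [hend hu, List.replicate_succ']; simp
    · have := Walk.length_eq (f u)
      rw [h6, hcost] at this
      simp only at this; omega

/-- Representatives of the three-sided prudent polygons up to reflection in the vertical
axis. -/
def Walk.IsOriented (w : Walk) : Prop :=
  w.IsThreeSided ∧ w.length ≠ 1 ∧
    ((w.endpoint = (1, 0) ∧ ∃ v : Walk, w = v ++ [.down]) ∨ (w.endpoint = (-1, 0) ∧ ∃ v : Walk, w = v ++ [.up]) ∨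
      (w.endpoint = (0, 1) ∧ ∃ v : Walk, w = v ++ [.right]))

theorem Walk.mirror_concat (v : Walk) (d : Dir) :
    Walk.mirror (v ++ [d]) = v.mirror ++ [d.mirror] := by simp [Walk.mirror]

/-- The last step cannot start from the origin nor point towards it, so it enters a neighbour of the
origin sideways; entering the one below is impossible by `Walk.endpoint_ne_down`. What remains comes
in mirror pairs. -/
theorem Walk.isThreeSidedPolygon_iff (w : Walk) :
    w.IsThreeSidedPolygon ↔ w.IsOriented ∨ w.mirror.IsOriented := by
  constructor
  · rintro ⟨h1, h2, d', h3⟩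
    rcases w.eq_nil_or_concat with rfl | ⟨v, d, rfl⟩
    · simp [Walk.vertex] at h3
      cases d' <;> simp [Dir.vec, Prod.ext_iff] at h3
    change Walk.endpoint _ = _ at h3
    have h0 : v.endpoint ≠ (0, 0) := by
      rcases v.eq_nil_or_concat with rfl | ⟨u, e, rfl⟩
      · simp at h2
      · exact Walk.endpoint_ne_zero (isThreeSided_of_append h1)
    have had := ((isThreeSided_concat v d).mp h1).2
    have h3' := h3
    rw [Walk.endpoint_concat, Prod.ext_iff] at h3'
    have hz := v.zero_mem_support
    have hm : Walk.IsThreeSided (v.mirror ++ [d.mirror]) := by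
      rw [← Walk.mirror_concat]; exact h1.mirror
    have hme := Walk.endpoint_mirror (v ++ [d])
    rw [Walk.mirror_concat, h3] at hme
    have hlen : (Walk.mirror (v ++ [d])).length ≠ 1 := by rwa [Walk.length_mirror]
    rw [Walk.mirror_concat] at hlen
    unfold Walk.IsOriented
    rw [Walk.mirror_concat]
    have hv : v.endpoint = d'.vec - d.vec := by
      rw [← h3, Walk.endpoint_concat]; simp
    cases d with
    | left =>
      rw [admissible_left_iff, hv] at had
      cases d' with
      | left => exact absurd (by rw [hv]; rfl) h0
      | right => have := had.1 _ hz; simp [Dir.vec] at this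
      | up => exact .inr ⟨hm, hlen, .inr (.inr ⟨by rw [hme]; rfl, _, rfl⟩)⟩
      | down => exact absurd (hme.trans rfl) (Walk.endpoint_ne_down hm)
    | right =>
      rw [admissible_right_iff, hv] at had
      cases d' with
      | right => exact absurd (by rw [hv]; rfl) h0
      | left => have := had.1 _ hz; simp [Dir.vec] at this
      | up => exact .inl ⟨h1, h2, .inr (.inr ⟨h3, _, rfl⟩)⟩
      | down => exact absurd h3 (Walk.endpoint_ne_down h1)
    | up =>
      rw [admissible_up_iff, hv] at had
      cases d' with
      | up => exact absurd (by rw [hv]; rfl) h0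
      | down => have := had.1 _ hz; simp [Dir.vec] at this
      | left => exact .inl ⟨h1, h2, .inr (.inl ⟨h3, _, rfl⟩)⟩
      | right => exact .inr ⟨hm, hlen, .inr (.inl ⟨by rw [hme]; rfl, _, rfl⟩)⟩
    | down =>
      rw [admissible_down_iff, hv] at had
      cases d' with
      | down => exact absurd (by rw [hv]; rfl) h0
      | up => have := had.1 _ hz; simp [Dir.vec] at this
      | right => exact .inl ⟨h1, h2, .inl ⟨h3, _, rfl⟩⟩
      | left => exact .inr ⟨hm, hlen, .inl ⟨by rw [hme]; rfl, _, rfl⟩⟩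
  · have key : ∀ w : Walk, w.IsOriented → w.IsThreeSidedPolygon := by
      rintro w ⟨h1, h2, h3⟩
      refine ⟨h1, h2, ?_⟩
      rcases h3 with ⟨h, -⟩ | ⟨h, -⟩ | ⟨h, -⟩
      exacts [⟨.right, h⟩, ⟨.left, h⟩, ⟨.up, h⟩]
    rintro (h | h)
    · exact key w h
    · obtain ⟨h1, h2, d, h3⟩ := key _ h
      change Walk.endpoint _ = _ at h3
      refine ⟨by simpa [Walk.mirror_mirror] using h1.mirror, by rwa [Walk.length_mirror] at h2,
        d.mirror, ?_⟩
      rw [Walk.endpoint_mirror, Prod.ext_iff] at h3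
      rw [Dir.vec_mirror]
      exact Prod.ext (by have := h3.1; simp only at this; simp only [← this]; simp [Walk.endpoint])
        h3.2

theorem Walk.IsOriented.not_mirror {w : Walk} (h : w.IsOriented) : ¬ w.mirror.IsOriented := by
  rintro ⟨-, -, h'⟩
  obtain ⟨-, -, h⟩ := h
  rw [Walk.endpoint_mirror] at h'
  rcases h with ⟨h, v, rfl⟩ | ⟨h, v, rfl⟩ | ⟨h, v, rfl⟩ <;> rw [h, Walk.mirror_concat] at h' <;>
    rcases h' with ⟨h', u, e⟩ | ⟨h', u, e⟩ | ⟨h', u, e⟩ <;> simp [Dir.mirror] at h' e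

/-- The factor 2 is reflection. The middle term counts the polygons down, left, up, of which there
is one for each half-perimeter at least 2. -/
theorem threeSidedCount_eq (n : ℕ) : threeSidedCount n =
    2 * (genericCount n + (if 2 ≤ n then 1 else 0) +
      {u : Walk | (∃ m, u.run = some (.top 0 0 m .right)) ∧ u.cost = n}.ncard) := by
  have hfin := Walk.finite_length_eq n
  set A : Set Walk := {w | w.IsOriented ∧ w.length + 1 = 2 * n} with hA
  set G : Set Walk := {w | w.IsGenericThreeSidedPolygon ∧ w.length + 1 = 2 * n} with hG
  set K : Set Walk := {w | (∃ k, w = List.replicate (k + 1) .down ++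
    .left :: List.replicate (k + 1) .up) ∧ w.length + 1 = 2 * n} with hK
  set Z : Set Walk := {u | (∃ m, u.run = some (.top 0 0 m .right)) ∧ u.cost = n} with hZ
  have hAfin : A.Finite := hfin.subset fun w hw => hw.2
  have hGfin : G.Finite := hfin.subset fun w hw => hw.2
  have hKfin : K.Finite := hfin.subset fun w hw => hw.2
  have hZlen : ∀ (w : Walk) (m : ℕ), w.run = some (.top 0 0 m .right) → w.length + 1 = 2 * w.cost := by
    intro w m hw
    have e : w.endpoint = _ := (Walk.describes_of_run hw).2.1
    have := w.length_eq
    rw [e] at this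
    simp only at this; omega
  have hZfin : Z.Finite := hfin.subset fun w ⟨⟨m, hw⟩, h⟩ => h ▸ hZlen w m hw
  have h1 : threeSidedCount n = A.ncard + A.ncard := by
    have : {w : Walk | w.IsThreeSidedPolygon ∧ w.length + 1 = 2 * n} = A ∪ Walk.mirror '' A := by
      ext w
      simp only [Set.mem_ofPred_eq, Set.mem_union, Set.mem_image, hA, Walk.isThreeSidedPolygon_iff]
      constructor
      · rintro ⟨h | h, h'⟩
        · exact .inl ⟨h, h'⟩
        · exact .inr ⟨_, ⟨h, by rwa [Walk.length_mirror]⟩, w.mirror_mirror⟩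
      · rintro (h | ⟨v, ⟨h, h'⟩, rfl⟩)
        · exact ⟨.inl h.1, h.2⟩
        · rw [Walk.length_mirror, Walk.mirror_mirror]
          exact ⟨.inr h, h'⟩
    unfold threeSidedCount
    rw [this, Set.ncard_union_eq ?_ hAfin (hAfin.image _),
      Set.ncard_image_of_injective _ Walk.mirror_injective]
    rw [Set.disjoint_left]
    rintro w hw ⟨v, hv, rfl⟩
    exact hv.1.not_mirror hw.1
  have hKs : ∀ k, Walk.IsThreeSided (List.replicate (k + 1) .down ++
      .left :: List.replicate (k + 1) .up) ∧ Walk.endpoint (List.replicate (k + 1) .down ++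
      .left :: List.replicate (k + 1) .up) = (-1, 0) := by
    intro k
    have := Walk.run_down_left_up 0 k
    rw [zero_add] at this
    obtain ⟨h, h', -⟩ := Walk.describes_of_run this
    exact ⟨h, by simpa using h'⟩
  have h2 : A = (G ∪ K) ∪ Z := by
    ext w
    simp only [hA, hG, hK, hZ, Set.mem_ofPred_eq, Set.mem_union, Walk.isGeneric_iff]
    constructor
    · rintro ⟨⟨h1, h2, h | ⟨h, v, rfl⟩ | ⟨h, v, rfl⟩⟩, h'⟩
      · exact .inl (.inl ⟨⟨h1, h⟩, h'⟩)
      · exact .inl (.inr ⟨Walk.eq_of_endpoint_left_up h1 h, h'⟩)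
      · right
        obtain ⟨m, hm⟩ := Walk.run_of_endpoint_up h1 h
        refine ⟨⟨m, hm⟩, ?_⟩
        have := hZlen _ _ hm
        omega
    · rintro ((⟨⟨h1, h2⟩, h'⟩ | ⟨⟨k, rfl⟩, h'⟩) | ⟨⟨m, hm⟩, h'⟩)
      · have hg := (Walk.isGeneric_iff w).mpr ⟨h1, h2⟩
        exact ⟨⟨h1, hg.1.2.1, .inl h2⟩, h'⟩
      · refine ⟨⟨(hKs k).1, by simp; omega, .inr (.inl ⟨(hKs k).2, ?_⟩)⟩, h'⟩
        refine ⟨List.replicate (k + 1) .down ++ .left :: List.replicate k .up, ?_⟩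
        simp [List.replicate_succ']
      · obtain ⟨h3, h4, -⟩ := Walk.describes_of_run hm
        refine ⟨⟨h3, ?_, .inr (.inr ⟨by simpa using h4, Walk.concat_of_run_top_right hm⟩)⟩,
          h' ▸ hZlen _ _ hm⟩
        intro h5
        obtain ⟨v, rfl⟩ := Walk.concat_of_run_top_right hm
        obtain rfl : v = [] := by simpa using h5
        simp [Walk.run, State.step] at hm
  have hKc : K.ncard = if 2 ≤ n then 1 else 0 := by
    split_ifs with hn
    · rw [Set.ncard_eq_one]
      refine ⟨List.replicate (n - 2 + 1) .down ++ .left :: List.replicate (n - 2 + 1) .up, ?_⟩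
      ext w
      simp only [hK, Set.mem_ofPred_eq, Set.mem_singleton_iff]
      constructor
      · rintro ⟨⟨k, rfl⟩, h⟩
        obtain rfl : k = n - 2 := by simp at h; omega
        rfl
      · rintro rfl
        exact ⟨⟨_, rfl⟩, by simp; omega⟩
    · rw [Set.ncard_eq_zero hKfin, Set.eq_empty_iff_forall_notMem]
      rintro w ⟨⟨k, rfl⟩, h⟩
      simp at h; omega
  have hGK : Disjoint G K := by
    rw [Set.disjoint_left]
    rintro w hw ⟨⟨k, rfl⟩, -⟩
    have := ((Walk.isGeneric_iff _).mp hw.1).2.1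
    rw [(hKs k).2] at this
    simp at this
  have hGZ : Disjoint (G ∪ K) Z := by
    rw [Set.disjoint_left]
    rintro w hw ⟨⟨m, hm⟩, -⟩
    have e : w.endpoint = _ := (Walk.describes_of_run hm).2.1
    rcases hw with hw | ⟨⟨k, rfl⟩, -⟩
    · have := ((Walk.isGeneric_iff _).mp hw.1).2.1
      rw [e] at this
      simp at this
    · rw [(hKs k).2] at e
      simp at e
  rw [h1, h2, Set.ncard_union_eq hGZ (hGfin.union hKfin) hZfin, Set.ncard_union_eq hGK hGfin hKfin,
    hKc]
  change G.ncard + _ + _ + (G.ncard + _ + _) = 2 * (G.ncard + _ + _)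
  ring

end PrudentPolygon

/-! ### Weighted sums over walks -/

namespace PrudentPolygon

/-- There are 4 ^ n walks with n steps, and 4/5 < 1. -/
theorem summable_pow_length : Summable fun w : Walk => (1 / 5 : ℝ) ^ w.length := by
  rw [← (Equiv.sigmaFiberEquiv (List.length (α := Dir))).summable_iff, summable_sigma_of_nonneg
    (fun _ => by simp only [Function.comp]; positivity)]
  have hfib : ∀ n, Fintype {w : List Dir // w.length = n} :=
    fun n => (inferInstance : Fintype (List.Vector Dir n))
  have hcard : ∀ n, Fintype.card {w : List Dir // w.length = n} = 4 ^ n := fun n => by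
    have := card_vector (α := Dir) n
    rw [show Fintype.card Dir = 4 from rfl] at this
    rw [← this]
    exact Fintype.card_congr (Equiv.refl _)
  have hval : ∀ (n : ℕ) (w : {w : List Dir // w.length = n}),
      ((fun w : Walk => (1 / 5 : ℝ) ^ w.length) ∘ (Equiv.sigmaFiberEquiv List.length)) ⟨n, w⟩ =
        (1 / 5 : ℝ) ^ n := by
    rintro n ⟨w, rfl⟩
    rfl
  refine ⟨fun n => (hasSum_fintype _).summable, ?_⟩
  simp only [hval, tsum_fintype, Finset.sum_const, Finset.card_univ, hcard, nsmul_eq_mul]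
  have : ∀ n : ℕ, ((4 ^ n : ℕ) : ℝ) * (1 / 5) ^ n = (4 / 5 : ℝ) ^ n := fun n => by
    push_cast; rw [← mul_pow]; norm_num
  simp only [this]
  exact summable_geometric_of_lt_one (by norm_num) (by norm_num)

theorem tsum_walk {f : Walk → ℝ} (hf : Summable f) :
    ∑' w, f w = f [] + ∑' w : Walk, ∑ d, f (w ++ [d]) := by
  let g : Walk × Dir → Walk := fun p => p.1 ++ [p.2]
  have hg : Function.Injective g := by
    rintro ⟨w, d⟩ ⟨w', d'⟩ h
    obtain ⟨h1, h2⟩ := List.append_inj' h rfl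
    simp only [List.cons.injEq, and_true] at h2
    exact Prod.ext h1 h2
  rw [hf.tsum_eq_add_tsum_ite []]
  congr 1
  rw [← hg.tsum_eq (f := fun w : Walk => if w = [] then 0 else f w)]
  · have hs : Summable fun p : Walk × Dir => f (p.1 ++ [p.2]) := hf.comp_injective hg
    have : ∀ p : Walk × Dir, (if g p = [] then 0 else f (g p)) = f (p.1 ++ [p.2]) :=
      fun p => if_neg (by simp [g])
    simp only [this]
    rw [hs.tsum_prod]
    simp
  · intro w hw
    rcases w.eq_nil_or_concat with rfl | ⟨v, d, rfl⟩
    · simp at hw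
    · exact ⟨(v, d), rfl⟩

/-- The total weight `∑ t ^ cost w * φ (state of w)` over all walks read by the automaton. -/
noncomputable def total (t : ℝ) (φ : State → ℝ) : ℝ :=
  ∑' w : Walk, t ^ w.cost * w.run.elim 0 φ

/-- A growth condition on functions of the state that makes `total` converge. -/
def Tame (X : ℝ) (φ : State → ℝ) : Prop :=
  ∃ C, (∀ h m k l, |φ (.low h m k l)| ≤ C * (X ^ m * (1 / 5) ^ k)) ∧
    ∀ h i m l, i ≤ m → |φ (.top h i m l)| ≤ C * X ^ m

/-- The number of columns to the left of the origin. -/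
def State.width : State → ℕ
  | .low _ m _ _ => m
  | .top _ _ m _ => m

theorem Walk.width_le_cost {w : Walk} {st : State} (hw : w.run = some st) : st.width ≤ w.cost := by
  induction w using List.reverseRecOn generalizing st with
  | nil =>
    simp only [Walk.run_nil, Option.some.injEq] at hw
    subst hw; simp [State.width]
  | append_singleton w d ih =>
    rw [Walk.run_concat] at hw
    obtain ⟨st₀, h₀, h₁⟩ := Option.bind_eq_some_iff.mp hw
    have := ih h₀
    rw [Walk.cost_concat]
    rcases st₀ with ⟨h', m', k', l'⟩ | ⟨h', i', m', l'⟩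
    · cases d <;> rcases k' with _ | k' <;> cases l' <;>
        simp only [State.step, Option.some.injEq, reduceCtorEq] at h₁ <;> subst h₁ <;>
        simp only [State.width, Dir.cost] at this ⊢ <;> omega
    · cases d <;> rcases i' with _ | i' <;> cases l' <;>
        simp only [State.step, Option.some.injEq, reduceCtorEq] at h₁ <;>
        (try split_ifs at h₁) <;> (try simp only [Option.some.injEq] at h₁) <;> subst h₁ <;>
        simp only [State.width, Dir.cost] at this ⊢ <;> omega

section

variable {t X : ℝ} {φ ψ : State → ℝ}

/-- The length is at most twice the cost, plus the depth `k` in low states; this is why `Tame` asks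
for the factor (1/5) ^ k. Each column costs a left step, so `X ^ m` is absorbed by `t ^ cost`, and t
X ≤ 1/25 leaves at most (1/5) ^ length. -/
theorem Tame.summable (ht : 0 ≤ t) (hX : 1 ≤ X) (htX : t * X ≤ 1 / 25) (hφ : Tame X φ) :
    Summable fun w : Walk => t ^ w.cost * w.run.elim 0 φ := by
  obtain ⟨C, h1, h2⟩ := hφ
  have hC : 0 ≤ C := by
    have := (abs_nonneg _).trans (h2 0 0 0 .up le_rfl)
    simpa using this
  have key : ∀ (n m : ℕ), m ≤ n → t ^ n * X ^ m ≤ (1 / 5) ^ (2 * n) := by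
    intro n m hmn
    calc t ^ n * X ^ m ≤ t ^ n * X ^ n := by gcongr
      _ = (t * X) ^ n := (mul_pow _ _ _).symm
      _ ≤ (1 / 25) ^ n := by gcongr
      _ = (1 / 5) ^ (2 * n) := by rw [pow_mul]; norm_num
  refine Summable.of_norm_bounded (summable_pow_length.mul_left C) fun w => ?_
  rw [Real.norm_eq_abs, abs_mul, abs_of_nonneg (pow_nonneg ht _)]
  cases hw : w.run with
  | none => simp; positivity
  | some st =>
    have hD := (Walk.describes_of_run hw).2
    have hwd := Walk.width_le_cost hw
    have hlen := w.length_eq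
    simp only [Option.elim]
    rcases st with ⟨h, m, k, l⟩ | ⟨h, i, m, l⟩
    · rw [hD.1] at hlen
      simp only [State.width] at hwd hlen
      calc t ^ w.cost * |φ (.low h m k l)| ≤ t ^ w.cost * (C * (X ^ m * (1 / 5) ^ k)) := by
            gcongr; exact h1 _ _ _ _
        _ = C * ((t ^ w.cost * X ^ m) * (1 / 5) ^ k) := by ring
        _ ≤ C * ((1 / 5) ^ (2 * w.cost) * (1 / 5) ^ k) := by gcongr; exact key _ _ hwd
        _ = C * (1 / 5) ^ (2 * w.cost + k) := by rw [pow_add]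
        _ ≤ C * (1 / 5) ^ w.length := by
            gcongr C * ?_
            exact pow_le_pow_of_le_one (by norm_num) (by norm_num) (by omega)
    · rw [hD.1] at hlen
      simp only [State.width] at hwd hlen
      calc t ^ w.cost * |φ (.top h i m l)| ≤ t ^ w.cost * (C * X ^ m) := by
            gcongr; exact h2 _ _ _ _ hD.2.1
        _ = C * (t ^ w.cost * X ^ m) := by ring
        _ ≤ C * (1 / 5) ^ (2 * w.cost) := by gcongr; exact key _ _ hwd
        _ ≤ C * (1 / 5) ^ w.length := by
            gcongr C * ?_
            exact pow_le_pow_of_le_one (by norm_num) (by norm_num) (by omega)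

theorem Tame.add (hφ : Tame X φ) (hψ : Tame X ψ) : Tame X fun s => φ s + ψ s := by
  obtain ⟨C, h1, h2⟩ := hφ
  obtain ⟨D, h3, h4⟩ := hψ
  refine ⟨C + D, fun h m k l => ?_, fun h i m l hi => ?_⟩
  · rw [add_mul]; exact (abs_add_le _ _).trans (add_le_add (h1 _ _ _ _) (h3 _ _ _ _))
  · rw [add_mul]; exact (abs_add_le _ _).trans (add_le_add (h2 _ _ _ _ hi) (h4 _ _ _ _ hi))

theorem Tame.const_mul (hφ : Tame X φ) (c : ℝ) : Tame X fun s => c * φ s := by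
  obtain ⟨C, h1, h2⟩ := hφ
  refine ⟨|c| * C, fun h m k l => ?_, fun h i m l hi => ?_⟩
  · rw [abs_mul, mul_assoc]; gcongr; exact h1 _ _ _ _
  · rw [abs_mul, mul_assoc]; gcongr; exact h2 _ _ _ _ hi

theorem total_add (hφ : Summable fun w : Walk => t ^ w.cost * w.run.elim 0 φ)
    (hψ : Summable fun w : Walk => t ^ w.cost * w.run.elim 0 ψ) :
    total t (fun s => φ s + ψ s) = total t φ + total t ψ := by
  unfold total
  rw [← hφ.tsum_add hψ]
  congr 1; ext w
  cases w.run <;> simp [mul_add]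

theorem total_const_mul (c : ℝ) : total t (fun s => c * φ s) = c * total t φ := by
  unfold total
  rw [← tsum_mul_left]
  congr 1; ext w
  cases w.run <;> simp; ring

/-- The expected value of `φ` after one more step. -/
noncomputable def next (t : ℝ) (φ : State → ℝ) (s : State) : ℝ :=
  ∑ d, t ^ d.cost * (s.step d).elim 0 φ

theorem next_eq (s : State) : next t φ s = t * (s.step .left).elim 0 φ +
    (s.step .right).elim 0 φ + t * (s.step .up).elim 0 φ + (s.step .down).elim 0 φ := by
  have : (Finset.univ : Finset Dir) = {Dir.left, Dir.right, Dir.up, Dir.down} := rfl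
  simp [next, this, Dir.cost]
  ring

/-- Decomposition of walks according to their last step. -/
theorem total_eq_init_add (hφ : Summable fun w : Walk => t ^ w.cost * w.run.elim 0 φ) :
    total t φ = φ (.low 0 0 0 .left) + total t (next t φ) := by
  unfold total
  rw [tsum_walk hφ]
  congr 1
  · simp [Walk.run_nil, Walk.cost]
  · congr 1; ext w
    simp only [Walk.cost_concat, Walk.run_concat, pow_add]
    cases w.run with
    | none => simp
    | some s => simp [next, Finset.mul_sum, mul_assoc]

theorem total_congr (h : ∀ (w : Walk) (s : State), w.run = some s → φ s = ψ s) :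
    total t φ = total t ψ := by
  unfold total
  congr 1; ext w
  cases hw : w.run with
  | none => simp
  | some s => simp [h w s hw]

end

/-- Indicator of the states from which an up step reaches a new top row, weighted by `X ^ m`. -/
noncomputable def exitLow (X : ℝ) : State → ℝ
  | .low _ m 0 .left => X ^ m
  | .low _ m 0 .up => X ^ m
  | _ => 0

/-- Indicator of the states on the top row from which a left step enlarges the box, weighted by
`X ^ m`. -/
noncomputable def exitLeft (X : ℝ) : State → ℝ
  | .top _ i m .left => if i = m then X ^ m else 0
  | .top _ i m .up => if i = m then X ^ m else 0
  | _ => 0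

/-- Indicator of the states on the top row from which a right step leaves the half-plane
`x ≤ 0`, weighted by `X ^ m`. -/
noncomputable def exitRight (X : ℝ) : State → ℝ
  | .top _ 0 m .right => X ^ m
  | .top _ 0 m .up => X ^ m
  | _ => 0

theorem tame_exitLow {X Y : ℝ} (hX : 0 ≤ X) (hXY : X ≤ Y) : Tame Y (exitLow X) := by
  have hY := hX.trans hXY
  refine ⟨1, fun h m k l => ?_, fun h i m l hi => ?_⟩
  · rcases k with _ | k <;> cases l <;> simp only [exitLow, abs_zero] <;> try positivity
    all_goals
      rw [abs_of_nonneg (by positivity)]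
      simp; gcongr
  · simp only [exitLow, abs_zero]; positivity

theorem tame_exitLeft {X Y : ℝ} (hX : 0 ≤ X) (hXY : X ≤ Y) : Tame Y (exitLeft X) := by
  have hY := hX.trans hXY
  refine ⟨1, fun h m k l => ?_, fun h i m l hi => ?_⟩
  · simp only [exitLeft, abs_zero]; positivity
  · cases l <;> simp only [exitLeft, abs_zero] <;> try positivity
    all_goals
      split_ifs
      · rw [abs_of_nonneg (by positivity), one_mul]; gcongr
      · rw [abs_zero]; positivity

theorem tame_exitRight {X Y : ℝ} (hX : 0 ≤ X) (hXY : X ≤ Y) : Tame Y (exitRight X) := by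
  have hY := hX.trans hXY
  refine ⟨1, fun h m k l => ?_, fun h i m l hi => ?_⟩
  · simp only [exitRight, abs_zero]; positivity
  · rcases i with _ | i <;> cases l <;> simp only [exitRight, abs_zero] <;> try positivity
    all_goals
      rw [abs_of_nonneg (by positivity), one_mul]; gcongr

end PrudentPolygon

/-! ### Potentials and the three linear relations -/

namespace PrudentPolygon

/-- The potential of an excursion below the top row. -/
noncomputable def lowPotential (X N P V : ℝ) : State → ℝ
  | .low _ m k .left => P * N ^ k * X ^ m
  | .low _ m k .up => N ^ (k + 1) * X ^ m
  | .low _ m k .down => V * N ^ k * X ^ m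
  | .top _ _ _ _ => 0

/-- A potential on the top row that is harmonic away from its left end and its right end. -/
noncomputable def topPotential (q y a b : ℝ) : State → ℝ
  | .low _ _ _ _ => 0
  | .top _ i m .up => q ^ i * y ^ m
  | .top _ i m .left => a * q ^ i * y ^ m
  | .top _ i m .right => q * b * q ^ i * y ^ m

/-- A second potential on the top row that is harmonic away from its left end and its
right end. -/
noncomputable def topPotential' (q r X a b : ℝ) : State → ℝ
  | .low _ _ _ _ => 0
  | .top _ i m .up => r ^ (m - i) * X ^ m
  | .top _ i m .left => q * b * r ^ (m - i) * X ^ m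
  | .top _ i m .right => a * r ^ (m - i) * X ^ m

section

variable {t X N P V q y a b : ℝ}

theorem tame_lowPotential {Y : ℝ} (hX : 0 ≤ X) (hXY : X ≤ Y) (hN : 0 ≤ N) (hN' : N ≤ 1 / 5) :
    Tame Y (lowPotential X N P V) := by
  have hY := hX.trans hXY
  refine ⟨|P| + |V| + 1, fun h m k l => ?_, fun h i m l hi => ?_⟩
  · cases l with
    | left =>
      rw [lowPotential, mul_assoc, abs_mul, abs_of_nonneg (by positivity : 0 ≤ N ^ k * X ^ m),
        mul_comm (N ^ k)]
      gcongr
      linarith [abs_nonneg V]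
    | up =>
      rw [lowPotential, abs_of_nonneg (by positivity), pow_succ', mul_assoc, mul_comm (N ^ k)]
      gcongr
      linarith [abs_nonneg V, abs_nonneg P]
    | down =>
      rw [lowPotential, mul_assoc, abs_mul, abs_of_nonneg (by positivity : 0 ≤ N ^ k * X ^ m),
        mul_comm (N ^ k)]
      gcongr
      linarith [abs_nonneg P]
  · simp only [lowPotential, abs_zero]; positivity

theorem tame_topPotential (hq : 1 ≤ q) (hy : 0 ≤ y) (hy1 : y ≤ 1) :
    Tame q (topPotential q y a b) := by
  have key : ∀ i m : ℕ, i ≤ m → q ^ i * y ^ m ≤ q ^ m := by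
    intro i m him
    calc q ^ i * y ^ m ≤ q ^ m * 1 := by
          gcongr
          exact pow_le_one₀ hy hy1
      _ = q ^ m := mul_one _
  refine ⟨|a| + |q * b| + 1, fun h m k l => ?_, fun h i m l hi => ?_⟩
  · simp only [topPotential, abs_zero]; positivity
  · have hk := key i m hi
    have h0 : 0 ≤ q ^ i * y ^ m := by positivity
    cases l with
    | up =>
      rw [topPotential, abs_of_nonneg h0, ← one_mul (q ^ i * y ^ m)]
      gcongr
      linarith [abs_nonneg a, abs_nonneg (q * b)]
    | left =>
      rw [topPotential, mul_assoc, abs_mul, abs_of_nonneg h0]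
      gcongr
      linarith [abs_nonneg (q * b)]
    | right =>
      rw [topPotential, mul_assoc, abs_mul, abs_of_nonneg h0]
      gcongr
      linarith [abs_nonneg a]

theorem tame_topPotential' {r Y : ℝ} (hr : 0 ≤ r) (hr1 : r ≤ 1) (hX : 0 ≤ X) (hXY : X ≤ Y) :
    Tame Y (topPotential' q r X a b) := by
  have hY := hX.trans hXY
  have key : ∀ i m : ℕ, r ^ (m - i) * X ^ m ≤ Y ^ m := by
    intro i m
    calc r ^ (m - i) * X ^ m ≤ 1 * Y ^ m := by
          gcongr
          exact pow_le_one₀ hr hr1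
      _ = Y ^ m := one_mul _
  refine ⟨|a| + |q * b| + 1, fun h m k l => ?_, fun h i m l hi => ?_⟩
  · simp only [topPotential', abs_zero]; positivity
  · have hk := key i m
    have h0 : 0 ≤ r ^ (m - i) * X ^ m := by positivity
    cases l with
    | up =>
      rw [topPotential', abs_of_nonneg h0, ← one_mul (r ^ (m - i) * X ^ m)]
      gcongr
      linarith [abs_nonneg a, abs_nonneg (q * b)]
    | left =>
      rw [topPotential', mul_assoc, abs_mul, abs_of_nonneg h0]
      gcongr
      linarith [abs_nonneg a]
    | right =>
      rw [topPotential', mul_assoc, abs_mul, abs_of_nonneg h0]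
      gcongr
      linarith [abs_nonneg (q * b)]

theorem summable_next {φ : State → ℝ} (hφ : Summable fun w : Walk => t ^ w.cost * w.run.elim 0 φ) :
    Summable fun w : Walk => t ^ w.cost * w.run.elim 0 (next t φ) := by
  have hd : ∀ d : Dir, Summable fun w : Walk =>
      t ^ Walk.cost (w ++ [d]) * (Walk.run (w ++ [d])).elim 0 φ := fun d =>
    hφ.comp_injective (i := fun w : Walk => w ++ [d]) fun w w' h => (List.append_inj' h rfl).1
  refine (summable_sum fun d (_ : d ∈ Finset.univ) => hd d).congr fun w => ?_
  simp only [Walk.cost_concat, Walk.run_concat, pow_add]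
  cases w.run with
  | none => simp
  | some s => simp [next, Finset.mul_sum, mul_assoc]

/-- If `φ = next φ + δ` on reachable states, the total weight of `δ` is the initial value of
`φ`. -/
theorem total_of_eq_next_add {φ δ : State → ℝ}
    (hφ : Summable fun w : Walk => t ^ w.cost * w.run.elim 0 φ)
    (hδ : Summable fun w : Walk => t ^ w.cost * w.run.elim 0 δ)
    (h : ∀ (w : Walk) (s : State), w.run = some s → φ s = next t φ s + δ s) :
    total t δ = φ (.low 0 0 0 .left) := by
  have h1 := total_eq_init_add hφ
  rw [total_congr h, total_add (summable_next hφ) hδ] at h1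
  linarith

/-- An excursion below the top row starts at the origin or with a left step over the left end of a
top row, and ends with an up step out of its highest row. `N` is the weight of climbing one row; `P`
and `V` are the weights after a left and after a down step. The three equations list the possible
next steps. -/
theorem total_low (ht : 0 ≤ t) {Y : ℝ} (hX0 : 0 ≤ X) (hXY : X ≤ Y) (hY : 1 ≤ Y)
    (htY : t * Y ≤ 1 / 25) (hN : 0 ≤ N) (hN' : N ≤ 1 / 5)
    (e1 : N = t + t * X * P) (e2 : V = V * N + t * X * P) (e3 : P = t + t * X * P + V * N) :
    t * total t (exitLow X) = P * (1 + t * X * total t (exitLeft X)) := by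
  have T1 := tame_exitLow hX0 hXY
  have T2 := tame_exitLeft hX0 hXY
  have S1 := (T1.const_mul t).summable ht hY htY
  have S2 := (T2.const_mul (-(t * X * P))).summable ht hY htY
  have key := total_of_eq_next_add (t := t) (φ := lowPotential X N P V)
    (δ := fun s => t * exitLow X s + -(t * X * P) * exitLeft X s)
    ((tame_lowPotential hX0 hXY hN hN').summable ht hY htY)
    (((T1.const_mul t).add (T2.const_mul (-(t * X * P)))).summable ht hY htY) ?_
  · rw [total_add S1 S2, total_const_mul, total_const_mul] at key
    simp only [lowPotential, pow_zero, mul_one] at key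
    linarith
  · intro w s hs
    have hD := (Walk.describes_of_run hs).2
    rw [next_eq]
    rcases s with ⟨h, m, k, l⟩ | ⟨h, i, m, l⟩
    · rcases k with _ | k <;> cases l <;>
        simp only [State.step, Option.elim, lowPotential, exitLow, exitLeft, pow_succ, pow_zero]
      · linear_combination X ^ m * e3
      · linear_combination X ^ m * e1
      · linear_combination X ^ m * e2
      · linear_combination N ^ k * N * X ^ m * e3
      · linear_combination N ^ k * N * X ^ m * e1
      · linear_combination N ^ k * N * X ^ m * e2
    · have him : i ≤ m := hD.2.1
      by_cases hi : i < m
      · rcases i with _ | i <;> cases l <;>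
          simp [State.step, lowPotential, exitLow, exitLeft, hi, hi.ne]
      · obtain rfl : i = m := by omega
        rcases i with _ | i <;> cases l <;>
          simp [State.step, lowPotential, exitLow, exitLeft, pow_succ] <;> ring

/-- On a top row the weight `q ^ i` is harmonic. Its defects sit at the left end, where it is (q y)
^ m, and at the right end, where it is y ^ m; excursions arrive at the left end. -/
theorem total_top (ht : 0 ≤ t) (hq : 1 ≤ q) (htq : t * q ≤ 1 / 25) (hy : 0 ≤ y) (hy1 : y ≤ 1)
    (e1 : a = t + t * q * a) (e2 : q * b = t + b) (e3 : 1 = t + t * q * a + b) :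
    t * total t (exitLow (q * y)) =
      t * q * a * total t (exitLeft (q * y)) + b * total t (exitRight y) := by
  have hX0 : 0 ≤ q * y := by positivity
  have hXq : q * y ≤ q := by nlinarith
  have T1 := tame_exitLow hX0 hXq
  have T2 := tame_exitLeft hX0 hXq
  have T3 := tame_exitRight hy (hy1.trans hq)
  have key := total_of_eq_next_add (t := t) (φ := topPotential q y a b)
    (δ := fun s => (t * q * a * exitLeft (q * y) s + b * exitRight y s) + -t * exitLow (q * y) s)
    ((tame_topPotential hq hy hy1).summable ht hq htq)
    ((((T2.const_mul _).add (T3.const_mul _)).add (T1.const_mul _)).summable ht hq htq) ?_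
  · rw [total_add (((T2.const_mul _).add (T3.const_mul _)).summable ht hq htq)
      ((T1.const_mul _).summable ht hq htq), total_add ((T2.const_mul _).summable ht hq htq)
      ((T3.const_mul _).summable ht hq htq), total_const_mul, total_const_mul,
      total_const_mul] at key
    simp only [topPotential] at key
    linarith
  · intro w s hs
    have hD := (Walk.describes_of_run hs).2
    rw [next_eq]
    rcases s with ⟨h, m, k, l⟩ | ⟨h, i, m, l⟩
    · rcases k with _ | k <;> cases l <;>
        simp [State.step, topPotential, exitLow, exitLeft, exitRight, mul_pow]
    · have him : i ≤ m := hD.2.1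
      by_cases hi : i < m
      · rcases i with _ | i <;> cases l <;>
          simp only [State.step, topPotential, exitLow, exitLeft, exitRight, hi, hi.ne, Option.elim,
            if_true, if_false, pow_succ, pow_zero]
        · linear_combination y ^ m * e1
        · linear_combination y ^ m * e3
        · linear_combination y ^ m * e2
        · linear_combination q ^ i * q * y ^ m * e1
        · linear_combination q ^ i * q * y ^ m * e3
        · linear_combination q ^ i * q * y ^ m * e2
      · obtain rfl : i = m := by omega
        rcases i with _ | i <;> cases l <;>
          simp only [State.step, topPotential, exitLow, exitLeft, exitRight, hi, Option.elim,
            if_true, if_false, pow_succ, pow_zero, mul_pow]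
        · linear_combination e1
        · linear_combination e3
        · linear_combination e2
        · linear_combination q ^ i * q * (y ^ i * y) * e1
        · linear_combination q ^ i * q * (y ^ i * y) * e3
        · linear_combination q ^ i * q * (y ^ i * y) * e2

/-- The roots of t q² - (t² + 1) q + 1 have product 1 / t, so the second harmonic weight is (1 / (t
q)) ^ i. It is normalised to (t q) ^ (m - i), which is 1 at the left end and (t q) ^ m at the right
end. -/
theorem total_top' (ht : 0 ≤ t) (hq : 1 ≤ q) (htq : t * q ≤ 1 / 25) (hX : 0 ≤ X) (hXq : X ≤ q)
    (e1 : a = t + t * q * a) (e2 : q * b = t + b) (e3 : 1 = t + t * q * a + b) :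
    t * total t (exitLow X) =
      b * total t (exitLeft X) + t * q * a * total t (exitRight (t * q * X)) := by
  have htq0 : 0 ≤ t * q := by positivity
  have hXX : t * q * X ≤ q := by nlinarith
  have T1 := tame_exitLow hX hXq
  have T2 := tame_exitLeft hX hXq
  have T3 := tame_exitRight (by positivity : 0 ≤ t * q * X) hXX
  have key := total_of_eq_next_add (t := t) (φ := topPotential' q (t * q) X a b)
    (δ := fun s => (b * exitLeft X s + t * q * a * exitRight (t * q * X) s) + -t * exitLow X s)
    ((tame_topPotential' htq0 (by linarith) hX hXq).summable ht hq htq)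
    ((((T2.const_mul _).add (T3.const_mul _)).add (T1.const_mul _)).summable ht hq htq) ?_
  · rw [total_add (((T2.const_mul _).add (T3.const_mul _)).summable ht hq htq)
      ((T1.const_mul _).summable ht hq htq), total_add ((T2.const_mul _).summable ht hq htq)
      ((T3.const_mul _).summable ht hq htq), total_const_mul, total_const_mul,
      total_const_mul] at key
    simp only [topPotential'] at key
    linarith
  · intro w s hs
    have hD := (Walk.describes_of_run hs).2
    rw [next_eq]
    rcases s with ⟨h, m, k, l⟩ | ⟨h, i, m, l⟩
    · rcases k with _ | k <;> cases l <;>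
        simp [State.step, topPotential', exitLow, exitLeft, exitRight]
    · have him : i ≤ m := hD.2.1
      by_cases hi : i < m
      · obtain ⟨n, rfl⟩ : ∃ n, m = i + n + 1 := ⟨m - i - 1, by omega⟩
        rcases i with _ | i
        · have h1 : 0 + n + 1 - 0 = n + 1 := by omega
          have h2 : 0 + n + 1 - (0 + 1) = n := by omega
          cases l <;>
            simp only [State.step, topPotential', exitLow, exitLeft, exitRight, hi, hi.ne,
              Option.elim, if_true, if_false, h1, h2]
          · linear_combination (t * q) ^ (n + 1) * X ^ (0 + n + 1) * e2
          · linear_combination (t * q) ^ (n + 1) * X ^ (0 + n + 1) * e3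
          · linear_combination (t * q) ^ (n + 1) * X ^ (0 + n + 1) * e1
        · have h1 : i + 1 + n + 1 - (i + 1) = n + 1 := by omega
          have h2 : i + 1 + n + 1 - (i + 1 + 1) = n := by omega
          have h3 : i + 1 + n + 1 - i = n + 2 := by omega
          cases l <;>
            simp only [State.step, topPotential', exitLow, exitLeft, exitRight, hi, hi.ne,
              Option.elim, if_true, if_false, h1, h2, h3]
          · linear_combination (t * q) ^ (n + 1) * X ^ (i + 1 + n + 1) * e2
          · linear_combination (t * q) ^ (n + 1) * X ^ (i + 1 + n + 1) * e3
          · linear_combination (t * q) ^ (n + 1) * X ^ (i + 1 + n + 1) * e1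
      · obtain rfl : i = m := by omega
        rcases i with _ | i
        · cases l <;>
            simp only [State.step, topPotential', exitLow, exitLeft, exitRight, hi,
              Option.elim, if_true, if_false, Nat.sub_self, pow_zero]
          · linear_combination e2
          · linear_combination e3
          · linear_combination e1
        · have h3 : i + 1 - i = 1 := by omega
          cases l <;>
            simp only [State.step, topPotential', exitLow, exitLeft, exitRight, hi,
              Option.elim, if_true, if_false, Nat.sub_self, pow_zero, h3]
          · linear_combination X ^ (i + 1) * e2
          · linear_combination X ^ (i + 1) * e3
          · linear_combination X ^ (i + 1) * e1

end

end PrudentPolygon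

/-! ### Generating functions and the functional equation -/

namespace PrudentPolygon

/-- The potential of the walks that stay in the bottom row or below and then turn right on the
next row. -/
noncomputable def firstRowPotential (t N P V : ℝ) : State → ℝ
  | .low 0 m k .left => P * N ^ k - (if m = 0 ∧ k = 0 then t else 0)
  | .low 0 _ k .up => N ^ (k + 1)
  | .low 0 _ k .down => V * N ^ k
  | .top 0 i _ .up => if i = 0 then 0 else 1
  | .top 0 _ _ .right => 1
  | _ => 0

/-- Indicator of the states of the first row above the origin that are reached by a right step
ending above the origin. -/
noncomputable def exitFirstRow : State → ℝ
  | .top 0 0 _ .right => 1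
  | _ => 0

theorem hasSum_of_eq {f g : ℕ → ℝ} {a : ℝ} (h : HasSum f a) (e : ∀ n, g n = f n) : HasSum g a := by
  rwa [funext e]

section

variable {t N P V : ℝ}

theorem tame_firstRowPotential (ht : 0 ≤ t) (hN : 0 ≤ N) (hN' : N ≤ 1 / 5) :
    Tame 1 (firstRowPotential t N P V) := by
  have hp : ∀ k : ℕ, N ^ k ≤ (1 / 5) ^ k := fun k => pow_le_pow_left₀ hN hN' k
  have hP := abs_nonneg P
  have hV := abs_nonneg V
  refine ⟨|P| + |V| + 1 + t, fun h m k l => ?_, fun h i m l hi => ?_⟩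
  · have hk : 0 ≤ N ^ k := pow_nonneg hN k
    rw [one_pow, one_mul]
    have h5 : (0 : ℝ) < (1 / 5) ^ k := by positivity
    rcases h with _ | h
    · cases l with
      | left =>
        rw [firstRowPotential]
        refine (abs_sub _ _).trans ?_
        have h1 : |P * N ^ k| ≤ |P| * (1 / 5) ^ k := by
          rw [abs_mul, abs_of_nonneg hk]; gcongr
        have h2 : |if m = 0 ∧ k = 0 then t else 0| ≤ t * (1 / 5) ^ k := by
          split_ifs with h
          · rw [h.2, abs_of_nonneg ht]; simp
          · simp; positivity
        nlinarith
      | up =>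
        rw [firstRowPotential, abs_of_nonneg (by positivity), pow_succ']
        have := hp k
        calc N * N ^ k ≤ 1 * (1 / 5) ^ k := by gcongr; linarith
          _ ≤ _ := by gcongr; linarith
      | down =>
        rw [firstRowPotential, abs_mul, abs_of_nonneg hk]
        gcongr
        linarith
    · cases l <;> simp only [firstRowPotential, abs_zero] <;> positivity
  · rw [one_pow, mul_one]
    rcases h with _ | h
    · cases l with
      | left => simp only [firstRowPotential, abs_zero]; positivity
      | up => rw [firstRowPotential]; split_ifs <;> simp <;> linarith
      | right => rw [firstRowPotential]; simp; linarith
    · cases l <;> simp only [firstRowPotential, abs_zero] <;> positivity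

theorem tame_exitFirstRow : Tame 1 exitFirstRow := by
  refine ⟨1, fun h m k l => ?_, fun h i m l hi => ?_⟩
  · simp only [exitFirstRow, abs_zero]; positivity
  · rcases h with _ | h <;> rcases i with _ | i <;> cases l <;> simp [exitFirstRow]

/-- Once a right turn is possible on the first row there is exactly one way to end above the origin,
so the excursion weight at `X = 1` counts these walks. The `t` taken off is the immediate up step
from the origin, which leaves no room for a right step. -/
theorem total_exitFirstRow (ht : 0 ≤ t) (ht' : t ≤ 1 / 25) (hN : 0 ≤ N) (hN' : N ≤ 1 / 5)
    (e1 : N = t + t * P) (e2 : V = V * N + t * P) (e3 : P = t + t * P + V * N) :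
    total t exitFirstRow = P - t := by
  have key := total_of_eq_next_add (t := t) (φ := firstRowPotential t N P V) (δ := exitFirstRow)
    ((tame_firstRowPotential ht hN hN').summable ht le_rfl (by linarith))
    (tame_exitFirstRow.summable ht le_rfl (by linarith)) ?_
  · simpa [firstRowPotential] using key
  · intro w s hs
    have hD := (Walk.describes_of_run hs).2
    rw [next_eq]
    rcases s with ⟨h, m, k, l⟩ | ⟨h, i, m, l⟩
    · rcases h with _ | h
      · cases l with
        | left =>
          have hm : m = 0 → k = 0 := hD.2.2.2.2.2.2.2.2.1
          rcases m with _ | m <;> rcases k with _ | k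
          · simp [State.step, firstRowPotential, exitFirstRow]
            linear_combination e3
          · simp at hm
          · simp [State.step, firstRowPotential, exitFirstRow]
            linear_combination e3
          · simp [State.step, firstRowPotential, exitFirstRow]
            linear_combination N ^ (k + 1) * e3
        | up =>
          have hm : m ≠ 0 := hD.2.2.2.2.2.2.2.2.2.2
          rcases k with _ | k
          · simp [State.step, firstRowPotential, exitFirstRow, hm]
            linear_combination e1
          · simp [State.step, firstRowPotential, exitFirstRow]
            linear_combination N ^ (k + 1) * e1
        | down =>
          rcases k with _ | k <;> simp [State.step, firstRowPotential, exitFirstRow]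
          · linear_combination e2
          · linear_combination N ^ (k + 1) * e2
      · rcases k with _ | k <;> cases l <;> simp [State.step, firstRowPotential, exitFirstRow]
    · have him : i ≤ m := hD.2.1
      rcases h with _ | h <;> rcases i with _ | i <;> cases l <;>
        simp only [State.step, firstRowPotential, exitFirstRow] <;>
        (try split_ifs) <;> simp [firstRowPotential] <;> omega

/-- The generating function of a class of walks by cost. -/
theorem hasSum_ncard_mul_pow {Q : Walk → Prop} {φ : State → ℝ}
    (hφ : Summable fun w : Walk => t ^ w.cost * w.run.elim 0 φ)
    (h1 : ∀ w, Q w → w.run.elim 0 φ = 1) (h0 : ∀ w, ¬ Q w → w.run.elim 0 φ = 0) :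
    HasSum (fun n : ℕ => ({w : Walk | Q w ∧ w.cost = n}.ncard : ℝ) * t ^ n) (total t φ) := by
  have hind : (fun w : Walk => t ^ w.cost * w.run.elim 0 φ) =
      Set.indicator {w : Walk | Q w} fun w => t ^ w.cost := by
    ext w
    by_cases hw : Q w
    · rw [Set.indicator_of_mem (show w ∈ {w : Walk | Q w} from hw), h1 w hw, mul_one]
    · rw [Set.indicator_of_notMem (show w ∉ {w : Walk | Q w} from hw), h0 w hw, mul_zero]
  have hs := hφ.hasSum
  change HasSum _ (total t φ) at hs
  rw [hind, ← hasSum_subtype_iff_indicator] at hs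
  have := hs.tsum_fiberwise fun w : {w : Walk | Q w} => w.1.cost
  refine hasSum_of_eq this fun n => ?_
  have hc : ∀ b : ((fun w : {w : Walk | Q w} => w.1.cost) ⁻¹' {n} : Set _),
      ((fun w : Walk => t ^ w.cost) ∘ Subtype.val) b.1 = t ^ n := by
    rintro ⟨b, hb⟩
    simp only [Function.comp]
    rw [show b.1.cost = n from hb]
  rw [tsum_congr hc, tsum_const, nsmul_eq_mul]
  congr 2
  rw [← Nat.card_coe_set_eq]
  exact Nat.card_congr (Equiv.subtypeSubtypeEquivSubtypeInter (fun w : Walk => Q w)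
    fun w : Walk => w.cost = n).symm

theorem hasSum_genericCount (ht : 0 ≤ t) (ht' : t ≤ 1 / 25) :
    HasSum (fun n : ℕ => (genericCount n : ℝ) * t ^ n) (t * total t (exitRight 1)) := by
  have hs := hasSum_ncard_mul_pow (t := t) (Q := fun u => ∃ h m l, u.run = some (.top h 0 m l))
    (φ := exitRight 1)
    ((tame_exitRight zero_le_one le_rfl).summable ht le_rfl (by linarith)) ?_ ?_
  -- The half-perimeter is the cost plus one: shift the index.
  · rw [← hasSum_nat_add_iff' 1]
    have h0 : genericCount 0 = 0 := by
      rw [genericCount_eq]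
      simp
    simp only [Finset.sum_range_one, h0, Nat.cast_zero, zero_mul, sub_zero]
    refine hasSum_of_eq (hs.mul_left t) fun n => ?_
    rw [genericCount_eq, pow_succ]
    simp only [Nat.add_right_cancel_iff]
    ring
  · rintro w ⟨h, m, l, hw⟩
    have hD := (Walk.describes_of_run hw).2
    cases l with
    | left => exact absurd hD.2.2.2.2.2.2.2.2.2.2 (by norm_num)
    | up => simp [hw, exitRight]
    | right => simp [hw, exitRight]
  · intro w hw
    cases hs : w.run with
    | none => rfl
    | some s =>
      rcases s with ⟨h, m, k, l⟩ | ⟨h, i, m, l⟩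
      · simp [exitRight]
      · rcases i with _ | i
        · exact absurd ⟨h, m, l, hs⟩ hw
        · simp [exitRight]

theorem hasSum_threeSidedCount (ht : 0 ≤ t) (ht' : t ≤ 1 / 25) :
    HasSum (fun n : ℕ => (threeSidedCount n : ℝ) * t ^ n)
      (2 * (t * total t (exitRight 1) + t ^ 2 / (1 - t) + total t exitFirstRow)) := by
  have hs := hasSum_ncard_mul_pow (t := t) (Q := fun u => ∃ m, u.run = some (.top 0 0 m .right))
    (φ := exitFirstRow) (tame_exitFirstRow.summable ht le_rfl (by linarith)) ?_ ?_
  · have hg : HasSum (fun n : ℕ => (if 2 ≤ n then (1 : ℝ) else 0) * t ^ n) (t ^ 2 / (1 - t)) := by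
      rw [← hasSum_nat_add_iff' 2]
      simp only [Finset.sum_range_succ, Finset.sum_range_zero]
      norm_num
      have := (hasSum_geometric_of_lt_one ht (by linarith)).mul_left (t ^ 2)
      rw [← div_eq_mul_inv] at this
      exact hasSum_of_eq this fun n => by ring
    refine hasSum_of_eq ((((hasSum_genericCount ht ht').add hg).add hs).mul_left 2) fun n => ?_
    rw [threeSidedCount_eq]
    push_cast
    ring
  · rintro w ⟨m, hw⟩
    simp [hw, exitFirstRow]
  · intro w hw
    cases hs : w.run with
    | none => rfl
    | some s =>
      rcases s with ⟨h, m, k, l⟩ | ⟨h, i, m, l⟩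
      · simp [exitFirstRow]
      · rcases h with _ | h <;> rcases i with _ | i <;> cases l <;> simp [exitFirstRow]
        exact hw ⟨m, hs⟩

theorem total_exitRight_nonneg (ht : 0 ≤ t) {y : ℝ} (hy : 0 ≤ y) : 0 ≤ total t (exitRight y) := by
  refine tsum_nonneg fun w => mul_nonneg (pow_nonneg ht _) ?_
  cases w.run with
  | none => simp
  | some s =>
    rcases s with ⟨h, m, k, l⟩ | ⟨h, i, m, l⟩
    · simp [exitRight]
    · rcases i with _ | i <;> cases l <;> simp only [Option.elim, exitRight] <;> positivity

theorem total_exitRight_le (ht : 0 ≤ t) (ht' : t ≤ 1 / 25) {y : ℝ} (hy : 0 ≤ y) (hy1 : y ≤ 1) :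
    total t (exitRight y) ≤ total t (exitRight 1) := by
  refine Summable.tsum_le_tsum (fun w => mul_le_mul_of_nonneg_left ?_ (pow_nonneg ht _))
    ((tame_exitRight hy hy1).summable ht le_rfl (by linarith))
    ((tame_exitRight zero_le_one le_rfl).summable ht le_rfl (by linarith))
  cases w.run with
  | none => simp
  | some s =>
    rcases s with ⟨h, m, k, l⟩ | ⟨h, i, m, l⟩
    · simp [exitRight]
    · rcases i with _ | i <;> cases l <;> simp [exitRight]
      · exact pow_le_one₀ hy hy1
      · exact pow_le_one₀ hy hy1

/-- The functional equation of the generating function of generic polygons. -/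
theorem total_exitRight_rec {q b y : ℝ} (ht : 0 < t) (hq : 1 < q) (htq : t * q ≤ 1 / 25)
    (hqq : t * q ^ 2 - (t ^ 2 + 1) * q + 1 = 0) (hy : 0 < y) (hy1 : y ≤ 1) (hb : 0 ≤ b)
    (hb' : t + b ≤ 1 / 5)
    (hbb : b ^ 2 - b * (1 - t) * (1 - t * q * y) + t * q * y * t * (1 - t) = 0) :
    (1 - (q - 1) / t * b) * total t (exitRight y) =
      (1 - t * q * (q - 1) / (1 - t * q)) * ((q - 1) / t * (b / (t * q * y))) +
      t * q * (q - 1) / (1 - t * q) * (t * q * (q - 1) / (1 - t * q) - (q - 1) / t * b) *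
        total t (exitRight (t * q ^ 2 * y)) := by
  have hq0 : 0 < q := by linarith
  have h1 : 0 < 1 - t * q := by linarith
  have h2 : 0 < q - 1 := by linarith
  have hX : 0 < t * q * y := by positivity
  have h3 : 0 < 1 - (t + b) := by linarith
  -- The kernel root determines the excursion: `N = t + b`, `P = b / X` with `X = t q y`, and `V`
  -- from its own equation. The remaining equation for `P` is the kernel quadratic.
  have E1 := total_low (t := t) (X := q * y) (N := t + b) (P := b / (t * q * y))
    (V := b / (1 - (t + b))) ht.le (Y := q) (by positivity) (by nlinarith) hq.le htq (by linarith)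
    hb' (by field_simp) (by field_simp; ring) (by
      field_simp
      linear_combination -hbb)
  have E2 := total_top (t := t) (q := q) (y := y) (a := t / (1 - t * q)) (b := t / (q - 1))
    ht.le hq.le htq hy.le hy1 (by field_simp; ring) (by field_simp; ring) (by
      field_simp
      linear_combination -hqq)
  have E3 := total_top' (t := t) (q := q) (X := q * y) (a := t / (1 - t * q)) (b := t / (q - 1))
    ht.le hq.le htq (by positivity) (by nlinarith) (by field_simp; ring) (by field_simp; ring) (by
      field_simp
      linear_combination -hqq)
  rw [show t * q * (q * y) = t * q ^ 2 * y by ring] at E3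
  generalize total t (exitRight y) = S at *
  generalize total t (exitRight (t * q ^ 2 * y)) = S' at *
  generalize total t (exitLow (q * y)) = s at *
  generalize total t (exitLeft (q * y)) = ν at *
  rw [show t * (q * y) = t * q * y by ring] at E1
  set β := b / (t * q * y) with hβ
  have hbβ : t * q * y * β = b := by rw [hβ]; field_simp
  have hC : (q - 1) / t * (t / (q - 1)) = 1 := by field_simp
  have hc : t * q * (q - 1) / (1 - t * q) = (q - 1) / t * (t * q * (t / (1 - t * q))) := by
    field_simp
  rw [hc]
  generalize (q - 1) / t = H at *
  generalize t / (q - 1) = C at *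
  generalize t * q * (t / (1 - t * q)) = A at *
  -- Elimination of the low and left exits: the multipliers of the three relations add up to zero,
  -- which removes `t * s`, and the terms in `ν` cancel because `t q y β = b`.
  have E : C * (C - b) * S - (C - A) * β - A * (A - b) * S' = 0 := by
    linear_combination (C - A) * E1 - C * E2 + A * E3 + b * (E2 - E3) + (C - A) * ν * hbβ
  linear_combination H ^ 2 * E + (H * b * S + H * β - (H * C + 1) * S) * hC

end

end PrudentPolygon

/-! ### Real analysis: ρ, the function q, the branch points σ_k -/

namespace PrudentPolygon

open Set

theorem exists_rho : ∃ r : ℝ, 1 - 3 * r - r ^ 2 - r ^ 3 = 0 := by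
  have hc : Continuous fun r : ℝ => 1 - 3 * r - r ^ 2 - r ^ 3 := by fun_prop
  obtain ⟨r, -, hr⟩ := intermediate_value_Icc' (by norm_num : (0 : ℝ) ≤ 1) hc.continuousOn
    (show (0 : ℝ) ∈ Icc _ _ by constructor <;> norm_num)
  exact ⟨r, hr⟩

/-- The radius of the disc on which `q` is analytic. -/
noncomputable def rho : ℝ := Classical.choose exists_rho

theorem rho_root : 1 - 3 * rho - rho ^ 2 - rho ^ 3 = 0 := Classical.choose_spec exists_rho

/-- The cubic is (ρ - t) times a positive quadratic. -/
theorem lt_rho_iff {t : ℝ} : t < rho ↔ 0 < 1 - 3 * t - t ^ 2 - t ^ 3 := by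
  have h := rho_root
  have e : 1 - 3 * t - t ^ 2 - t ^ 3 =
      (rho - t) * (3 + (rho + t) + (rho ^ 2 + rho * t + t ^ 2)) := by linear_combination h
  have hpos : 0 < 3 + (rho + t) + (rho ^ 2 + rho * t + t ^ 2) := by
    nlinarith [sq_nonneg (rho + t + 1), sq_nonneg (rho + t), sq_nonneg rho, sq_nonneg t,
      sq_nonneg (rho + 1), sq_nonneg (t + 1)]
  rw [e, mul_pos_iff_of_pos_right hpos, sub_pos]

theorem eq_rho_iff {t : ℝ} : 1 - 3 * t - t ^ 2 - t ^ 3 = 0 ↔ t = rho := by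
  refine ⟨fun h => ?_, fun h => h ▸ rho_root⟩
  have e : (rho - t) * (3 + (rho + t) + (rho ^ 2 + rho * t + t ^ 2)) = 0 := by
    linear_combination h - rho_root
  have hpos : 0 < 3 + (rho + t) + (rho ^ 2 + rho * t + t ^ 2) := by
    nlinarith [sq_nonneg (rho + t + 1), sq_nonneg (rho + t), sq_nonneg rho, sq_nonneg t,
      sq_nonneg (rho + 1), sq_nonneg (t + 1)]
  have := (mul_eq_zero.mp e).resolve_right hpos.ne'
  linarith

theorem le_rho : 0.2955977 ≤ rho := (lt_rho_iff.mpr (by norm_num)).le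

theorem rho_lt : rho < 0.2955978 := by
  by_contra! h
  rcases h.eq_or_lt with h | h
  · have := rho_root; rw [← h] at this; norm_num at this
  · have := lt_rho_iff.mp h; norm_num at this

theorem rho_pos : 0 < rho := by linarith [le_rho]

theorem one_sub_rho_cube : (1 - rho) ^ 3 = 4 * rho ^ 2 := by linear_combination rho_root

theorem sqrt_rho : √rho = (1 - rho) / (1 + rho) := by
  have h1 := rho_pos
  have h2 := rho_lt
  rw [Real.sqrt_eq_iff_mul_self_eq (by linarith) (by apply div_nonneg <;> linarith)]
  field_simp
  linear_combination -rho_root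

/-- The slope `(q(t) - 1) / t`. -/
noncomputable def hR (t : ℝ) : ℝ := 2 / ((1 - t) * (1 + √(1 - 4 * t ^ 2 / (1 - t) ^ 3)))

/-- The function `q`, continued to `t = 0`. -/
noncomputable def qR (t : ℝ) : ℝ := 1 + t * hR t

/-- The radicand of q is (1 - t) ((1 - t)³ - 4 t²), and its second factor vanishes at ρ. -/
theorem v0_rho : 4 * rho ^ 2 / (1 - rho) ^ 3 = 1 := by
  have := rho_pos
  rw [one_sub_rho_cube]; field_simp

section

variable {t s : ℝ}

theorem v0_lt_of_lt (hs : 0 ≤ s) (hst : s < t) (ht : t ≤ rho) :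
    4 * s ^ 2 / (1 - s) ^ 3 < 4 * t ^ 2 / (1 - t) ^ 3 := by
  have := rho_lt
  have h1 : 0 < 1 - t := by linarith
  have h2 : (1 - t) ^ 3 ≤ (1 - s) ^ 3 := by gcongr
  have h3 : s ^ 2 < t ^ 2 := by gcongr
  have h4 : 0 < (1 - t) ^ 3 := by positivity
  rw [div_lt_div_iff₀ (by linarith) h4]
  nlinarith [sq_nonneg s]

theorem v0_le_one (hs : 0 ≤ s) (ht : s ≤ rho) : 4 * s ^ 2 / (1 - s) ^ 3 ≤ 1 := by
  rcases ht.eq_or_lt with rfl | h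
  · exact v0_rho.le
  · exact (v0_lt_of_lt hs h le_rfl).le.trans v0_rho.le

theorem v0_lt_one (hs : 0 ≤ s) (ht : s < rho) : 4 * s ^ 2 / (1 - s) ^ 3 < 1 :=
  (v0_lt_of_lt hs ht le_rfl).trans_le v0_rho.le

theorem hR_pos (ht : t ≤ rho) : 0 < hR t := by
  have := rho_lt
  have : 0 < 1 - t := by linarith
  unfold hR; positivity

theorem strictMonoOn_hR : StrictMonoOn hR (Icc 0 rho) := by
  intro s hs t ht hst
  have := rho_lt
  have h1 : 0 < 1 - t := by linarith [ht.2]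
  have h2 := v0_lt_of_lt hs.1 hst ht.2
  have h3 : √(1 - 4 * t ^ 2 / (1 - t) ^ 3) ≤ √(1 - 4 * s ^ 2 / (1 - s) ^ 3) :=
    Real.sqrt_le_sqrt (by linarith)
  unfold hR
  apply div_lt_div_of_pos_left two_pos (by positivity)
  have : 0 ≤ √(1 - 4 * t ^ 2 / (1 - t) ^ 3) := Real.sqrt_nonneg _
  nlinarith

theorem continuousOn_hR : ContinuousOn hR (Icc 0 rho) := by
  have := rho_lt
  have h1 : ∀ t ∈ Icc 0 rho, 1 - t ≠ 0 := fun t ht => by linarith [ht.2]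
  have h2 : ∀ t ∈ Icc 0 rho, (1 - t) ^ 3 ≠ 0 := fun t ht => pow_ne_zero _ (h1 t ht)
  unfold hR
  refine ContinuousOn.div (by fun_prop) ?_ fun t ht => mul_ne_zero (h1 t ht) (by positivity)
  refine ContinuousOn.mul (by fun_prop) (ContinuousOn.add (by fun_prop) ?_)
  refine ContinuousOn.sqrt (ContinuousOn.sub (by fun_prop) ?_)
  exact ContinuousOn.div (by fun_prop) (by fun_prop) h2

/-- The quadratic equation of `h`, in a form valid over any field. -/
theorem quadratic_of_sq {K : Type*} [Field K] {t y h : K} (h1 : 1 - t ≠ 0) (h2 : 1 + y ≠ 0)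
    (hy : y ^ 2 = 1 - 4 * t ^ 2 / (1 - t) ^ 3) (hh : h = 2 / ((1 - t) * (1 + y))) :
    t ^ 2 * h ^ 2 - (1 - t) ^ 2 * h + (1 - t) = 0 := by
  have e : (1 - t) ^ 3 * y ^ 2 = (1 - t) ^ 3 - 4 * t ^ 2 := by
    rw [hy]; field_simp
  subst hh
  field_simp
  linear_combination e

theorem hR_quadratic (h0 : 0 ≤ t) (ht : t ≤ rho) :
    t ^ 2 * hR t ^ 2 - (1 - t) ^ 2 * hR t + (1 - t) = 0 := by
  have := rho_lt
  refine quadratic_of_sq (by linarith) (by positivity) (Real.sq_sqrt ?_) rfl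
  linarith [v0_le_one h0 ht]

theorem qR_quadratic (h0 : 0 ≤ t) (ht : t ≤ rho) :
    t * qR t ^ 2 - (t ^ 2 + 1) * qR t + 1 = 0 := by
  unfold qR
  linear_combination t * hR_quadratic h0 ht

theorem one_le_qR (h0 : 0 ≤ t) (ht : t ≤ rho) : 1 ≤ qR t := by
  have := hR_pos ht
  unfold qR; nlinarith

theorem one_lt_qR (h0 : 0 < t) (ht : t ≤ rho) : 1 < qR t := by
  have := hR_pos ht
  unfold qR; nlinarith

/-- Rationalising (q - 1) / t moves the square root into the denominator. This form makes sense at 0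
and can be majorised in the complex disc. -/
theorem q_eq_qR (h0 : 0 < t) (ht : t ≤ rho) : q t = qR t := by
  have := rho_lt
  have h1 : 0 < 1 - t := by linarith
  have hv := v0_le_one h0.le ht
  have e : 1 - 4 * t + 2 * t ^ 2 + t ^ 4 = ((1 - t) ^ 2) ^ 2 * (1 - 4 * t ^ 2 / (1 - t) ^ 3) := by
    field_simp; ring
  have hs : √(1 - 4 * t ^ 2 / (1 - t) ^ 3) ^ 2 = 1 - 4 * t ^ 2 / (1 - t) ^ 3 :=
    Real.sq_sqrt (by linarith)
  have hs0 : 0 ≤ √(1 - 4 * t ^ 2 / (1 - t) ^ 3) := Real.sqrt_nonneg _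
  unfold q qR hR
  rw [e, Real.sqrt_mul (by positivity), Real.sqrt_sq (by positivity)]
  have hs' : (1 - t) ^ 3 * √(1 - 4 * t ^ 2 / (1 - t) ^ 3) ^ 2 = (1 - t) ^ 3 - 4 * t ^ 2 := by
    rw [hs]; field_simp
  generalize √(1 - 4 * t ^ 2 / (1 - t) ^ 3) = y at *
  field_simp
  linear_combination -hs'

theorem strictMonoOn_qR : StrictMonoOn qR (Icc 0 rho) := by
  intro s hs t ht hst
  have h1 := strictMonoOn_hR hs ht hst
  have h2 := hR_pos hs.2
  have := hs.1
  unfold qR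
  nlinarith

theorem continuousOn_qR : ContinuousOn qR (Icc 0 rho) :=
  continuousOn_const.add (continuousOn_id.mul continuousOn_hR)

theorem qR_rho : qR rho = (1 + rho) / (1 - rho) := by
  have := rho_lt
  unfold qR hR
  rw [v0_rho]
  have : 1 - rho ≠ 0 := by linarith
  simp
  field_simp
  ring

/-- The ratio `t q(t) ^ 2` of the functional equation. -/
noncomputable def PR (t : ℝ) : ℝ := t * qR t ^ 2

theorem PR_rho : PR rho = 1 := by
  have := rho_lt
  have h1 : 1 - rho ≠ 0 := by linarith
  rw [PR, qR_rho]
  field_simp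
  linear_combination -rho_root

theorem strictMonoOn_PR : StrictMonoOn PR (Icc 0 rho) := by
  intro s hs t ht hst
  have h1 := strictMonoOn_qR hs ht hst
  have h2 := one_le_qR hs.1 hs.2
  have h3 : qR s ^ 2 ≤ qR t ^ 2 := by gcongr
  have h4 : 0 < qR t ^ 2 := by nlinarith
  have := hs.1
  unfold PR
  nlinarith

theorem continuousOn_PR : ContinuousOn PR (Icc 0 rho) :=
  continuousOn_id.mul (continuousOn_qR.pow 2)

theorem PR_nonneg (h0 : 0 ≤ t) : 0 ≤ PR t := by unfold PR; positivity

theorem PR_lt_one (h0 : 0 ≤ t) (ht : t < rho) : PR t < 1 :=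
  PR_rho ▸ strictMonoOn_PR ⟨h0, ht.le⟩ ⟨rho_pos.le, le_rfl⟩ ht

theorem PR_pos (h0 : 0 < t) (ht : t ≤ rho) : 0 < PR t := by
  have := one_le_qR h0.le ht
  unfold PR; positivity

/-- The points `t q(t) (t q(t) ^ 2) ^ k` at which the kernel is evaluated. -/
noncomputable def XR (k : ℕ) (t : ℝ) : ℝ := t * qR t * PR t ^ k

theorem XR_zero : XR 0 t = t * qR t := by simp [XR]

theorem XR_succ (k : ℕ) : XR (k + 1) t = PR t * XR k t := by unfold XR; ring

theorem XR_nonneg (k : ℕ) (h0 : 0 ≤ t) (ht : t ≤ rho) : 0 ≤ XR k t := by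
  have := one_le_qR h0 ht
  have := PR_nonneg h0
  unfold XR; positivity

theorem XR_pos (k : ℕ) (h0 : 0 < t) (ht : t ≤ rho) : 0 < XR k t := by
  have := one_le_qR h0.le ht
  have := PR_pos h0 ht
  unfold XR; positivity

theorem strictMonoOn_XR (k : ℕ) : StrictMonoOn (XR k) (Icc 0 rho) := by
  intro s hs t ht hst
  have h1 := strictMonoOn_qR hs ht hst
  have h2 := one_le_qR hs.1 hs.2
  have h3 : PR s ^ k ≤ PR t ^ k := pow_le_pow_left₀ (PR_nonneg hs.1)
    (strictMonoOn_PR hs ht hst).le k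
  have h4 : 0 < PR t ^ k := pow_pos (PR_pos (hs.1.trans_lt hst) ht.2) k
  have h5 := hs.1
  have h6 : s * qR s < t * qR t := by nlinarith
  have h7 : 0 ≤ s * qR s := by positivity
  unfold XR
  nlinarith

theorem continuousOn_XR (k : ℕ) : ContinuousOn (XR k) (Icc 0 rho) :=
  (continuousOn_id.mul continuousOn_qR).mul (continuousOn_PR.pow k)

/-- At ρ the ratio t q² is 1, so all the functions X_k meet there. -/
theorem XR_rho (k : ℕ) : XR k rho = √rho := by
  have := rho_lt
  have := rho_pos
  have h1 : 1 - rho ≠ 0 := by linarith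
  rw [XR, PR_rho, one_pow, mul_one, qR_rho, sqrt_rho]
  field_simp
  linear_combination -rho_root

theorem XR_lt_XR_succ (k : ℕ) (h0 : 0 < t) (ht : t < rho) : XR (k + 1) t < XR k t := by
  rw [XR_succ]
  have := PR_lt_one h0.le ht
  have := XR_pos k h0 ht.le
  nlinarith

theorem XR_le_XR_zero (k : ℕ) (h0 : 0 ≤ t) (ht : t < rho) : XR k t ≤ XR 0 t := by
  have h1 : PR t ^ k ≤ 1 := pow_le_one₀ (PR_nonneg h0) (PR_lt_one h0 ht).le
  have h2 := XR_nonneg 0 h0 ht.le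
  rw [XR_zero] at *
  unfold XR
  nlinarith

theorem XR_lt_one (k : ℕ) (h0 : 0 ≤ t) (ht : t < rho) : XR k t < 1 := by
  have h1 := strictMonoOn_XR k ⟨h0, ht.le⟩ ⟨rho_pos.le, le_rfl⟩ ht
  rw [XR_rho, sqrt_rho] at h1
  have := rho_pos
  have : (1 - rho) / (1 + rho) < 1 := by rw [div_lt_one (by linarith)]; linarith
  linarith

theorem tendsto_XR (h0 : 0 ≤ t) (ht : t < rho) :
    Filter.Tendsto (fun k => XR k t) Filter.atTop (nhds 0) := by
  have := (tendsto_pow_atTop_nhds_zero_of_lt_one (PR_nonneg h0) (PR_lt_one h0 ht)).const_mul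
    (t * qR t)
  simpa [XR] using this

/-- The critical value `t u(t)` of `X`. -/
noncomputable def critX (t : ℝ) : ℝ := (1 - √t) / (1 + √t)

theorem strictAntiOn_critX : StrictAntiOn critX (Ici 0) := by
  intro s hs t ht hst
  have h1 : √s < √t := Real.sqrt_lt_sqrt hs hst
  have h2 := Real.sqrt_nonneg s
  unfold critX
  rw [div_lt_div_iff₀ (by linarith) (by linarith)]
  nlinarith

theorem continuous_critX : Continuous critX := by
  unfold critX
  exact Continuous.div (by fun_prop) (by fun_prop) fun t => by positivity

theorem critX_rho : critX rho = rho := by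
  have := rho_pos
  rw [critX, sqrt_rho]
  field_simp
  ring

theorem rho_lt_critX (h0 : 0 ≤ t) (ht : t < rho) : rho < critX t := by
  have := strictAntiOn_critX (mem_Ici.mpr h0) (mem_Ici.mpr rho_pos.le) ht
  rwa [critX_rho] at this

/-- X_k starts at 0 and reaches √ρ at ρ, while the critical value starts at 1 and reaches ρ, which
is less than √ρ. -/
theorem exists_sig (k : ℕ) : ∃ t ∈ Ioo 0 rho, XR k t = critX t := by
  have hc : ContinuousOn (fun t => XR k t - critX t) (Icc 0 rho) :=
    (continuousOn_XR k).sub continuous_critX.continuousOn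
  have h0 : XR k 0 - critX 0 < 0 := by simp [XR, critX]
  have h1 : 0 < XR k rho - critX rho := by
    rw [XR_rho, critX_rho, sqrt_rho, sub_pos, lt_div_iff₀ (by linarith [rho_pos])]
    nlinarith [rho_pos, rho_lt]
  obtain ⟨t, ht, h⟩ := intermediate_value_Ioo rho_pos.le hc ⟨h0, h1⟩
  exact ⟨t, ht, by simpa [sub_eq_zero] using h⟩

/-- The branch points of the kernel. -/
noncomputable def sig (k : ℕ) : ℝ := Classical.choose (exists_sig k)

theorem sig_pos (k : ℕ) : 0 < sig k := (Classical.choose_spec (exists_sig k)).1.1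

theorem sig_lt (k : ℕ) : sig k < rho := (Classical.choose_spec (exists_sig k)).1.2

theorem XR_sig (k : ℕ) : XR k (sig k) = critX (sig k) := (Classical.choose_spec (exists_sig k)).2

theorem XR_lt_critX_iff (k : ℕ) (h0 : 0 ≤ t) (ht : t ≤ rho) : XR k t < critX t ↔ t < sig k := by
  have hm : sig k ∈ Icc 0 rho := ⟨(sig_pos k).le, (sig_lt k).le⟩
  rcases lt_trichotomy t (sig k) with h | rfl | h
  · have h1 := strictMonoOn_XR k ⟨h0, ht⟩ hm h
    have h2 := strictAntiOn_critX (mem_Ici.mpr h0) (mem_Ici.mpr hm.1) h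
    have := XR_sig k
    exact ⟨fun _ => h, fun _ => by linarith⟩
  · simp [XR_sig]
  · have h1 := strictMonoOn_XR k hm ⟨h0, ht⟩ h
    have h2 := strictAntiOn_critX (mem_Ici.mpr hm.1) (mem_Ici.mpr h0) h
    have := XR_sig k
    constructor <;> intro _ <;> linarith

theorem critX_lt_XR_iff (k : ℕ) (h0 : 0 ≤ t) (ht : t ≤ rho) : critX t < XR k t ↔ sig k < t := by
  have hm : sig k ∈ Icc 0 rho := ⟨(sig_pos k).le, (sig_lt k).le⟩
  rcases lt_trichotomy t (sig k) with h | rfl | h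
  · have := (XR_lt_critX_iff k h0 ht).mpr h
    constructor <;> intro _ <;> linarith
  · simp [XR_sig]
  · have h1 := strictMonoOn_XR k hm ⟨h0, ht⟩ h
    have h2 := strictAntiOn_critX (mem_Ici.mpr hm.1) (mem_Ici.mpr h0) h
    have := XR_sig k
    exact ⟨fun _ => h, fun _ => by linarith⟩

theorem XR_eq_critX_iff (k : ℕ) (h0 : 0 ≤ t) (ht : t ≤ rho) : XR k t = critX t ↔ t = sig k := by
  refine ⟨fun h => ?_, fun h => h ▸ XR_sig k⟩
  rcases lt_trichotomy t (sig k) with h' | h' | h'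
  · exact absurd h ((XR_lt_critX_iff k h0 ht).mpr h').ne
  · exact h'
  · exact absurd h ((critX_lt_XR_iff k h0 ht).mpr h').ne'

theorem u_eq_iff (k : ℕ) (h0 : 0 < t) (ht : t ≤ rho) :
    u t = q t * (q t ^ 2 * t) ^ k ↔ XR k t = critX t := by
  rw [q_eq_qR h0 ht, u, XR, critX, PR, mul_comm (qR t ^ 2) t]
  constructor <;> intro h
  · rw [mul_assoc, ← h]; field_simp
  · rw [← h]; field_simp

theorem sig_unique (k : ℕ) (t : ℝ) :
    (0 < t ∧ t < rho ∧ u t = q t * (q t ^ 2 * t) ^ k) ↔ t = sig k := by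
  constructor
  · rintro ⟨h0, ht, h⟩
    exact (XR_eq_critX_iff k h0.le ht.le).mp ((u_eq_iff k h0 ht.le).mp h)
  · rintro rfl
    exact ⟨sig_pos k, sig_lt k, (u_eq_iff k (sig_pos k) (sig_lt k).le).mpr (XR_sig k)⟩

/-- At σ_k the smaller X_{k+1} is still subcritical. -/
theorem strictMono_sig : StrictMono sig := by
  refine strictMono_nat_of_lt_succ fun k => ?_
  rw [← XR_lt_critX_iff (k + 1) (sig_pos k).le (sig_lt k).le, ← XR_sig k]
  exact XR_lt_XR_succ k (sig_pos k) (sig_lt k)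

/-- At a fixed t < ρ the X_k tend to 0, hence are eventually below the critical value; then t < σ_k.
-/
theorem tendsto_sig : Filter.Tendsto sig Filter.atTop (nhds rho) := by
  rw [tendsto_order]
  refine ⟨fun a ha => ?_, fun a ha => .of_forall fun k => (sig_lt k).trans ha⟩
  have h0 : 0 ≤ max a 0 := le_max_right _ _
  have h1 : max a 0 < rho := max_lt ha rho_pos
  have h2 : 0 < critX (max a 0) := rho_pos.trans (rho_lt_critX h0 h1)
  filter_upwards [(tendsto_XR h0 h1).eventually_lt_const h2] with k hk
  exact (le_max_left _ _).trans_lt ((XR_lt_critX_iff k h0 h1.le).mp hk)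

/-- With s = √t the critical equation reads q = (1 - s) / (s² (1 + s)); the quadratic of q turns it
into s times the quintic. -/
theorem sig_zero_quintic : √(sig 0) ^ 5 + 2 * √(sig 0) ^ 2 + 3 * √(sig 0) - 2 = 0 := by
  have h := XR_sig 0
  have h0 := sig_pos 0
  have hq := qR_quadratic h0.le (sig_lt 0).le
  rw [XR_zero, critX] at h
  have hs : √(sig 0) ^ 2 = sig 0 := Real.sq_sqrt h0.le
  have hp : 0 < √(sig 0) := Real.sqrt_pos.mpr h0
  generalize √(sig 0) = s at *
  rw [← hs] at h hq
  have h2 : qR (s ^ 2) * (s ^ 2 * (1 + s)) = 1 - s := by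
    rw [eq_div_iff (by positivity)] at h; linear_combination h
  generalize qR (s ^ 2) = q at *
  have : s * (s ^ 5 + 2 * s ^ 2 + 3 * s - 2) = 0 := by
    linear_combination s ^ 2 * (1 + s) ^ 2 * hq - (q * (s ^ 2 * (1 + s)) + (1 - s) -
      (s ^ 4 + 1) * (1 + s)) * h2
  exact (mul_eq_zero.mp this).resolve_left hp.ne'

theorem strictMono_quintic : StrictMono fun x : ℝ => x ^ 5 + 2 * x ^ 2 + 3 * x - 2 := by
  refine strictMono_of_deriv_pos fun x => ?_
  have : HasDerivAt (fun x : ℝ => x ^ 5 + 2 * x ^ 2 + 3 * x - 2)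
      (5 * x ^ 4 + 2 * (2 * x) + 3) x := by
    have := (((hasDerivAt_pow 5 x).add ((hasDerivAt_pow 2 x).const_mul 2)).add
      ((hasDerivAt_id x).const_mul 3)).sub_const 2
    exact this.congr_deriv (by norm_num)
  rw [this.deriv]
  nlinarith [sq_nonneg (x ^ 2 - 1 / 2), sq_nonneg (x + 2 / 5), sq_nonneg x]

theorem quintic_iff (x : ℝ) : x ^ 5 + 2 * x ^ 2 + 3 * x - 2 = 0 ↔ x = √(sig 0) := by
  refine ⟨fun h => strictMono_quintic.injective ?_, fun h => h ▸ sig_zero_quintic⟩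
  simp only [h, sig_zero_quintic]

theorem lt_sqrt_sig_zero {a : ℝ} (ha : a ^ 5 + 2 * a ^ 2 + 3 * a - 2 < 0) : a < √(sig 0) := by
  rw [← strictMono_quintic.lt_iff_lt]
  simpa only [sig_zero_quintic] using ha

theorem sqrt_sig_zero_lt {a : ℝ} (ha : 0 < a ^ 5 + 2 * a ^ 2 + 3 * a - 2) : √(sig 0) < a := by
  rw [← strictMono_quintic.lt_iff_lt]
  simpa only [sig_zero_quintic] using ha

theorem sqrt_sig_zero_bounds : 0.4940964 < √(sig 0) ∧ √(sig 0) < 0.49409644 :=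
  ⟨lt_sqrt_sig_zero (by norm_num), sqrt_sig_zero_lt (by norm_num)⟩

theorem le_sig_zero : 0.2441312 ≤ sig 0 := by
  have h := sqrt_sig_zero_bounds.1
  rw [← Real.sq_sqrt (sig_pos 0).le]
  nlinarith

theorem sig_zero_lt : sig 0 < 0.2441313 := by
  have h := sqrt_sig_zero_bounds
  rw [← Real.sq_sqrt (sig_pos 0).le]
  nlinarith

/-- The coefficient `c` of the functional equation. -/
noncomputable def cR (t : ℝ) : ℝ := t * qR t * (t * hR t) / (1 - t * qR t)

theorem cR_nonneg (h0 : 0 ≤ t) (ht : t < rho) : 0 ≤ cR t := by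
  have h1 := XR_lt_one 0 h0 ht
  have h2 := XR_nonneg 0 h0 ht.le
  have h3 := hR_pos ht.le
  rw [XR_zero] at *
  have : 0 < 1 - t * qR t := by linarith
  unfold cR; positivity

/-- As t h = q - 1, the numerator 1 - t q - t q (q - 1) is 1 - t q². This identity yields both c < 1
and c < P. -/
theorem one_sub_cR (h0 : 0 ≤ t) (ht : t < rho) : 1 - cR t = (1 - PR t) / (1 - t * qR t) := by
  have h1 := XR_lt_one 0 h0 ht
  rw [XR_zero] at h1
  have : 1 - t * qR t ≠ 0 := by linarith
  rw [cR, PR, show t * hR t = qR t - 1 by simp [qR]]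
  field_simp
  ring

theorem cR_lt_one (h0 : 0 ≤ t) (ht : t < rho) : cR t < 1 := by
  have h1 := XR_lt_one 0 h0 ht
  rw [XR_zero] at h1
  have h2 := PR_lt_one h0 ht
  have : 0 < 1 - cR t := by
    rw [one_sub_cR h0 ht]; apply div_pos <;> linarith
  linarith

theorem cR_lt_PR (h0 : 0 < t) (ht : t < rho) : cR t < PR t := by
  have h1 := XR_lt_one 0 h0.le ht
  have h3 := XR_pos 0 h0 ht.le
  rw [XR_zero] at h1 h3
  have h2 := PR_lt_one h0.le ht
  have : 1 - PR t < 1 - cR t := by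
    rw [one_sub_cR h0.le ht, lt_div_iff₀ (by linarith)]; nlinarith
  linarith

/-- The first bound excludes poles in the closed disc |t| ≤ σ_0 through `norm_cx_le_cR`; the second
feeds `xbar_sig_zero`. -/
theorem cR_sig_zero_lt : 2 * cR (sig 0) < 1 ∧ sig 0 * hR (sig 0) < 0.39 := by
  have h := XR_sig 0
  have h0 := sig_pos 0
  obtain ⟨h1, h2⟩ := sqrt_sig_zero_bounds
  have h3 := XR_lt_one 0 h0.le (sig_lt 0)
  have h5 := XR_pos 0 h0 (sig_lt 0).le
  have h4 := hR_pos (sig_lt 0).le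
  rw [XR_zero] at *
  have hq : qR (sig 0) = 1 + sig 0 * hR (sig 0) := rfl
  have h6 := le_sig_zero
  rw [critX, eq_div_iff (by linarith)] at h
  rw [cR]
  generalize sig 0 * hR (sig 0) = p at *
  generalize √(sig 0) = s at *
  -- At σ_0, t q is (1 - s) / (1 + s) with s > 0.4940964.
  have hX : sig 0 * qR (sig 0) < 0.3388 := by nlinarith
  have hp : p < 0.39 := by
    rw [hq] at hX; nlinarith
  refine ⟨?_, hp⟩
  rw [← mul_div_assoc, div_lt_one (by linarith)]
  nlinarith

/-- An upper bound for the kernel denominators on the slit. -/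
noncomputable def xbar (t : ℝ) : ℝ := t * hR t * ((1 - √t) / √t)

/-- The condition under which the unit interval is invariant in `cX_mul_cS_mem`, here at the
dominant singularity. -/
theorem xbar_sig_zero : xbar (sig 0) * (2 - cR (sig 0)) < 1 := by
  have h0 := sig_pos 0
  obtain ⟨h1, h2⟩ := sqrt_sig_zero_bounds
  have h3 := cR_sig_zero_lt.2
  have h4 := hR_pos (sig_lt 0).le
  have h5 := cR_nonneg h0.le (sig_lt 0)
  have h6 : (1 - √(sig 0)) / √(sig 0) < 1.1 := by
    rw [div_lt_iff₀ (by linarith)]; linarith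
  have h7 : 0 < (1 - √(sig 0)) / √(sig 0) := by apply div_pos <;> linarith
  have h8 : 0 < sig 0 * hR (sig 0) := by positivity
  have h9 : xbar (sig 0) < 0.45 := by unfold xbar; nlinarith
  have h10 : 0 < xbar (sig 0) := by unfold xbar; positivity
  nlinarith

/-- At ρ one has c = 1 and `xbar` = 1 - ρ, so the limit of the product is 1 - ρ < 1. Only large
indices are covered, which suffices for infinitely many singularities. -/
theorem eventually_xbar_sig : ∀ᶠ k in Filter.atTop, xbar (sig k) * (2 - cR (sig k)) < 1 := by
  have hr := rho_pos
  have hr' := rho_lt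
  have h1 : 1 - rho ≠ 0 := by linarith
  have hX : rho * qR rho = √rho := by simpa [XR] using XR_rho 0
  have hs : √rho < 1 := by rw [sqrt_rho, div_lt_one (by linarith)]; linarith
  have hc : rho * hR rho = 2 * rho / (1 - rho) := by
    have := qR_rho
    rw [qR] at this
    rw [← eq_sub_iff_add_eq'] at this
    rw [this]; field_simp; ring
  have e1 : cR rho = 1 := by
    rw [cR, hX, hc, sqrt_rho]
    have : 1 - (1 - rho) / (1 + rho) = 2 * rho / (1 + rho) := by field_simp; ring
    rw [this]; field_simp
  have e2 : xbar rho = 1 - rho := by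
    rw [xbar, hc, sqrt_rho]
    field_simp
    linear_combination -rho_root
  have hm : rho ∈ Icc 0 rho := ⟨hr.le, le_rfl⟩
  have c0 : ContinuousWithinAt (fun t => t * hR t) (Icc 0 rho) rho :=
    (continuousOn_id.mul continuousOn_hR) _ hm
  have c1 : ContinuousWithinAt (fun t => t * qR t) (Icc 0 rho) rho :=
    (continuousOn_id.mul continuousOn_qR) _ hm
  have c2 : ContinuousWithinAt cR (Icc 0 rho) rho :=
    (c1.mul c0).div (continuousWithinAt_const.sub c1) (by rw [hX]; linarith)
  have c3 : ContinuousWithinAt xbar (Icc 0 rho) rho := by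
    refine c0.mul (ContinuousWithinAt.div ?_ ?_ (Real.sqrt_pos.mpr hr).ne') <;>
      exact Continuous.continuousWithinAt (by fun_prop)
  have c4 : Filter.Tendsto (fun k => xbar (sig k) * (2 - cR (sig k))) Filter.atTop
      (nhds (xbar rho * (2 - cR rho))) := by
    refine (c3.mul (continuousWithinAt_const.sub c2)).tendsto.comp
      (tendsto_nhdsWithin_iff.mpr ⟨tendsto_sig, .of_forall fun k => ?_⟩)
    exact ⟨(sig_pos k).le, (sig_lt k).le⟩
  refine c4.eventually_lt_const ?_
  rw [e1, e2]; linarith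

end

end PrudentPolygon

/-! ### The complex functions and their real majorants -/

namespace PrudentPolygon

open Set Filter Topology

section sqrt

theorem csqrt_sq (z : ℂ) : z.sqrt ^ 2 = z := Complex.cpow_ofNat_inv_pow z 2

theorem csqrt_re (z : ℂ) : z.sqrt.re = √((‖z‖ + z.re) / 2) := Complex.cpow_inv_two_re z

theorem csqrt_re_nonneg (z : ℂ) : 0 ≤ z.sqrt.re := by rw [csqrt_re]; exact Real.sqrt_nonneg _

theorem csqrt_re_pos {z : ℂ} (hz : z ∈ Complex.slitPlane) : 0 < z.sqrt.re := by
  rw [csqrt_re]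
  apply Real.sqrt_pos.mpr
  have h1 := Complex.abs_re_le_norm z
  rcases Complex.mem_slitPlane_iff.mp hz with h | h
  · have := norm_nonneg z; linarith
  · have h2 : |z.re| < ‖z‖ := Complex.abs_re_lt_norm.mpr h
    have := neg_abs_le z.re
    linarith

theorem one_add_csqrt_ne_zero (z : ℂ) : 1 + z.sqrt ≠ 0 := by
  intro h
  have h1 := congrArg Complex.re h
  simp only [Complex.add_re, Complex.one_re, Complex.zero_re] at h1
  linarith [csqrt_re_nonneg z]

theorem one_le_norm_one_add_csqrt (z : ℂ) : 1 ≤ ‖1 + z.sqrt‖ := by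
  refine le_trans ?_ (Complex.re_le_norm _)
  simp only [Complex.add_re, Complex.one_re]
  linarith [csqrt_re_nonneg z]

/-- Re √z = √((|z| + Re z) / 2), and for z = 1 - v both summands are at least 1 - |v|. This is why a
rationalised denominator 1 + √(1 - v) is smallest on the positive axis. -/
theorem sqrt_one_sub_le_csqrt_re {v : ℂ} {a : ℝ} (h : ‖v‖ ≤ a) : √(1 - a) ≤ (1 - v).sqrt.re := by
  rw [csqrt_re]
  apply Real.sqrt_le_sqrt
  have h1 : 1 - ‖v‖ ≤ ‖1 - v‖ := by simpa using norm_sub_norm_le (1 : ℂ) v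
  have h2 := Complex.re_le_norm v
  simp only [Complex.sub_re, Complex.one_re]
  linarith

theorem analyticAt_csqrt {f : ℂ → ℂ} {t : ℂ} (hf : AnalyticAt ℂ f t)
    (h : f t ∈ Complex.slitPlane) : AnalyticAt ℂ (fun z => (f z).sqrt) t :=
  hf.cpow analyticAt_const h

theorem csqrt_ofReal {x : ℝ} (hx : 0 ≤ x) : (x : ℂ).sqrt = (√x : ℝ) := by
  rw [Complex.sqrt, Real.sqrt_eq_rpow, Complex.ofReal_cpow hx]
  norm_num

theorem one_sub_mem_slitPlane {v : ℂ} (h : ‖v‖ < 1) : 1 - v ∈ Complex.slitPlane := by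
  rw [sub_eq_add_neg]
  exact Complex.mem_slitPlane_of_norm_lt_one (by rwa [norm_neg])

end sqrt

/-- The slope `(q(t) - 1) / t` in the complex domain. -/
noncomputable def ch (t : ℂ) : ℂ := 2 / ((1 - t) * (1 + (1 - 4 * t ^ 2 / (1 - t) ^ 3).sqrt))

/-- The function `q` in the complex domain. -/
noncomputable def cq (t : ℂ) : ℂ := 1 + t * ch t

/-- The ratio `t q ^ 2` of the functional equation. -/
noncomputable def cP (t : ℂ) : ℂ := t * cq t ^ 2

/-- The coefficient `c` of the functional equation. -/
noncomputable def cc (t : ℂ) : ℂ := t * cq t * (t * ch t) / (1 - t * cq t)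

/-- The points at which the kernel is evaluated. -/
noncomputable def cX (k : ℕ) (t : ℂ) : ℂ := t * cq t * cP t ^ k

/-- The kernel discriminants are `1 - cv k`. -/
noncomputable def cv (k : ℕ) (t : ℂ) : ℂ := 4 * cX k t * t / ((1 - t) * (1 - cX k t) ^ 2)

/-- The square roots of the kernel discriminants. -/
noncomputable def cw (k : ℕ) (t : ℂ) : ℂ := (1 - cv k t).sqrt

/-- The small root of the kernel, divided by `X`. -/
noncomputable def cβ (k : ℕ) (t : ℂ) : ℂ := 2 * t / ((1 - cX k t) * (1 + cw k t))

/-- The quantities whose value `1` produces poles. -/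
noncomputable def cx (k : ℕ) (t : ℂ) : ℂ := ch t * (cX k t * cβ k t)

/-- The inhomogeneous coefficients of the functional equation. -/
noncomputable def ca (k : ℕ) (t : ℂ) : ℂ := (1 - cc t) * (ch t * cβ k t) / (1 - cx k t)

/-- The multipliers of the functional equation. -/
noncomputable def cm (k : ℕ) (t : ℂ) : ℂ := cc t * (cc t - cx k t) / (1 - cx k t)

/-- The iterated solution of the functional equation, started at index `n`. -/
noncomputable def cS (n : ℕ) (t : ℂ) : ℂ :=
  ∑' k : ℕ, ca (n + k) t * ∏ j ∈ Finset.range k, cm (n + j) t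

section bounds

variable {t : ℂ} {r : ℝ}

theorem one_sub_le_norm (ht : ‖t‖ ≤ r) : 1 - r ≤ ‖1 - t‖ := by
  have : 1 - ‖t‖ ≤ ‖1 - t‖ := by simpa using norm_sub_norm_le (1 : ℂ) t
  linarith

theorem norm_v0_le (ht : ‖t‖ ≤ r) (hr : r < rho) :
    ‖4 * t ^ 2 / (1 - t) ^ 3‖ ≤ 4 * r ^ 2 / (1 - r) ^ 3 := by
  have h1 := one_sub_le_norm ht
  have h2 := rho_lt
  have h3 : 0 < 1 - r := by linarith
  rw [norm_div, norm_mul, norm_pow, norm_pow, Complex.norm_ofNat]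
  gcongr

theorem norm_ch_le (ht : ‖t‖ ≤ r) (hr : r < rho) : ‖ch t‖ ≤ hR r := by
  have h1 := one_sub_le_norm ht
  have h2 := rho_lt
  have h3 : 0 < 1 - r := by linarith
  have h4 : 1 + √(1 - 4 * r ^ 2 / (1 - r) ^ 3) ≤ ‖1 + (1 - 4 * t ^ 2 / (1 - t) ^ 3).sqrt‖ := by
    refine le_trans ?_ (Complex.re_le_norm _)
    simp only [Complex.add_re, Complex.one_re]
    linarith [sqrt_one_sub_le_csqrt_re (norm_v0_le ht hr)]
  unfold ch hR
  rw [norm_div, norm_mul, Complex.norm_ofNat]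
  gcongr

theorem norm_cq_le (ht : ‖t‖ ≤ r) (hr : r < rho) : ‖cq t‖ ≤ qR r := by
  have h1 := norm_ch_le ht hr
  have h2 : 0 ≤ r := (norm_nonneg t).trans ht
  refine (norm_add_le _ _).trans ?_
  rw [norm_one, norm_mul, qR]
  gcongr

theorem norm_cP_le (ht : ‖t‖ ≤ r) (hr : r < rho) : ‖cP t‖ ≤ PR r := by
  have h1 := norm_cq_le ht hr
  have h2 : 0 ≤ r := (norm_nonneg t).trans ht
  rw [cP, PR, norm_mul, norm_pow]
  gcongr

theorem norm_cX_le (k : ℕ) (ht : ‖t‖ ≤ r) (hr : r < rho) : ‖cX k t‖ ≤ XR k r := by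
  have h1 := norm_cq_le ht hr
  have h2 : 0 ≤ r := (norm_nonneg t).trans ht
  have h3 := norm_cP_le ht hr
  have h4 : 0 ≤ qR r := (norm_nonneg _).trans h1
  rw [cX, XR, norm_mul, norm_mul, norm_pow]
  gcongr

theorem norm_tq_le (ht : ‖t‖ ≤ r) (hr : r < rho) : ‖t * cq t‖ ≤ r * qR r := by
  have := norm_cX_le 0 ht hr
  simpa [cX, XR] using this

theorem one_sub_XR_pos (k : ℕ) (ht : ‖t‖ ≤ r) (hr : r < rho) : 0 < 1 - XR k r := by
  linarith [XR_lt_one k ((norm_nonneg t).trans ht) hr]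

theorem norm_cc_le (ht : ‖t‖ ≤ r) (hr : r < rho) : ‖cc t‖ ≤ cR r := by
  have h1 := norm_tq_le ht hr
  have h2 : 0 ≤ r := (norm_nonneg t).trans ht
  have h3 := one_sub_le_norm h1
  have h4 := one_sub_XR_pos 0 ht hr
  rw [XR_zero] at h4
  have h5 := norm_ch_le ht hr
  have h6 : 0 ≤ r * qR r := (norm_nonneg _).trans h1
  have h7 : 0 ≤ hR r := (norm_nonneg _).trans h5
  rw [cc, cR, norm_div, norm_mul, norm_mul t (ch t)]
  gcongr

/-- The real majorant of the discriminants. -/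
noncomputable def vR (k : ℕ) (r : ℝ) : ℝ := 4 * XR k r * r / ((1 - r) * (1 - XR k r) ^ 2)

theorem norm_cv_le (k : ℕ) (ht : ‖t‖ ≤ r) (hr : r < rho) : ‖cv k t‖ ≤ vR k r := by
  have h1 := norm_cX_le k ht hr
  have h2 : 0 ≤ r := (norm_nonneg t).trans ht
  have h3 := one_sub_le_norm h1
  have h4 := one_sub_XR_pos k ht hr
  have h5 := one_sub_le_norm ht
  have h6 : 0 < 1 - r := by linarith [rho_lt]
  have h7 : 0 ≤ XR k r := (norm_nonneg _).trans h1
  rw [cv, vR, norm_div, norm_mul, norm_mul, norm_mul, norm_pow, Complex.norm_ofNat]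
  gcongr

theorem norm_cβ_le (k : ℕ) (ht : ‖t‖ ≤ r) (hr : r < rho) :
    ‖cβ k t‖ ≤ 2 * r / (1 - XR k r) := by
  have h1 := norm_cX_le k ht hr
  have h2 : 0 ≤ r := (norm_nonneg t).trans ht
  have h3 := one_sub_le_norm h1
  have h4 := one_sub_XR_pos k ht hr
  have h5 := one_le_norm_one_add_csqrt (1 - cv k t)
  rw [cβ, norm_div, norm_mul, norm_mul, Complex.norm_ofNat]
  have h6 : 1 - XR k r ≤ ‖1 - cX k t‖ * ‖1 + cw k t‖ := by
    rw [cw]; nlinarith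
  gcongr

theorem norm_cx_le (k : ℕ) (ht : ‖t‖ ≤ r) (hr : r < rho) :
    ‖cx k t‖ ≤ hR r * (XR k r * (2 * r / (1 - XR k r))) := by
  have h1 := norm_cX_le k ht hr
  have h2 := norm_ch_le ht hr
  have h3 := norm_cβ_le k ht hr
  have h4 : 0 ≤ XR k r := (norm_nonneg _).trans h1
  have h5 : 0 ≤ hR r := (norm_nonneg _).trans h2
  rw [cx, norm_mul, norm_mul]
  gcongr

/-- Dropping the square root from the denominator of β costs a factor at most 2, and X_k ≤ X_0 makes
the bound uniform in `k`. -/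
theorem norm_cx_le_cR (k : ℕ) (ht : ‖t‖ ≤ r) (hr : r < rho) : ‖cx k t‖ ≤ 2 * cR r := by
  have h2 : 0 ≤ r := (norm_nonneg t).trans ht
  have h3 := XR_le_XR_zero k h2 hr
  have h4 := one_sub_XR_pos 0 ht hr
  have h5 := hR_pos hr.le
  have h6 := XR_nonneg k h2 hr.le
  have h7 := XR_nonneg 0 h2 hr.le
  have h8 : 0 < 1 - XR k r := by linarith
  refine (norm_cx_le k ht hr).trans ?_
  calc hR r * (XR k r * (2 * r / (1 - XR k r))) ≤ hR r * (XR 0 r * (2 * r / (1 - XR 0 r))) := by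
        gcongr
    _ = 2 * cR r := by rw [cR, XR_zero]; ring

theorem norm_tq_lt_one (ht : ‖t‖ < rho) : ‖t * cq t‖ < 1 := by
  have := norm_tq_le le_rfl ht
  have h := XR_lt_one 0 (norm_nonneg t) ht
  rw [XR_zero] at h; linarith

theorem norm_cX_lt_one (k : ℕ) (ht : ‖t‖ < rho) : ‖cX k t‖ < 1 :=
  (norm_cX_le k le_rfl ht).trans_lt (XR_lt_one k (norm_nonneg t) ht)

theorem one_sub_ne_zero_of_norm {z : ℂ} (h : ‖z‖ < 1) : 1 - z ≠ 0 := by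
  intro h'
  rw [sub_eq_zero] at h'
  simp [← h'] at h

theorem one_sub_ne_zero (ht : ‖t‖ < rho) : 1 - t ≠ 0 :=
  one_sub_ne_zero_of_norm (by linarith [rho_lt])

end bounds

section analytic

variable {t : ℂ}

theorem analyticAt_ch (ht : ‖t‖ < rho) : AnalyticAt ℂ ch t := by
  have h1 := one_sub_ne_zero ht
  have h2 : ‖4 * t ^ 2 / (1 - t) ^ 3‖ < 1 :=
    (norm_v0_le le_rfl ht).trans_lt (v0_lt_one (norm_nonneg t) ht)
  refine AnalyticAt.fun_div analyticAt_const (AnalyticAt.fun_mul (by fun_prop)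
    (AnalyticAt.fun_add analyticAt_const (analyticAt_csqrt ?_ (one_sub_mem_slitPlane h2))))
    (mul_ne_zero h1 (one_add_csqrt_ne_zero _))
  exact AnalyticAt.fun_sub analyticAt_const
    (AnalyticAt.fun_div (by fun_prop) (by fun_prop) (pow_ne_zero 3 h1))

theorem analyticAt_cq (ht : ‖t‖ < rho) : AnalyticAt ℂ cq t :=
  AnalyticAt.fun_add analyticAt_const (AnalyticAt.fun_mul analyticAt_id (analyticAt_ch ht))

theorem analyticAt_cP (ht : ‖t‖ < rho) : AnalyticAt ℂ cP t :=
  AnalyticAt.fun_mul analyticAt_id ((analyticAt_cq ht).fun_pow 2)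

theorem analyticAt_cX (ht : ‖t‖ < rho) (k : ℕ) : AnalyticAt ℂ (cX k) t :=
  AnalyticAt.fun_mul (AnalyticAt.fun_mul analyticAt_id (analyticAt_cq ht))
    ((analyticAt_cP ht).fun_pow k)

theorem analyticAt_cc (ht : ‖t‖ < rho) : AnalyticAt ℂ cc t :=
  AnalyticAt.fun_div (AnalyticAt.fun_mul (AnalyticAt.fun_mul analyticAt_id (analyticAt_cq ht))
    (AnalyticAt.fun_mul analyticAt_id (analyticAt_ch ht)))
    (AnalyticAt.fun_sub analyticAt_const (AnalyticAt.fun_mul analyticAt_id (analyticAt_cq ht)))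
    (one_sub_ne_zero_of_norm (norm_tq_lt_one ht))

theorem analyticAt_cv (ht : ‖t‖ < rho) (k : ℕ) : AnalyticAt ℂ (cv k) t :=
  AnalyticAt.fun_div (AnalyticAt.fun_mul (AnalyticAt.fun_mul analyticAt_const (analyticAt_cX ht k))
    analyticAt_id) (AnalyticAt.fun_mul (by fun_prop)
    ((AnalyticAt.fun_sub analyticAt_const (analyticAt_cX ht k)).fun_pow 2))
    (mul_ne_zero (one_sub_ne_zero ht)
      (pow_ne_zero 2 (one_sub_ne_zero_of_norm (norm_cX_lt_one k ht))))

theorem analyticAt_cw (ht : ‖t‖ < rho) {k : ℕ} (hv : 1 - cv k t ∈ Complex.slitPlane) : AnalyticAt ℂ (cw k) t :=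
  analyticAt_csqrt (AnalyticAt.fun_sub analyticAt_const (analyticAt_cv ht k)) hv

theorem analyticAt_cβ (ht : ‖t‖ < rho) {k : ℕ} (hv : 1 - cv k t ∈ Complex.slitPlane) : AnalyticAt ℂ (cβ k) t :=
  AnalyticAt.fun_div (by fun_prop) (AnalyticAt.fun_mul
    (AnalyticAt.fun_sub analyticAt_const (analyticAt_cX ht k))
    (AnalyticAt.fun_add analyticAt_const (analyticAt_cw ht hv)))
    (mul_ne_zero (one_sub_ne_zero_of_norm (norm_cX_lt_one k ht)) (one_add_csqrt_ne_zero _))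

theorem analyticAt_cx (ht : ‖t‖ < rho) {k : ℕ} (hv : 1 - cv k t ∈ Complex.slitPlane) : AnalyticAt ℂ (cx k) t :=
  AnalyticAt.fun_mul (analyticAt_ch ht) (AnalyticAt.fun_mul (analyticAt_cX ht k)
    (analyticAt_cβ ht hv))

theorem analyticAt_ca_num (ht : ‖t‖ < rho) {k : ℕ} (hv : 1 - cv k t ∈ Complex.slitPlane) :
    AnalyticAt ℂ (fun t => (1 - cc t) * (ch t * cβ k t)) t :=
  AnalyticAt.fun_mul (AnalyticAt.fun_sub analyticAt_const (analyticAt_cc ht))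
    (AnalyticAt.fun_mul (analyticAt_ch ht) (analyticAt_cβ ht hv))

theorem analyticAt_cm_num (ht : ‖t‖ < rho) {k : ℕ} (hv : 1 - cv k t ∈ Complex.slitPlane) :
    AnalyticAt ℂ (fun t => cc t * (cc t - cx k t)) t :=
  AnalyticAt.fun_mul (analyticAt_cc ht)
    (AnalyticAt.fun_sub (analyticAt_cc ht) (analyticAt_cx ht hv))

theorem analyticAt_one_sub_cx (ht : ‖t‖ < rho) {k : ℕ} (hv : 1 - cv k t ∈ Complex.slitPlane) :
    AnalyticAt ℂ (fun t => 1 - cx k t) t :=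
  AnalyticAt.fun_sub analyticAt_const (analyticAt_cx ht hv)

theorem analyticAt_ca (ht : ‖t‖ < rho) {k : ℕ} (hv : 1 - cv k t ∈ Complex.slitPlane) (hx : 1 - cx k t ≠ 0) :
    AnalyticAt ℂ (ca k) t :=
  AnalyticAt.fun_div (analyticAt_ca_num ht hv) (analyticAt_one_sub_cx ht hv) hx

theorem analyticAt_cm (ht : ‖t‖ < rho) {k : ℕ} (hv : 1 - cv k t ∈ Complex.slitPlane) (hx : 1 - cx k t ≠ 0) :
    AnalyticAt ℂ (cm k) t :=
  AnalyticAt.fun_div (analyticAt_cm_num ht hv) (analyticAt_one_sub_cx ht hv) hx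

end analytic

end PrudentPolygon

/-! ### Convergence and analyticity of the iterated series -/

namespace PrudentPolygon

open Set Filter Topology

/-- With s = √r the discriminant numerator factors as (1 - s - X (1 + s)) (1 + s - X (1 - s)). The
second factor is positive and the first changes sign at the critical value of X. -/
theorem vR_lt_one_iff {k : ℕ} {r : ℝ} (h0 : 0 ≤ r) (hr : r < rho) :
    vR k r < 1 ↔ r < sig k := by
  have h1 := XR_lt_one k h0 hr
  have h2 := XR_nonneg k h0 hr.le
  have h3 : 0 < 1 - r := by linarith [rho_lt]
  have h4 : 0 < 1 - XR k r := by linarith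
  have hs0 := Real.sqrt_nonneg r
  have hs := Real.sq_sqrt h0
  have hs1 : √r < 1 := by
    rw [Real.sqrt_lt' one_pos]; linarith
  rw [← XR_lt_critX_iff k h0 hr.le, vR, div_lt_one (by positivity), critX,
    lt_div_iff₀ (by positivity)]
  generalize XR k r = X at *
  generalize √r = s at *
  rw [← hs]
  have e : (1 - s ^ 2) * (1 - X) ^ 2 - 4 * X * s ^ 2 =
      (1 - s - X * (1 + s)) * (1 + s - X * (1 - s)) := by ring
  have hp : 0 < 1 + s - X * (1 - s) := by nlinarith
  constructor <;> intro h
  · by_contra! h'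
    nlinarith [mul_nonneg (sub_nonneg.mpr h') hp.le]
  · nlinarith [mul_pos (sub_pos.mpr h) hp]

theorem vR_eq_one (k : ℕ) : vR k (sig k) = 1 := by
  have h0 := (sig_pos k).le
  have h := XR_sig k
  have h1 := XR_lt_one k h0 (sig_lt k)
  have hs0 := Real.sqrt_nonneg (sig k)
  have hs := Real.sq_sqrt h0
  have h3 : 0 < 1 - sig k := by linarith [rho_lt, sig_lt k]
  rw [vR, div_eq_one_iff_eq (by have : 1 - XR k (sig k) ≠ 0 := by linarith
                                positivity)]
  rw [critX, eq_div_iff (by positivity)] at h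
  generalize XR k (sig k) = X at *
  generalize √(sig k) = s at *
  rw [← hs]
  linear_combination (1 + s - X * (1 - s)) * h

theorem vR_le_one {k : ℕ} {r : ℝ} (h0 : 0 ≤ r) (hr : r ≤ sig k) : vR k r ≤ 1 := by
  rcases hr.eq_or_lt with rfl | h
  · exact (vR_eq_one k).le
  · exact ((vR_lt_one_iff h0 (h.trans (sig_lt k))).mpr h).le

/-- As X_k(r) → 0, the bounds for `cv k` and `cx k` tend to 0 and the bound for `cm k` tends to
c(r)² < 1; μ is the midpoint of c(r)² and 1. -/
theorem exists_tail_bound {r : ℝ} (h0 : 0 ≤ r) (hr : r < rho) : ∃ (K : ℕ) (A μ : ℝ), 0 ≤ μ ∧ μ < 1 ∧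
    ∀ k ≥ K, ∀ t : ℂ, ‖t‖ ≤ r → ‖cv k t‖ < 1 ∧ ‖cx k t‖ < 1 ∧ ‖ca k t‖ ≤ A ∧ ‖cm k t‖ ≤ μ := by
  have hX := tendsto_XR h0 hr
  have hc0 := cR_nonneg h0 hr
  have hc1 := cR_lt_one h0 hr
  set ξ : ℕ → ℝ := fun k => hR r * (XR k r * (2 * r / (1 - XR k r))) with hξ
  have hξ0 : Tendsto ξ atTop (𝓝 0) := by
    have : Tendsto ξ atTop (𝓝 (hR r * (0 * (2 * r / (1 - 0))))) :=
      (hX.mul ((tendsto_const_nhds).div (tendsto_const_nhds.sub hX) (by norm_num))).const_mul _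
    simpa using this
  have hv : Tendsto (fun k => vR k r) atTop (𝓝 0) := by
    have h3 : 1 - r ≠ 0 := by linarith [rho_lt]
    have : Tendsto (fun k => vR k r) atTop (𝓝 (4 * 0 * r / ((1 - r) * (1 - 0) ^ 2))) :=
      ((hX.const_mul 4).mul_const r).div (((tendsto_const_nhds.sub hX).pow 2).const_mul _)
        (by simpa using h3)
    simpa using this
  have hm : Tendsto (fun k => cR r * (cR r + ξ k) / (1 - ξ k)) atTop (𝓝 (cR r * cR r)) := by
    have : Tendsto (fun k => cR r * (cR r + ξ k) / (1 - ξ k)) atTop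
        (𝓝 (cR r * (cR r + 0) / (1 - 0))) :=
      ((tendsto_const_nhds.add hξ0).const_mul _).div (tendsto_const_nhds.sub hξ0) (by norm_num)
    simpa using this
  have hlt : cR r * cR r < (1 + cR r * cR r) / 2 := by nlinarith
  obtain ⟨K, hK⟩ := eventually_atTop.mp ((hξ0.eventually_lt_const (by norm_num : (0 : ℝ) < 1 / 2)).and
    ((hv.eventually_lt_const one_pos).and (hm.eventually_lt_const hlt)))
  refine ⟨K, (1 + cR r) * (hR r * (2 * r / (1 - XR 0 r))) / (1 / 2), (1 + cR r * cR r) / 2,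
    by positivity, by nlinarith, fun k hk t ht => ?_⟩
  obtain ⟨h1, h2, h3⟩ := hK k hk
  have hx := norm_cx_le k ht hr
  change ‖cx k t‖ ≤ ξ k at hx
  have hcc := norm_cc_le ht hr
  have hx1 := one_sub_le_norm hx
  have hβ := norm_cβ_le k ht hr
  have hX0 := XR_le_XR_zero k h0 hr
  have hX1 := one_sub_XR_pos 0 ht hr
  have hh := norm_ch_le ht hr
  have hh0 := hR_pos hr.le
  have hξk : 0 ≤ ξ k := (norm_nonneg _).trans hx
  refine ⟨(norm_cv_le k ht hr).trans_lt h2, by linarith, ?_, ?_⟩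
  · rw [ca, norm_div, norm_mul, norm_mul]
    have e1 : ‖1 - cc t‖ ≤ 1 + cR r := (norm_sub_le _ _).trans (by rw [norm_one]; linarith)
    have e2 : ‖cβ k t‖ ≤ 2 * r / (1 - XR 0 r) := hβ.trans (by gcongr)
    have e3 : 1 / 2 ≤ ‖1 - cx k t‖ := by linarith
    gcongr
  · refine le_trans ?_ h3.le
    have e1 : ‖cc t - cx k t‖ ≤ cR r + ξ k := (norm_sub_le _ _).trans (by linarith)
    rw [cm, norm_div, norm_mul]
    have : 0 < 1 - ξ k := by linarith
    gcongr

theorem term_succ (n k : ℕ) (t : ℂ) : ca (n + (k + 1)) t * ∏ j ∈ Finset.range (k + 1), cm (n + j) t =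
    cm n t * (ca (n + 1 + k) t * ∏ j ∈ Finset.range k, cm (n + 1 + j) t) := by
  rw [Finset.prod_range_succ', show n + (k + 1) = n + 1 + k by ring, add_zero,
    Finset.prod_congr rfl fun j _ => by rw [show n + (j + 1) = n + 1 + j by ring]]
  ring

theorem norm_term_le {n K : ℕ} {A μ : ℝ} {t : ℂ}
    (hb : ∀ k ≥ K, ‖ca k t‖ ≤ A ∧ ‖cm k t‖ ≤ μ) (hn : K ≤ n) (k : ℕ) :
    ‖ca (n + k) t * ∏ j ∈ Finset.range k, cm (n + j) t‖ ≤ A * μ ^ k := by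
  have hA : 0 ≤ A := (norm_nonneg _).trans (hb K le_rfl).1
  rw [norm_mul, norm_prod]
  gcongr
  · exact (hb _ (by omega)).1
  · calc ∏ j ∈ Finset.range k, ‖cm (n + j) t‖ ≤ ∏ _j ∈ Finset.range k, μ :=
        Finset.prod_le_prod (fun _ _ => norm_nonneg _) fun j _ => (hb _ (by omega)).2
      _ = μ ^ k := by simp

/-- The geometric bound starts at some index K; smaller starting indices follow by peeling off one
factor at a time. -/
theorem summable_term (n : ℕ) {t : ℂ} (ht : ‖t‖ < rho) :
    Summable fun k => ca (n + k) t * ∏ j ∈ Finset.range k, cm (n + j) t := by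
  obtain ⟨K, A, μ, h0, h1, hb⟩ := exists_tail_bound (norm_nonneg t) ht
  have key : ∀ d n, K ≤ n + d →
      Summable fun k => ca (n + k) t * ∏ j ∈ Finset.range k, cm (n + j) t := by
    intro d
    induction d with
    | zero =>
      intro n hn
      exact Summable.of_norm_bounded ((summable_geometric_of_lt_one h0 h1).mul_left A)
        (norm_term_le (fun k hk => (hb k hk t le_rfl).2.2) hn)
    | succ d ih =>
      intro n hn
      rw [← summable_nat_add_iff 1]
      simp only [term_succ]
      exact (ih (n + 1) (by omega)).mul_left _
  exact key K n (by omega)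

/-- This holds also where `1 - cx n` vanishes: there `ca n` and `cm n` take the value 0, and the
recursion is still an identity of convergent series. -/
theorem cS_rec (n : ℕ) {t : ℂ} (ht : ‖t‖ < rho) : cS n t = ca n t + cm n t * cS (n + 1) t := by
  rw [cS, (summable_term n ht).tsum_eq_zero_add]
  simp only [term_succ, tsum_mul_left]
  simp [cS]

theorem eventually_norm_lt {t : ℂ} (ht : ‖t‖ < rho) : ∀ᶠ z in 𝓝 t, ‖z‖ < rho :=
  continuous_norm.continuousAt.eventually_lt_const ht

theorem exists_analyticAt_tail {t : ℂ} (ht : ‖t‖ < rho) : ∃ K, ∀ n ≥ K, AnalyticAt ℂ (cS n) t := by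
  obtain ⟨r, hr1, hr2⟩ := exists_between ht
  have hr0 : 0 ≤ r := (norm_nonneg t).trans hr1.le
  obtain ⟨K, A, μ, h0, h1, hb⟩ := exists_tail_bound hr0 hr2
  refine ⟨K, fun n hn => ?_⟩
  have hd : DifferentiableOn ℂ (cS n) (Metric.ball 0 r) := by
    refine Complex.differentiableOn_tsum_of_summable_norm
      ((summable_geometric_of_lt_one h0 h1).mul_left A) (fun k z hz => ?_) Metric.isOpen_ball
      fun k z hz => ?_
    · rw [mem_ball_zero_iff] at hz
      have hz' := hz.trans hr2
      have hk : ∀ j, K ≤ j → AnalyticAt ℂ (ca j) z ∧ AnalyticAt ℂ (cm j) z := fun j hj => by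
        obtain ⟨e1, e2, -, -⟩ := hb j hj z hz.le
        exact ⟨analyticAt_ca hz' (one_sub_mem_slitPlane e1) (one_sub_ne_zero_of_norm e2),
          analyticAt_cm hz' (one_sub_mem_slitPlane e1) (one_sub_ne_zero_of_norm e2)⟩
      refine (AnalyticAt.differentiableAt ?_).differentiableWithinAt
      exact AnalyticAt.fun_mul (hk _ (by omega)).1
        (Finset.analyticAt_fun_prod _ fun j _ => (hk (n + j) (by omega)).2)
    · rw [mem_ball_zero_iff] at hz
      exact norm_term_le (fun k hk => (hb k hk z hz.le).2.2) hn k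
  exact hd.analyticOnNhd Metric.isOpen_ball t (by simpa using hr1)

/-- Descending induction by `cS_rec` from the tail, which is analytic as a locally uniform limit. -/
theorem analyticAt_cS {n : ℕ} {t : ℂ} (ht : ‖t‖ < rho)
    (h : ∀ k ≥ n, 1 - cv k t ∈ Complex.slitPlane ∧ 1 - cx k t ≠ 0) : AnalyticAt ℂ (cS n) t := by
  obtain ⟨K, hK⟩ := exists_analyticAt_tail ht
  have key : ∀ d m, n ≤ m → K ≤ m + d → AnalyticAt ℂ (cS m) t := by
    intro d
    induction d with
    | zero => exact fun m _ hm => hK m hm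
    | succ d ih =>
      intro m hn hm
      have h1 := h m hn
      refine (AnalyticAt.fun_add (analyticAt_ca ht h1.1 h1.2) (AnalyticAt.fun_mul
        (analyticAt_cm ht h1.1 h1.2) (ih (m + 1) (by omega) (by omega)))).congr ?_
      filter_upwards [eventually_norm_lt ht] with z hz
      exact (cS_rec m hz).symm
  exact key K n le_rfl (by omega)

theorem meromorphicAt_cS {n : ℕ} {t : ℂ} (ht : ‖t‖ < rho)
    (h : ∀ k ≥ n, 1 - cv k t ∈ Complex.slitPlane) : MeromorphicAt (cS n) t := by
  obtain ⟨K, hK⟩ := exists_analyticAt_tail ht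
  have key : ∀ d m, n ≤ m → K ≤ m + d → MeromorphicAt (cS m) t := by
    intro d
    induction d with
    | zero => exact fun m _ hm => (hK m hm).meromorphicAt
    | succ d ih =>
      intro m hn hm
      have h1 := h m hn
      have ha : MeromorphicAt (ca m) t := (analyticAt_ca_num ht h1).meromorphicAt.div
        (analyticAt_one_sub_cx ht h1).meromorphicAt
      have hm' : MeromorphicAt (cm m) t := (analyticAt_cm_num ht h1).meromorphicAt.div
        (analyticAt_one_sub_cx ht h1).meromorphicAt
      refine (ha.add (hm'.mul (ih (m + 1) (by omega) (by omega)))).congr ?_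
      refine eventually_nhdsWithin_of_eventually_nhds ?_
      filter_upwards [eventually_norm_lt ht] with z hz
      exact (cS_rec m hz).symm
  exact key K n le_rfl (by omega)

theorem norm_cv_lt_one_of_ne (k : ℕ) {t : ℂ} (ht : ‖t‖ ≤ sig 0) (hne : t ≠ sig 0) :
    ‖cv k t‖ < 1 := by
  have hr : ‖t‖ < rho := ht.trans_lt (sig_lt 0)
  have h0 := norm_nonneg t
  have hs : sig 0 ≤ sig k := strictMono_sig.monotone (Nat.zero_le k)
  rcases (ht.trans hs).eq_or_lt with h | h
  · have h1 := norm_cX_le k le_rfl hr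
    have h3 := one_sub_le_norm h1
    have h4 := one_sub_XR_pos k le_rfl hr
    have h6 : 0 < 1 - ‖t‖ := by linarith [rho_lt]
    -- On the boundary circle of a branch point the majorant equals 1, so strictness has to come
    -- from the factor 1 - t, where equality would force t to be real and positive.
    have h5 : 1 - ‖t‖ < ‖1 - t‖ := by
      refine lt_of_le_of_ne (one_sub_le_norm le_rfl) fun e => hne ?_
      have hts : ‖t‖ = sig 0 := le_antisymm ht (hs.trans h.ge)
      have hre : t.re = ‖t‖ := by
        have e1 := congrArg (· ^ 2) e
        simp only [Complex.sq_norm, Complex.normSq_apply, Complex.sub_re, Complex.sub_im,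
          Complex.one_re, Complex.one_im] at e1
        have e2 := Complex.sq_norm t
        rw [Complex.normSq_apply] at e2
        nlinarith
      have him : t.im = 0 := by
        have e2 := Complex.sq_norm t
        rw [Complex.normSq_apply, ← hre] at e2
        have : t.im * t.im = 0 := by nlinarith
        simpa using this
      apply Complex.ext
      · simp [hre, hts]
      · simp [him]
    have hX : 0 < XR k ‖t‖ := XR_pos k (h ▸ sig_pos k) hr.le
    have ht0 : 0 < ‖t‖ := h ▸ sig_pos k
    have : ‖cv k t‖ < vR k ‖t‖ := by
      rw [cv, vR, norm_div, norm_mul, norm_mul, norm_mul, norm_pow, Complex.norm_ofNat]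
      have e1 : 4 * ‖cX k t‖ * ‖t‖ ≤ 4 * XR k ‖t‖ * ‖t‖ := by gcongr
      refine div_lt_div₀' e1 ?_ (by positivity) (by positivity)
      have e2 : (1 - XR k ‖t‖) ^ 2 ≤ ‖1 - cX k t‖ ^ 2 := by gcongr
      have e3 : 0 < (1 - XR k ‖t‖) ^ 2 := by positivity
      nlinarith
    rw [h, vR_eq_one] at this
    exact this
  · exact (norm_cv_le k le_rfl hr).trans_lt ((vR_lt_one_iff h0 hr).mpr h)

theorem analyticAt_cS_of_norm_le (n : ℕ) {t : ℂ} (ht : ‖t‖ ≤ sig 0) (hne : t ≠ sig 0) :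
    AnalyticAt ℂ (cS n) t := by
  have hr := sig_lt 0
  refine analyticAt_cS (ht.trans_lt hr) fun k _ =>
    ⟨one_sub_mem_slitPlane (norm_cv_lt_one_of_ne k ht hne), one_sub_ne_zero_of_norm ?_⟩
  exact (norm_cx_le_cR k ht hr).trans_lt cR_sig_zero_lt.1

end PrudentPolygon

/-! ### The kernels have no branch point off the slit -/

namespace PrudentPolygon

open Set Filter Topology

theorem csqrt_im_pos {z : ℂ} (hz : 0 < z.im) : 0 < z.sqrt.im := by
  rw [Complex.sqrt, Complex.cpow_inv_two_im_eq_sqrt hz.le]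
  apply Real.sqrt_pos.mpr
  have : |z.re| < ‖z‖ := Complex.abs_re_lt_norm.mpr hz.ne'
  have := le_abs_self z.re
  linarith

theorem csqrt_im_neg {z : ℂ} (hz : z.im < 0) : z.sqrt.im < 0 := by
  rw [Complex.sqrt, Complex.cpow_inv_two_im_eq_neg_sqrt hz, neg_lt_zero]
  apply Real.sqrt_pos.mpr
  have : |z.re| < ‖z‖ := Complex.abs_re_lt_norm.mpr hz.ne
  have := le_abs_self z.re
  linarith

theorem csqrt_conj {z : ℂ} (hz : z ∈ Complex.slitPlane) :
    ((starRingEnd ℂ) z).sqrt = (starRingEnd ℂ) z.sqrt := by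
  have h := Complex.cpow_conj z 2⁻¹ (Complex.mem_slitPlane_iff_arg.mp hz).1
  rw [map_inv₀, Complex.conj_ofNat] at h
  rw [Complex.sqrt, Complex.sqrt, h, Complex.conj_conj]

theorem ch_quadratic {t : ℂ} (ht : ‖t‖ < rho) :
    t ^ 2 * ch t ^ 2 - (1 - t) ^ 2 * ch t + (1 - t) = 0 :=
  quadratic_of_sq (one_sub_ne_zero ht) (one_add_csqrt_ne_zero _) (csqrt_sq _) rfl

theorem cq_quadratic {t : ℂ} (ht : ‖t‖ < rho) :
    t * cq t ^ 2 - (t ^ 2 + 1) * cq t + 1 = 0 := by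
  unfold cq
  linear_combination t * ch_quadratic ht

theorem cq_ne_zero {t : ℂ} (ht : ‖t‖ < rho) : cq t ≠ 0 := by
  intro h
  have := cq_quadratic ht
  simp [h] at this

/-- With √t = a + i b the right side is Re - Im of (√t)³ + 1/√t. After squaring, the term free of ab
is R (R + 1/R)², where R = |t|; it exceeds 4 because the radicand of q is positive at R, and the
rest is positive. -/
theorem real_kernel_bound {a b : ℝ} (ha : 0 < a) (hb : 0 < b) (hr : a ^ 2 + b ^ 2 < rho) :
    2 < (a + b) * (a ^ 2 + b ^ 2 - 4 * (a * b) + 1 / (a ^ 2 + b ^ 2)) := by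
  have hR : 0 < a ^ 2 + b ^ 2 := by positivity
  have hab : 0 < a * b := by positivity
  have hm : 2 * (a * b) ≤ a ^ 2 + b ^ 2 := by nlinarith [sq_nonneg (a - b)]
  have hy : (a + b) ^ 2 = (a ^ 2 + b ^ 2) + 2 * (a * b) := by ring
  have hdisc := lt_rho_iff.mp hr
  have hr' := rho_lt
  generalize a ^ 2 + b ^ 2 = R at *
  generalize a * b = m at *
  have hK : R * (1 / R) = 1 := by field_simp
  have hi : 3 < 1 / R := by
    rw [lt_div_iff₀ hR]; linarith
  have hKR : 11 * R < 1 / R := by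
    rw [lt_div_iff₀ hR]; nlinarith
  have hdisc' : 4 * R < (R ^ 2 + 1) ^ 2 := by
    nlinarith [mul_pos (show 0 < 1 - R by linarith) hdisc]
  have h0 : 4 < R * (R + 1 / R) ^ 2 := by
    have : R * (R + 1 / R) ^ 2 = (R ^ 2 + 1) ^ 2 / R := by field_simp
    rw [this, lt_div_iff₀ hR]; linarith
  generalize 1 / R = I at *
  have hpos : 0 < R - 4 * m + I := by linarith
  have h1 : 4 < (a + b) ^ 2 * (R - 4 * m + I) ^ 2 := by
    rw [hy]
    have e : (R + 2 * m) * (R - 4 * m + I) ^ 2 = R * (R + I) ^ 2 +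
      2 * m * ((R + I) ^ 2 - 4 * (R + I) * R - 4 * (2 * m) * I + 4 * (2 * m) ^ 2) := by ring
    have : 0 < (R + I) ^ 2 - 4 * (R + I) * R - 4 * (2 * m) * I + 4 * (2 * m) ^ 2 := by
      nlinarith [mul_nonneg (sub_nonneg.mpr hm) (by linarith : 0 ≤ I), sq_nonneg m]
    rw [e]
    nlinarith [mul_pos hab this]
  by_contra! h
  have hy0 : 0 < a + b := by linarith
  have := mul_pos hy0 hpos
  nlinarith

/-- A complex number `z` of modulus less than one is determined by `z + 1 / z`; if the latter
stays to one side of a line through `2`, the argument of `z` is controlled by its modulus. -/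
theorem arg_lt_of_re_sub_im {z : ℂ} (hz0 : z ≠ 0) (hz1 : ‖z‖ < 1) (him : 0 < z.im)
    (h : 2 < (z + z⁻¹).re - (z + z⁻¹).im) : z.arg < 5 / 2 * -Real.log ‖z‖ := by
  set n := ‖z‖ with hn
  set α := z.arg with hα
  have hn0 : 0 < n := norm_pos_iff.mpr hz0
  have hα0 : 0 < α := by
    refine lt_of_le_of_ne (Complex.arg_nonneg_iff.mpr him.le) fun e => ?_
    exact him.ne' (Complex.arg_eq_zero_iff.mp e.symm).2
  have hαπ : α < Real.pi := lt_of_le_of_ne (Complex.arg_le_pi z) fun e =>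
    him.ne' (Complex.arg_eq_pi_iff.mp e).2
  set C := Real.cos (α / 2) with hC
  set S := Real.sin (α / 2) with hS
  have hC0 : 0 < C := Real.cos_pos_of_mem_Ioo ⟨by linarith, by linarith⟩
  have hS0 : 0 < S := Real.sin_pos_of_pos_of_lt_pi (by linarith) (by linarith)
  have hCS : S ^ 2 + C ^ 2 = 1 := Real.sin_sq_add_cos_sq _
  have hre : z.re = n * (C ^ 2 - S ^ 2) := by
    rw [← Complex.norm_mul_cos_arg z, ← hn, ← hα, show α = 2 * (α / 2) by ring, Real.cos_two_mul,
      ← hC]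
    linear_combination n * hCS
  have him' : z.im = n * (2 * S * C) := by
    rw [← Complex.norm_mul_sin_arg z, ← hn, ← hα, show α = 2 * (α / 2) by ring, Real.sin_two_mul]
  have hns : Complex.normSq z = n ^ 2 := by rw [hn, Complex.sq_norm]
  simp only [Complex.add_re, Complex.add_im, Complex.inv_re, Complex.inv_im, hns] at h
  rw [hre, him'] at h
  -- In half angles the hypothesis is a quadratic form A² + 2 A B - B² > 0 with A = (1 - n) cos and
  -- B = (1 + n) sin. Hence B < (1 + √2) A, and 5/2 exceeds 1 + √2.
  have key : 0 < ((1 - n) * C) ^ 2 + 2 * ((1 - n) * C) * ((1 + n) * S) - ((1 + n) * S) ^ 2 := by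
    have e : n * (n * (C ^ 2 - S ^ 2) + n * (C ^ 2 - S ^ 2) / n ^ 2 -
        (n * (2 * S * C) + -(n * (2 * S * C)) / n ^ 2)) - 2 * n * (S ^ 2 + C ^ 2) =
        ((1 - n) * C) ^ 2 + 2 * ((1 - n) * C) * ((1 + n) * S) - ((1 + n) * S) ^ 2 := by
      field_simp
      ring
    rw [← e, hCS]
    nlinarith
  have hA : 0 < (1 - n) * C := mul_pos (by linarith) hC0
  have hB : (1 + n) * S < 5 / 2 * ((1 - n) * C) := by
    by_contra! hB
    generalize (1 - n) * C = A at *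
    generalize (1 + n) * S = B at *
    nlinarith
  have htan : α / 2 < S / C := by
    rw [← Real.tan_eq_sin_div_cos]; exact Real.lt_tan (by linarith) (by linarith)
  -- The inequality log (1 + x) ≥ 2 x / (x + 2) at x = 1/n - 1.
  have hlog : 2 * ((1 - n) / (1 + n)) ≤ -Real.log n := by
    have h1 : 0 ≤ 1 / n - 1 := by rw [sub_nonneg, le_div_iff₀ hn0]; linarith
    have := Real.le_log_one_add_of_nonneg h1
    rw [show 1 + (1 / n - 1) = n⁻¹ by field_simp; ring, Real.log_inv] at this
    refine le_trans (le_of_eq ?_) this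
    rw [show 1 / n - 1 + 2 = (1 + n) / n by field_simp; ring,
      show 1 / n - 1 = (1 - n) / n by field_simp]
    field_simp
  have h3 : S / C < 5 / 2 * ((1 - n) / (1 + n)) := by
    rw [← mul_div_assoc, div_lt_div_iff₀ hC0 (by linarith)]; linarith
  linarith

theorem neg_log_rho_lt : -Real.log rho < 5 / 4 := by
  rw [← Real.log_inv, Real.log_lt_iff_lt_exp (inv_pos.mpr rho_pos)]
  have h1 : Real.exp (5 / 4) = Real.exp 1 * Real.exp (1 / 4) := by rw [← Real.exp_add]; norm_num
  have h2 := Real.exp_one_gt_d9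
  have h3 := Real.add_one_le_exp (1 / 4 : ℝ)
  have h4 : rho⁻¹ < 3.39 := by
    rw [inv_lt_comm₀ rho_pos (by norm_num)]
    refine lt_of_lt_of_le ?_ le_rho
    norm_num
  rw [h1]
  nlinarith

/-- Put s = √t and z = s q. Then z² = t q² and X_k = s z^(2k+1). The lower bound on |X_k| limits
(2k+1) (-log |z|), and `arg_lt_of_re_sub_im` turns this into a bound on the argument of X_k that
stays below π for every k. -/
theorem cX_im_pos (k : ℕ) {t : ℂ} (ht : ‖t‖ < rho) (him : 0 < t.im) (hX : rho ≤ ‖cX k t‖) :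
    0 < (cX k t).im := by
  have hr' := rho_lt
  have hr0 := rho_pos
  set s := t.sqrt with hs
  have hs2 : s ^ 2 = t := csqrt_sq t
  have ht0 : t ≠ 0 := fun h => by simp [h] at him
  have hs0 : s ≠ 0 := fun h => ht0 (by rw [← hs2, h]; simp)
  have ha : 0 < s.re := csqrt_re_pos (Complex.mem_slitPlane_iff.mpr (.inr him.ne'))
  have hb : 0 < s.im := csqrt_im_pos him
  have hns : ‖s‖ ^ 2 = ‖t‖ := by rw [← norm_pow, hs2]
  have hnab : s.re ^ 2 + s.im ^ 2 = ‖t‖ := by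
    rw [← hns, Complex.sq_norm, Complex.normSq_apply]; ring
  set z := s * cq t with hz
  have hz0 : z ≠ 0 := mul_ne_zero hs0 (cq_ne_zero ht)
  have hzP : z ^ 2 = cP t := by rw [hz, mul_pow, hs2, cP]
  have hz1 : ‖z‖ < 1 := by
    have h1 : ‖z‖ ^ 2 < 1 := by
      rw [← norm_pow, hzP]
      exact (norm_cP_le le_rfl ht).trans_lt (PR_lt_one (norm_nonneg t) ht)
    nlinarith [norm_nonneg z]
  -- The quadratic of q divided by s q.
  have hJ : z + z⁻¹ = s ^ 3 + s⁻¹ := by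
    have := cq_quadratic ht
    rw [← hs2] at this
    have hq := cq_ne_zero ht
    rw [← hs2] at hq
    rw [hz, ← hs2]
    field_simp
    linear_combination this
  have hnsq : Complex.normSq s = s.re ^ 2 + s.im ^ 2 := by rw [Complex.normSq_apply]; ring
  have hre : (z + z⁻¹).re = s.re ^ 3 - 3 * s.re * s.im ^ 2 + s.re / (s.re ^ 2 + s.im ^ 2) := by
    rw [hJ, Complex.add_re, Complex.inv_re, hnsq]
    simp [pow_succ]
    ring
  have him' : (z + z⁻¹).im = 3 * s.re ^ 2 * s.im - s.im ^ 3 - s.im / (s.re ^ 2 + s.im ^ 2) := by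
    rw [hJ, Complex.add_im, Complex.inv_im, hnsq]
    simp [pow_succ]
    ring
  have hR : s.re ^ 2 + s.im ^ 2 < rho := hnab ▸ ht
  have hRpos : 0 < s.re ^ 2 + s.im ^ 2 := by positivity
  have hJim : (z + z⁻¹).im < 0 := by
    have h3 : 3 * (s.re ^ 2 + s.im ^ 2) < 1 / (s.re ^ 2 + s.im ^ 2) := by
      rw [lt_div_iff₀ hRpos]; nlinarith
    have e : (z + z⁻¹).im = s.im * (3 * s.re ^ 2 - s.im ^ 2 - 1 / (s.re ^ 2 + s.im ^ 2)) := by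
      rw [him']; ring
    rw [e]
    apply mul_neg_of_pos_of_neg hb
    nlinarith [sq_nonneg s.im]
  -- Inside the unit disc z and z + 1/z have imaginary parts of opposite signs.
  have hzim : 0 < z.im := by
    have hn : 0 < Complex.normSq z := Complex.normSq_pos.mpr hz0
    have hn1 : Complex.normSq z < 1 := by
      rw [← Complex.sq_norm]; nlinarith [norm_nonneg z]
    have e : (z + z⁻¹).im * Complex.normSq z = -z.im * (1 - Complex.normSq z) := by
      rw [Complex.add_im, Complex.inv_im]; field_simp; ring
    by_contra! h
    have h1 : 0 ≤ -z.im * (1 - Complex.normSq z) := mul_nonneg (by linarith) (by linarith)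
    nlinarith
  have hα := arg_lt_of_re_sub_im hz0 hz1 hzim (by
    rw [hre, him']
    refine (real_kernel_bound ha hb hR).trans_eq ?_
    field_simp
    ring)
  have hα0 : 0 < z.arg := lt_of_le_of_ne (Complex.arg_nonneg_iff.mpr hzim.le) fun e =>
    hzim.ne' (Complex.arg_eq_zero_iff.mp e.symm).2
  have hθ0 : 0 < s.arg := lt_of_le_of_ne (Complex.arg_nonneg_iff.mpr hb.le) fun e =>
    hb.ne' (Complex.arg_eq_zero_iff.mp e.symm).2
  have hθ1 : s.arg < Real.pi / 2 := (abs_lt.mp (Complex.abs_arg_lt_pi_div_two_iff.mpr (.inl ha))).2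
  have hXs : cX k t = s * z ^ (2 * k + 1) := by
    rw [cX, pow_succ, pow_mul, hzP]
    nth_rewrite 1 [← hs2]
    rw [hz]; ring
  have hnz : 0 < ‖z‖ := norm_pos_iff.mpr hz0
  have hnspos : 0 < ‖s‖ := norm_pos_iff.mpr hs0
  have hlog : ((2 * k + 1 : ℕ) : ℝ) * -Real.log ‖z‖ ≤ 5 / 8 := by
    rw [hXs, norm_mul, norm_pow] at hX
    have h1 := Real.log_le_log hr0 hX
    rw [Real.log_mul hnspos.ne' (pow_pos hnz _).ne', Real.log_pow] at h1
    have h2 : Real.log (‖s‖ ^ 2) ≤ Real.log rho :=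
      Real.log_le_log (by positivity) (by rw [hns]; exact ht.le)
    rw [Real.log_pow] at h2
    have := neg_log_rho_lt
    push_cast at *
    linarith
  -- π/2 + (5/2)(5/8) = π/2 + 25/16, and 25/16 is just below 3.14/2.
  have hsum : s.arg + ((2 * k + 1 : ℕ) : ℝ) * z.arg < Real.pi := by
    have h1 : ((2 * k + 1 : ℕ) : ℝ) * z.arg ≤ ((2 * k + 1 : ℕ) : ℝ) * (5 / 2 * -Real.log ‖z‖) := by
      gcongr
    have := Real.pi_gt_d2
    linarith
  have hpolar : cX k t = ((‖s‖ * ‖z‖ ^ (2 * k + 1) : ℝ) : ℂ) *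
      Complex.exp (((s.arg + ((2 * k + 1 : ℕ) : ℝ) * z.arg : ℝ) : ℂ) * Complex.I) := by
    rw [hXs]
    nth_rewrite 1 [← Complex.norm_mul_exp_arg_mul_I s, ← Complex.norm_mul_exp_arg_mul_I z]
    rw [mul_pow, ← Complex.exp_nat_mul]
    push_cast
    rw [show ((s.arg : ℂ) + (2 * (k : ℂ) + 1) * z.arg) * Complex.I =
      s.arg * Complex.I + (2 * (k : ℂ) + 1) * (z.arg * Complex.I) by ring, Complex.exp_add]
    ring
  rw [hpolar, Complex.im_ofReal_mul, Complex.exp_ofReal_mul_I_im]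
  exact mul_pos (by positivity) (Real.sin_pos_of_pos_of_lt_pi (by positivity) hsum)

/-- The product of two numbers in the open upper half-plane is not a nonnegative real. -/
theorem one_sub_mul_mem_slitPlane {A B : ℂ} (hA : 0 < A.im) (hB : 0 < B.im) :
    1 - A * B ∈ Complex.slitPlane := by
  rw [Complex.mem_slitPlane_iff]
  by_contra! h
  obtain ⟨h1, h2⟩ := h
  simp only [Complex.sub_re, Complex.sub_im, Complex.one_re, Complex.one_im, Complex.mul_re,
    Complex.mul_im] at h1 h2
  have e : (A.re * B.re - A.im * B.im) * B.im = -(A.im * (B.re ^ 2 + B.im ^ 2)) := by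
    linear_combination -B.re * h2
  have h3 : 0 < A.im * (B.re ^ 2 + B.im ^ 2) := by positivity
  nlinarith

theorem im_div_one_sub {t : ℂ} (ht : 0 < t.im) : 0 < (t / (1 - t)).im := by
  have h1 : 1 - t ≠ 0 := fun h => by
    have := congrArg Complex.im h
    simp at this; linarith
  have hn : 0 < Complex.normSq (1 - t) := Complex.normSq_pos.mpr h1
  rw [Complex.div_im]
  have : t.im * (1 - t).re / Complex.normSq (1 - t) - t.re * (1 - t).im / Complex.normSq (1 - t) =
      t.im / Complex.normSq (1 - t) := by
    rw [← sub_div]; simp; ring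
  rw [this]; positivity

theorem im_koebe {X : ℂ} (h1 : ‖X‖ < 1) (hX : 0 < X.im) : 0 < (4 * X / (1 - X) ^ 2).im := by
  have h2 := one_sub_ne_zero_of_norm h1
  have hn : 0 < Complex.normSq (1 - X) := Complex.normSq_pos.mpr h2
  have e : 4 * X / (1 - X) ^ 2 =
      ((4 / Complex.normSq (1 - X) ^ 2 : ℝ) : ℂ) * (X * (starRingEnd ℂ) (1 - X) ^ 2) := by
    have h3 : (Complex.normSq (1 - X) : ℂ) = (1 - X) * (starRingEnd ℂ) (1 - X) :=
      (Complex.mul_conj _).symm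
    have h4 : (starRingEnd ℂ) (1 - X) ≠ 0 := (map_ne_zero _).mpr h2
    push_cast
    rw [h3]
    field_simp
  rw [e, Complex.im_ofReal_mul]
  refine mul_pos (by positivity) ?_
  have h5 : X.re ^ 2 + X.im ^ 2 < 1 := by
    have := Complex.sq_norm X
    rw [Complex.normSq_apply] at this
    nlinarith [norm_nonneg X]
  have e2 : (X * (starRingEnd ℂ) (1 - X) ^ 2).im = X.im * (1 - (X.re ^ 2 + X.im ^ 2)) := by
    simp [pow_two]; ring
  rw [e2]
  exact mul_pos hX (by linarith)

theorem cv_eq_mul (k : ℕ) (t : ℂ) : cv k t = t / (1 - t) * (4 * cX k t / (1 - cX k t) ^ 2) := by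
  rw [cv, div_mul_div_comm]; ring

/-- If |t| and |X_k| are both below ρ, then |cv k| is below 4 ρ² / (1 - ρ)³ = 1. -/
theorem rho_le_norm_cX {k : ℕ} {t : ℂ} (ht : ‖t‖ < rho) (hv : 1 ≤ ‖cv k t‖) :
    rho ≤ ‖cX k t‖ := by
  by_contra! hX
  have hr := rho_lt
  have h1 := one_sub_le_norm (le_refl ‖t‖)
  have h2 := one_sub_le_norm hX.le
  have h3 : 0 < 1 - rho := by linarith
  have h4 : 1 - rho ≤ ‖1 - t‖ := by linarith
  have h5 : ‖cv k t‖ < 1 := by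
    rw [cv, norm_div, norm_mul, norm_mul, norm_mul, norm_pow, Complex.norm_ofNat,
      div_lt_one (mul_pos (h3.trans_le h4) (pow_pos (h3.trans_le h2) 2))]
    calc 4 * ‖cX k t‖ * ‖t‖ ≤ 4 * rho * ‖t‖ := by gcongr
      _ < 4 * rho * rho := by have := rho_pos; gcongr
      _ = (1 - rho) * (1 - rho) ^ 2 := by linear_combination -one_sub_rho_cube
      _ ≤ ‖1 - t‖ * ‖1 - cX k t‖ ^ 2 := by gcongr
  linarith

/-- Either `cv k` lies in the unit disc, or X_k is in the upper half-plane. In the second case `cv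
k` is a product of two numbers of the upper half-plane and cannot be real and at least 1. -/
theorem one_sub_cv_mem_of_im_pos (k : ℕ) {t : ℂ} (ht : ‖t‖ < rho) (him : 0 < t.im) :
    1 - cv k t ∈ Complex.slitPlane := by
  by_cases hv : ‖cv k t‖ < 1
  · exact one_sub_mem_slitPlane hv
  · have hX := cX_im_pos k ht him (rho_le_norm_cX ht (not_lt.mp hv))
    rw [cv_eq_mul]
    exact one_sub_mul_mem_slitPlane (im_div_one_sub him) (im_koebe (norm_cX_lt_one k ht) hX)

section conj

variable {t : ℂ}

theorem ch_conj (ht : ‖t‖ < rho) : ch ((starRingEnd ℂ) t) = (starRingEnd ℂ) (ch t) := by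
  have h2 : ‖4 * t ^ 2 / (1 - t) ^ 3‖ < 1 :=
    (norm_v0_le le_rfl ht).trans_lt (v0_lt_one (norm_nonneg t) ht)
  have h := csqrt_conj (one_sub_mem_slitPlane h2)
  unfold ch
  simp only [map_div₀, map_mul, map_sub, map_add, map_one, map_pow, Complex.conj_ofNat] at h ⊢
  rw [h]

theorem cq_conj (ht : ‖t‖ < rho) : cq ((starRingEnd ℂ) t) = (starRingEnd ℂ) (cq t) := by
  simp [cq, ch_conj ht]

theorem cP_conj (ht : ‖t‖ < rho) : cP ((starRingEnd ℂ) t) = (starRingEnd ℂ) (cP t) := by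
  simp [cP, cq_conj ht]

theorem cc_conj (ht : ‖t‖ < rho) : cc ((starRingEnd ℂ) t) = (starRingEnd ℂ) (cc t) := by
  simp [cc, cq_conj ht, ch_conj ht]

theorem cX_conj (k : ℕ) (ht : ‖t‖ < rho) : cX k ((starRingEnd ℂ) t) = (starRingEnd ℂ) (cX k t) := by
  simp [cX, cq_conj ht, cP_conj ht]

theorem cv_conj (k : ℕ) (ht : ‖t‖ < rho) : cv k ((starRingEnd ℂ) t) = (starRingEnd ℂ) (cv k t) := by
  simp [cv, cX_conj k ht, Complex.conj_ofNat]

theorem one_sub_cv_mem_of_im_ne_zero (k : ℕ) (ht : ‖t‖ < rho) (him : t.im ≠ 0) :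
    1 - cv k t ∈ Complex.slitPlane := by
  rcases lt_or_gt_of_ne him with h | h
  · have ht' : ‖(starRingEnd ℂ) t‖ < rho := by rwa [Complex.norm_conj]
    have := one_sub_cv_mem_of_im_pos k ht' (by simpa using h)
    rw [cv_conj k ht] at this
    rw [Complex.mem_slitPlane_iff] at this ⊢
    simpa using this
  · exact one_sub_cv_mem_of_im_pos k ht h

theorem cS_conj (n : ℕ) (ht : ‖t‖ < rho) (hv : ∀ k, 1 - cv k t ∈ Complex.slitPlane) :
    cS n ((starRingEnd ℂ) t) = (starRingEnd ℂ) (cS n t) := by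
  have hw : ∀ k, cw k ((starRingEnd ℂ) t) = (starRingEnd ℂ) (cw k t) := fun k => by
    rw [cw, cw, ← csqrt_conj (hv k), cv_conj k ht]; simp
  have hβ : ∀ k, cβ k ((starRingEnd ℂ) t) = (starRingEnd ℂ) (cβ k t) := fun k => by
    simp [cβ, hw, cX_conj k ht, Complex.conj_ofNat]
  have hx : ∀ k, cx k ((starRingEnd ℂ) t) = (starRingEnd ℂ) (cx k t) := fun k => by
    simp [cx, hβ, cX_conj k ht, ch_conj ht]
  have ha : ∀ k, ca k ((starRingEnd ℂ) t) = (starRingEnd ℂ) (ca k t) := fun k => by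
    simp [ca, hβ, hx, cc_conj ht, ch_conj ht]
  have hm : ∀ k, cm k ((starRingEnd ℂ) t) = (starRingEnd ℂ) (cm k t) := fun k => by
    simp [cm, hx, cc_conj ht]
  rw [cS, cS, Complex.conj_tsum]
  simp [ha, hm]

theorem one_sub_cv_mem_slitPlane (k : ℕ) (ht : t ∈ slitDisc (sig 0) rho) :
    1 - cv k t ∈ Complex.slitPlane := by
  obtain ⟨h1, h2⟩ := ht
  rw [mem_ball_zero_iff] at h1
  by_cases him : t.im = 0
  · have htr : (t.re : ℂ) = t := Complex.ext (by simp) (by simp [him])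
    have hnorm : ‖t‖ = |t.re| := by rw [← htr]; simp
    rcases le_or_gt 0 t.re with h0 | h0
    · have hlt : t.re < sig 0 := by
        by_contra! h
        exact h2 ⟨t.re, ⟨h, by rw [hnorm, abs_of_nonneg h0] at h1; exact h1⟩, htr⟩
      refine one_sub_mem_slitPlane (norm_cv_lt_one_of_ne k ?_ ?_)
      · rw [hnorm, abs_of_nonneg h0]; exact hlt.le
      · intro h
        rw [h] at hlt
        simp at hlt
    -- For negative t everything is real, and (1 - t)(1 - X)² - 4 X t = (1 - X)² - t (1 + X)² is
    -- positive.
    · have hXr : ((cX k t).re : ℂ) = cX k t := by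
        rw [← Complex.conj_eq_iff_re, ← cX_conj k h1, Complex.conj_eq_iff_re.mpr htr]
      have hXn := norm_cX_lt_one k h1
      rw [← hXr, Complex.norm_real, Real.norm_eq_abs, abs_lt] at hXn
      rw [Complex.mem_slitPlane_iff]
      left
      rw [cv, ← hXr]
      generalize (cX k t).re = X at *
      have e : (1 - 4 * (X : ℂ) * t / ((1 - t) * (1 - (X : ℂ)) ^ 2)) =
        ((1 - 4 * X * t.re / ((1 - t.re) * (1 - X) ^ 2) : ℝ) : ℂ) := by push_cast; rw [htr]
      rw [e, Complex.ofReal_re, sub_pos]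
      have hX1 : 0 < 1 - X := by linarith
      have hr1 : 0 < 1 - t.re := by linarith
      rw [div_lt_one (by positivity)]
      nlinarith [sq_nonneg (1 + X), mul_pos hX1 hX1, mul_nonneg (neg_nonneg.mpr h0.le) (sq_nonneg (1 + X)), mul_pos hr1 (mul_pos hX1 hX1)]
  · exact one_sub_cv_mem_of_im_ne_zero k h1 him

theorem meromorphicOn_cS (n : ℕ) : MeromorphicOn (cS n) (slitDisc (sig 0) rho) := fun t ht =>
  meromorphicAt_cS (by simpa using ht.1) fun k _ => one_sub_cv_mem_slitPlane k ht

end conj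

end PrudentPolygon

/-! ### For small positive t the series counts polygons -/

namespace PrudentPolygon

open Set Filter Topology

section real

variable {t : ℝ}

theorem norm_ofReal_lt (h0 : 0 ≤ t) (ht : t < rho) : ‖(t : ℂ)‖ < rho := by
  rwa [Complex.norm_real, Real.norm_eq_abs, abs_of_nonneg h0]

theorem ch_ofReal (h0 : 0 ≤ t) (ht : t < rho) : ch t = hR t := by
  have h := csqrt_ofReal (sub_nonneg.mpr (v0_lt_one h0 ht).le)
  push_cast at h
  rw [ch, h, hR]
  push_cast
  rfl

theorem cq_ofReal (h0 : 0 ≤ t) (ht : t < rho) : cq t = qR t := by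
  rw [cq, ch_ofReal h0 ht, qR]; push_cast; rfl

theorem cP_ofReal (h0 : 0 ≤ t) (ht : t < rho) : cP t = PR t := by
  rw [cP, cq_ofReal h0 ht, PR]; push_cast; rfl

theorem cc_ofReal (h0 : 0 ≤ t) (ht : t < rho) : cc t = cR t := by
  rw [cc, cq_ofReal h0 ht, ch_ofReal h0 ht, cR]; push_cast; rfl

theorem cX_ofReal (k : ℕ) (h0 : 0 ≤ t) (ht : t < rho) : cX k t = XR k t := by
  rw [cX, cq_ofReal h0 ht, cP_ofReal h0 ht, XR]; push_cast; rfl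

theorem cv_ofReal (k : ℕ) (h0 : 0 ≤ t) (ht : t < rho) : cv k t = vR k t := by
  rw [cv, cX_ofReal k h0 ht, vR]; push_cast; rfl

/-- The real version of `cβ`. -/
noncomputable def βR (k : ℕ) (t : ℝ) : ℝ := 2 * t / ((1 - XR k t) * (1 + √(1 - vR k t)))

/-- The real version of `cx`. -/
noncomputable def xR (k : ℕ) (t : ℝ) : ℝ := hR t * (XR k t * βR k t)

theorem cw_ofReal (k : ℕ) (h0 : 0 ≤ t) (ht : t ≤ sig k) : cw k t = (√(1 - vR k t) : ℝ) := by
  have h := csqrt_ofReal (sub_nonneg.mpr (vR_le_one h0 ht))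
  rw [cw, cv_ofReal k h0 (ht.trans_lt (sig_lt k)), ← h]; push_cast; rfl

theorem cβ_ofReal (k : ℕ) (h0 : 0 ≤ t) (ht : t ≤ sig k) : cβ k t = βR k t := by
  rw [cβ, cw_ofReal k h0 ht, cX_ofReal k h0 (ht.trans_lt (sig_lt k)), βR]; push_cast; rfl

theorem cx_ofReal (k : ℕ) (h0 : 0 ≤ t) (ht : t ≤ sig k) : cx k t = xR k t := by
  have ht' := ht.trans_lt (sig_lt k)
  rw [cx, cβ_ofReal k h0 ht, cX_ofReal k h0 ht', ch_ofReal h0 ht', xR]; push_cast; rfl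

theorem βR_nonneg (k : ℕ) (h0 : 0 ≤ t) (ht : t < rho) : 0 ≤ βR k t := by
  have : 0 < 1 - XR k t := by linarith [XR_lt_one k h0 ht]
  unfold βR; positivity

theorem xR_nonneg (k : ℕ) (h0 : 0 ≤ t) (ht : t < rho) : 0 ≤ xR k t :=
  mul_nonneg (hR_pos ht.le).le (mul_nonneg (XR_nonneg k h0 ht.le) (βR_nonneg k h0 ht))

end real

/-- The kernel equation, over any field. -/
theorem kernel_quadratic {K : Type*} [Field K] {t X w b : K} (h1 : 1 - t ≠ 0) (h2 : 1 - X ≠ 0)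
    (h3 : 1 + w ≠ 0) (hw : w ^ 2 = 1 - 4 * X * t / ((1 - t) * (1 - X) ^ 2))
    (hb : b = X * (2 * t / ((1 - X) * (1 + w)))) :
    b ^ 2 - b * (1 - t) * (1 - X) + X * t * (1 - t) = 0 := by
  have e : (1 - t) * (1 - X) ^ 2 * w ^ 2 = (1 - t) * (1 - X) ^ 2 - 4 * X * t := by
    rw [hw]; field_simp
  subst hb
  field_simp
  linear_combination X * t * e

theorem small_bounds {t : ℝ} (h0 : 0 < t) (ht : t ≤ 1 / 50) :
    hR t ≤ 2.1 ∧ qR t ≤ 1.1 ∧ cR t ≤ 1 / 8 := by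
  have hr := le_rho
  have h1 : hR t ≤ 2.1 := by
    have h2 := Real.sqrt_nonneg (1 - 4 * t ^ 2 / (1 - t) ^ 3)
    have h3 : 0 < (1 - t) * (1 + √(1 - 4 * t ^ 2 / (1 - t) ^ 3)) :=
      mul_pos (by linarith) (by linarith)
    unfold hR
    rw [div_le_iff₀ h3]
    nlinarith
  have h2 : qR t ≤ 1.1 := by
    unfold qR; nlinarith [hR_pos (t := t) (by linarith)]
  refine ⟨h1, h2, ?_⟩
  have h3 := hR_pos (t := t) (by linarith)
  have h4 := one_le_qR h0.le (by linarith : t ≤ rho)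
  have h5 : t * qR t ≤ 0.022 := by nlinarith
  have h6 : t * hR t ≤ 0.042 := by nlinarith
  have h7 : 0 ≤ t * hR t := by positivity
  unfold cR
  rw [div_le_iff₀ (by linarith)]
  nlinarith

/-- For small `t` the iterated solution of the functional equation counts walks. -/
theorem cS_zero_eq_total {t : ℝ} (h0 : 0 < t) (ht : t ≤ 1 / 50) :
    cS 0 t = (total t (exitRight 1) : ℝ) := by
  obtain ⟨b1, b2, b3⟩ := small_bounds h0 ht
  have hr : t < rho := by linarith [le_rho]
  have hσ : ∀ k, t ≤ sig k := fun k => by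
    have := strictMono_sig.monotone (Nat.zero_le k)
    linarith [le_sig_zero]
  have hn := norm_ofReal_lt h0.le hr
  have hP0 := PR_pos h0 hr.le
  have hP1 := PR_lt_one h0.le hr
  have hc0 := cR_nonneg h0.le hr
  have hnt : ‖(t : ℂ)‖ ≤ t := by
    rw [Complex.norm_real, Real.norm_eq_abs, abs_of_nonneg h0.le]
  set T : ℕ → ℝ := fun k => total t (exitRight (PR t ^ k)) with hT
  have hx : ∀ k, ‖cx k t‖ ≤ 1 / 4 := fun k => (norm_cx_le_cR k hnt hr).trans (by linarith)
  have hrec : ∀ k, (T k : ℂ) = ca k t + cm k t * T (k + 1) := by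
    intro k
    have hX := XR_pos k h0 hr.le
    have hX1 : 0 < 1 - XR k t := by linarith [XR_lt_one k h0.le hr]
    have hv : vR k t ≤ 1 := vR_le_one h0.le (hσ k)
    have hxk := hx k
    rw [cx_ofReal k h0.le (hσ k), Complex.norm_real, Real.norm_eq_abs] at hxk
    have hβ := βR_nonneg k h0.le hr
    have hβ' : βR k t * XR k t ≤ 0.1 := by
      have hX0 := XR_le_XR_zero k h0.le hr
      rw [XR_zero] at hX0
      have hX2 : XR k t ≤ 0.03 := by nlinarith
      have : βR k t ≤ 2 * t / (1 - XR k t) := by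
        unfold βR
        have := Real.sqrt_nonneg (1 - vR k t)
        gcongr
        nlinarith
      have : βR k t ≤ 1 := this.trans (by rw [div_le_one hX1]; linarith)
      nlinarith
    -- At y = P^k the kernel argument t q y is X_k, and t q² y is P^(k+1).
    have E := total_exitRight_rec (t := t) (q := qR t) (b := XR k t * βR k t) (y := PR t ^ k) h0
      (one_lt_qR h0 hr.le) (by nlinarith) (qR_quadratic h0.le hr.le) (by positivity)
      (pow_le_one₀ hP0.le hP1.le) (by positivity) (by linarith)
      (kernel_quadratic (w := √(1 - vR k t)) (by linarith) hX1.ne' (by positivity)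
        (Real.sq_sqrt (by linarith)) rfl)
    have hh : (qR t - 1) / t = hR t := by
      rw [qR]; field_simp; ring
    have hc : t * qR t * (qR t - 1) / (1 - t * qR t) = cR t := by
      rw [cR, qR]; ring
    rw [show t * qR t * PR t ^ k = XR k t from rfl, mul_div_cancel_left₀ _ hX.ne', hh, hc,
      show t * qR t ^ 2 * PR t ^ k = PR t ^ (k + 1) by unfold PR; ring] at E
    change (1 - xR k t) * T k = (1 - cR t) * (hR t * βR k t) +
      cR t * (cR t - xR k t) * T (k + 1) at E
    have hne : (1 : ℝ) - xR k t ≠ 0 := by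
      have := le_abs_self (xR k t)
      linarith
    rw [ca, cm, cc_ofReal h0.le hr, cx_ofReal k h0.le (hσ k), cβ_ofReal k h0.le (hσ k),
      ch_ofReal h0.le hr]
    have hne' : (1 : ℂ) - (xR k t : ℂ) ≠ 0 := by exact_mod_cast hne
    field_simp
    have E' := congrArg (fun x : ℝ => (x : ℂ)) E
    push_cast at E'
    linear_combination E'
  have hmb : ∀ k, ‖cm k t‖ ≤ 1 / 2 := by
    intro k
    have h1 := one_sub_le_norm (hx k)
    have h2 := norm_cc_le hnt hr
    have h3 : ‖cc t - cx k t‖ ≤ 1 / 8 + 1 / 4 := (norm_sub_le _ _).trans (by linarith [hx k])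
    rw [cm, norm_div, norm_mul, div_le_iff₀ (by linarith)]
    nlinarith [norm_nonneg (cc t), norm_nonneg (cc t - cx k t)]
  -- Unrolled n times, the recursion leaves the remainder (∏ m_j) T_n. It tends to 0, since |m_j| ≤
  -- 1/2 and every T_n is at most the sum at y = 1.
  have hpart : ∀ n, ∑ k ∈ Finset.range n, ca (0 + k) t * ∏ j ∈ Finset.range k, cm (0 + j) t =
      T 0 - (∏ j ∈ Finset.range n, cm j t) * T n := by
    intro n
    induction n with
    | zero => simp
    | succ n ih =>
      rw [Finset.sum_range_succ, ih, Finset.prod_range_succ, hrec n]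
      simp only [zero_add]
      ring
  have hlim : Tendsto (fun n => (∏ j ∈ Finset.range n, cm j t) * (T n : ℂ)) atTop (𝓝 0) := by
    have hg : Tendsto (fun n : ℕ => (1 / 2 : ℝ) ^ n * total t (exitRight 1)) atTop (𝓝 0) := by
      simpa using (tendsto_pow_atTop_nhds_zero_of_lt_one (by norm_num : (0 : ℝ) ≤ 1 / 2)
        (by norm_num)).mul_const (total t (exitRight 1))
    refine squeeze_zero_norm (fun n => ?_) hg
    rw [norm_mul, norm_prod, Complex.norm_real, Real.norm_eq_abs,
      abs_of_nonneg (total_exitRight_nonneg h0.le (by positivity))]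
    refine mul_le_mul ?_ ?_ (total_exitRight_nonneg h0.le (by positivity)) (by positivity)
    · calc ∏ j ∈ Finset.range n, ‖cm j t‖ ≤ ∏ _j ∈ Finset.range n, (1 / 2 : ℝ) :=
          Finset.prod_le_prod (fun _ _ => norm_nonneg _) fun j _ => hmb j
        _ = (1 / 2) ^ n := by simp
    · exact total_exitRight_le h0.le (by linarith) (by positivity) (pow_le_one₀ hP0.le hP1.le)
  have h1 := (summable_term 0 hn).hasSum.tendsto_sum_nat
  simp only [hpart] at h1
  have h2 := tendsto_const_nhds.sub hlim (f := fun _ => (T 0 : ℂ))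
  rw [sub_zero] at h2
  have h3 := tendsto_nhds_unique h1 h2
  rw [cS, h3]
  simp [hT]

theorem hasSum_genericCount_small {t : ℝ} (h0 : 0 < t) (ht : t ≤ 1 / 50) :
    HasSum (fun n : ℕ => (genericCount n : ℂ) * (t : ℂ) ^ n) (t * cS 0 t) := by
  have := hasSum_genericCount h0.le (by linarith : t ≤ 1 / 25)
  rw [cS_zero_eq_total h0 ht]
  exact_mod_cast this

theorem hasSum_threeSidedCount_small {t : ℝ} (h0 : 0 < t) (ht : t ≤ 1 / 50) :
    HasSum (fun n : ℕ => (threeSidedCount n : ℂ) * (t : ℂ) ^ n)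
      (2 * (t * cS 0 t + t ^ 2 / (1 - t) + (t * ch t - t))) := by
  have h := hasSum_threeSidedCount h0.le (by linarith : t ≤ 1 / 25)
  obtain ⟨b1, b2, b3⟩ := small_bounds h0 ht
  have hr : t < rho := by linarith [le_rho]
  have hh := hR_pos hr.le
  have hq := hR_quadratic h0.le hr.le
  have hb : t * (t * hR t) ≤ 0.1 := by nlinarith
  have hN : 1 - (t + t * (t * hR t)) ≠ 0 := by linarith
  set V := t * (t * hR t) / (1 - (t + t * (t * hR t))) with hVdef
  have hV : V * (1 - (t + t * (t * hR t))) = t * (t * hR t) := div_mul_cancel₀ _ hN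
  -- For `X = 1` the excursion weight is P = t h: its equation is the quadratic of h.
  rw [total_exitFirstRow (N := t + t * (t * hR t)) (P := t * hR t) (V := V) h0.le (by linarith)
    (by positivity) (by linarith) rfl (by linear_combination hV)
    (mul_right_cancel₀ hN (by linear_combination -t * hq - (t + t * (t * hR t)) * hV))] at h
  rw [cS_zero_eq_total h0 ht, ch_ofReal h0.le hr]
  exact_mod_cast h

end PrudentPolygon

/-! ### Branches of the square root and the invariant interval -/

namespace PrudentPolygon

open Set Filter Topology

/-- The two sides agree up to sign. If a and ab lie on the same side of the real axis, or a is
positive, comparing real and imaginary parts rules out the minus sign. -/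
theorem csqrt_mul {a b : ℂ} (hb : b ∈ Complex.slitPlane)
    (h : (a.im < 0 ∧ (a * b).im < 0) ∨ (0 < a.im ∧ 0 < (a * b).im) ∨
      (a.im = 0 ∧ 0 < a.re ∧ a * b ∈ Complex.slitPlane)) :
    (a * b).sqrt = a.sqrt * b.sqrt := by
  have hsq : (a * b).sqrt ^ 2 = (a.sqrt * b.sqrt) ^ 2 := by
    rw [csqrt_sq, mul_pow, csqrt_sq, csqrt_sq]
  rcases sq_eq_sq_iff_eq_or_eq_neg.mp hsq with e | e
  · exact e
  exfalso
  have hB := csqrt_re_pos hb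
  have e1 := congrArg Complex.re e
  have e2 := congrArg Complex.im e
  simp only [Complex.neg_re, Complex.neg_im, Complex.mul_re, Complex.mul_im] at e1 e2
  rcases h with ⟨h1, h2⟩ | ⟨h1, h2⟩ | ⟨h1, h2, h3⟩
  · have p1 := csqrt_re_pos (Complex.mem_slitPlane_iff.mpr (.inr h2.ne))
    have p2 := csqrt_im_neg h2
    have p3 := csqrt_re_pos (Complex.mem_slitPlane_iff.mpr (.inr h1.ne))
    have p4 := csqrt_im_neg h1
    have p5 : 0 < b.sqrt.im := by
      by_contra! h
      nlinarith [mul_nonneg p3.le (neg_nonneg.mpr h), mul_pos (neg_pos.mpr p4) hB]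
    nlinarith [mul_pos p3 hB, mul_pos (neg_pos.mpr p4) p5]
  · have p1 := csqrt_re_pos (Complex.mem_slitPlane_iff.mpr (.inr h2.ne'))
    have p2 := csqrt_im_pos h2
    have p3 := csqrt_re_pos (Complex.mem_slitPlane_iff.mpr (.inr h1.ne'))
    have p4 := csqrt_im_pos h1
    have p5 : b.sqrt.im < 0 := by
      by_contra! h
      nlinarith [mul_nonneg p3.le h, mul_pos p4 hB]
    nlinarith [mul_pos p3 hB, mul_pos p4 (neg_pos.mpr p5)]
  · have p1 := csqrt_re_pos h3
    have ha : a = (a.re : ℂ) := Complex.ext (by simp) (by simp [h1])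
    have p3 : a.sqrt = (√a.re : ℝ) := by
      conv_lhs => rw [ha]
      exact csqrt_ofReal h2.le
    rw [p3] at e1
    simp only [Complex.ofReal_re, Complex.ofReal_im, zero_mul, sub_zero] at e1
    nlinarith [mul_pos (Real.sqrt_pos.mpr h2) hB]

theorem csqrt_neg_of_im_pos {y : ℂ} (hy : 0 < y.im) : (-y).sqrt = -Complex.I * y.sqrt := by
  have hsq : (-y).sqrt ^ 2 = (-Complex.I * y.sqrt) ^ 2 := by
    rw [csqrt_sq, mul_pow, csqrt_sq, neg_sq, Complex.I_sq]; ring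
  rcases sq_eq_sq_iff_eq_or_eq_neg.mp hsq with e | e
  · exact e
  exfalso
  have e1 := congrArg Complex.re e
  simp at e1
  have h1 := csqrt_im_pos hy
  have h2 := csqrt_re_nonneg (-y)
  linarith

/-- The small root of the kernel as a function of the square root of the discriminant. -/
theorem kernel_root {K : Type*} [Field K] {t X w : K} (h1 : 1 - t ≠ 0) (h2 : 1 - X ≠ 0)
    (h3 : 1 + w ≠ 0) (h4 : (2 : K) ≠ 0)
    (hw : w ^ 2 = 1 - 4 * X * t / ((1 - t) * (1 - X) ^ 2)) :
    X * (2 * t / ((1 - X) * (1 + w))) = (1 - t) * (1 - X) * (1 - w) / 2 := by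
  have e : (1 - t) * (1 - X) ^ 2 * w ^ 2 = (1 - t) * (1 - X) ^ 2 - 4 * X * t := by
    rw [hw]; field_simp
  field_simp
  linear_combination e

/-- The value of `cx` when the square root of the discriminant vanishes. -/
noncomputable def cA (k : ℕ) (t : ℂ) : ℂ := ch t * ((1 - t) * (1 - cX k t) / 2)

/-- Rationalising the kernel root makes `cx` affine in the square root of the discriminant, the form
needed for singular expansions. -/
theorem cx_eq (k : ℕ) {t : ℂ} (ht : ‖t‖ < rho) : cx k t = cA k t * (1 - cw k t) := by
  have := kernel_root (one_sub_ne_zero ht) (one_sub_ne_zero_of_norm (norm_cX_lt_one k ht))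
    (one_add_csqrt_ne_zero (1 - cv k t)) two_ne_zero (csqrt_sq _)
  rw [cx, cβ, cw, this, cA]
  ring

theorem analyticAt_cA (k : ℕ) {t : ℂ} (ht : ‖t‖ < rho) : AnalyticAt ℂ (cA k) t := by
  have h1 := analyticAt_ch ht
  have h2 := analyticAt_cX ht k
  unfold cA
  exact AnalyticAt.fun_mul h1 (AnalyticAt.fun_div (AnalyticAt.fun_mul (by fun_prop)
    (AnalyticAt.fun_sub analyticAt_const h2)) analyticAt_const two_ne_zero)

theorem ca_eq (k : ℕ) {t : ℂ} (hX : cX k t ≠ 0) :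
    ca k t = (1 - cc t) * (cx k t / cX k t) / (1 - cx k t) := by
  rw [ca, show ch t * cβ k t = cx k t / cX k t by rw [cx]; field_simp]

section real

variable {t : ℝ}

theorem cR_pos (h0 : 0 < t) (ht : t < rho) : 0 < cR t := by
  have h1 := XR_lt_one 0 h0.le ht
  have h2 := XR_pos 0 h0 ht.le
  have h3 := hR_pos ht.le
  rw [XR_zero] at *
  have : 0 < 1 - t * qR t := by linarith
  unfold cR; positivity

/-- Up to σ_k one has X_k ≤ (1 - √t) / (1 + √t), that is X / (1 - X) ≤ (1 - √t) / (2 √t). -/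
theorem xR_le_xbar (k : ℕ) (h0 : 0 < t) (ht : t ≤ sig k) : xR k t ≤ xbar t := by
  have hr := ht.trans_lt (sig_lt k)
  have hX0 := XR_pos k h0 hr.le
  have hX1 : 0 < 1 - XR k t := by linarith [XR_lt_one k h0.le hr]
  have hXU : XR k t ≤ critX t := by
    by_contra! h
    exact absurd ((critX_lt_XR_iff k h0.le hr.le).mp h) (not_lt.mpr ht)
  have hh := hR_pos hr.le
  have hs : 0 < √t := Real.sqrt_pos.mpr h0
  have hβ : βR k t ≤ 2 * t / (1 - XR k t) := by
    unfold βR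
    have := Real.sqrt_nonneg (1 - vR k t)
    gcongr
    nlinarith
  have h1 : XR k t / (1 - XR k t) ≤ (1 - √t) / (2 * √t) := by
    rw [critX, le_div_iff₀ (by positivity)] at hXU
    rw [div_le_div_iff₀ hX1 (by positivity)]
    nlinarith
  calc xR k t ≤ hR t * (XR k t * (2 * t / (1 - XR k t))) := by unfold xR; gcongr
    _ = hR t * (2 * t) * (XR k t / (1 - XR k t)) := by ring
    _ ≤ hR t * (2 * t) * ((1 - √t) / (2 * √t)) := by gcongr
    _ = xbar t := by unfold xbar; field_simp

theorem xbar_lt_one (h0 : 0 < t) (ht : t < rho) (hstar : xbar t * (2 - cR t) < 1) :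
    xbar t < 1 := by
  have := cR_lt_one h0.le ht
  nlinarith

/-- The unit interval is preserved by the normalised functional equation. -/
theorem cX_mul_cS_mem {n : ℕ} (h0 : 0 < t) (ht : ∀ k ≥ n, t ≤ sig k)
    (hstar : xbar t * (2 - cR t) < 1) :
    cX n t * cS n t ∈ Complex.ofReal '' Icc 0 1 := by
  have hr : t < rho := (ht n le_rfl).trans_lt (sig_lt n)
  have hc0 := cR_pos h0 hr
  have hc1 := cR_lt_one h0.le hr
  have hcP := cR_lt_PR h0 hr
  have hP := PR_pos h0 hr.le
  have hxb := xbar_lt_one h0 hr hstar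
  have hn := norm_ofReal_lt h0.le hr
  have key : ∀ m k, n ≤ k → cX k t * ∑ i ∈ Finset.range m,
      ca (k + i) t * ∏ j ∈ Finset.range i, cm (k + j) t ∈ Complex.ofReal '' Icc 0 1 := by
    intro m
    induction m with
    | zero => exact fun k _ => ⟨0, by simp, by simp⟩
    | succ m ih =>
      intro k hk
      obtain ⟨y, ⟨hy0, hy1⟩, hy⟩ := ih (k + 1) (by omega)
      have hX := XR_pos k h0 hr.le
      have hx0 := xR_nonneg k h0.le hr
      have hxx := xR_le_xbar k h0 (ht k hk)
      have hne : 1 - xR k t ≠ 0 := by linarith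
      rw [Finset.sum_range_succ']
      simp only [term_succ]
      rw [← Finset.mul_sum]
      simp only [Finset.range_zero, Finset.prod_empty, add_zero, mul_one]
      have hXc : cX k t ≠ 0 := by
        rw [cX_ofReal k h0.le hr]; exact_mod_cast hX.ne'
      have hX1 : cX (k + 1) t = cP t * cX k t := by rw [cX, cX, pow_succ]; ring
      have hPc : cP t ≠ 0 := by rw [cP_ofReal h0.le hr]; exact_mod_cast hP.ne'
      rw [hX1] at hy
      set Z := ∑ i ∈ Finset.range m, ca (k + 1 + i) t * ∏ j ∈ Finset.range i, cm (k + 1 + j) t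
      have hZ : cX k t * Z = y / cP t := by rw [hy]; field_simp
      -- The recursion for X_k S_k; the factor 1 / P appears because X_{k+1} = P X_k.
      refine ⟨((1 - cR t) * xR k t + cR t / PR t * (cR t - xR k t) * y) / (1 - xR k t),
        ?_, ?_⟩
      · have hκ0 : 0 < cR t / PR t := by positivity
        have hκ1 : cR t / PR t < 1 := by rw [div_lt_one hP]; exact hcP
        have hpos : 0 < 1 - xR k t := by linarith
        generalize cR t / PR t = κ at *
        rw [mem_Icc, le_div_iff₀ hpos, div_le_one hpos]
        have hκy : κ * y ≤ 1 := by nlinarith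
        have hκy0 : 0 ≤ κ * y := by positivity
        rw [show κ * (cR t - xR k t) * y = κ * y * (cR t - xR k t) by ring]
        generalize κ * y = η at *
        -- For x ≤ c the numerator is between 0 and c (1 - x). For x > c it is at least c (1 - x)
        -- and at most (1 - c) x, and the latter is below 1 - x exactly when x (2 - c) < 1.
        rcases le_total (xR k t) (cR t) with h | h
        · constructor <;> nlinarith
        · constructor <;> nlinarith
      · have : cX k t * (cm k t * Z + ca k t) = cm k t * (cX k t * Z) + cX k t * ca k t := by ring
        rw [this, hZ, ca_eq k hXc, cm, cc_ofReal h0.le hr, cx_ofReal k h0.le (ht k hk),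
          cP_ofReal h0.le hr]
        rw [cP_ofReal h0.le hr] at hPc
        have hne' : (1 : ℂ) - (xR k t : ℂ) ≠ 0 := by exact_mod_cast hne
        push_cast
        field_simp
        ring
  have hclosed : IsClosed (Complex.ofReal '' Icc (0 : ℝ) 1) :=
    (isCompact_Icc.image Complex.continuous_ofReal).isClosed
  refine hclosed.mem_of_tendsto
    ((summable_term n hn).hasSum.tendsto_sum_nat.const_mul (cX n t))
    (.of_forall fun m => key m n le_rfl)

end real

end PrudentPolygon

/-! ### Square root singularities at the points σ_N -/

namespace PrudentPolygon

open Set Filter Topology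

theorem norm_sig_lt (N : ℕ) : ‖((sig N : ℝ) : ℂ)‖ < rho := norm_ofReal_lt (sig_pos N).le (sig_lt N)

theorem analyticAt_dslope {f : ℂ → ℂ} {a : ℂ} (hf : AnalyticAt ℂ f a) :
    AnalyticAt ℂ (dslope f a) a := by
  obtain ⟨p, hp⟩ := hf
  exact ⟨_, hp.has_fpower_series_dslope_fslope⟩

/-- The quotient vR k r / r is nondecreasing in r. This makes the zero of the discriminant simple.
-/
theorem vR_le_div_mul (k : ℕ) {r s : ℝ} (h0 : 0 < r) (hrs : r ≤ s) (hs : s < rho) :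
    vR k r ≤ r / s * vR k s := by
  have hs0 : 0 < s := h0.trans_le hrs
  have hX := (strictMonoOn_XR k).monotoneOn ⟨h0.le, hrs.trans hs.le⟩ ⟨hs0.le, hs.le⟩ hrs
  have hX0 := XR_nonneg k h0.le (hrs.trans hs.le)
  have hX1 : 0 < 1 - XR k s := by linarith [XR_lt_one k hs0.le hs]
  have h2 : 0 < 1 - s := by linarith [rho_lt]
  have hXX : 0 ≤ XR k s := hX0.trans hX
  have h3 : 0 < 1 - r := by linarith
  calc vR k r = r * (4 * XR k r / ((1 - r) * (1 - XR k r) ^ 2)) := by unfold vR; ring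
    _ ≤ r * (4 * XR k s / ((1 - s) * (1 - XR k s) ^ 2)) := by gcongr
    _ = r / s * vR k s := by unfold vR; field_simp

theorem vR_le_div {N : ℕ} {r : ℝ} (h0 : 0 < r) (hr : r < sig N) : vR N r ≤ r / sig N := by
  simpa only [vR_eq_one, mul_one] using vR_le_div_mul N h0 hr.le (sig_lt N)

/-- Since vR N r ≤ r / σ_N, the difference quotient of the discriminant from the left is at least 1
/ σ_N, and so is its limit. -/
theorem exists_discriminant_factor (N : ℕ) : ∃ g : ℂ → ℂ, AnalyticAt ℂ g (sig N : ℝ) ∧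
    0 < (g (sig N : ℝ)).re ∧ ∀ t, 1 - cv N t = ((sig N : ℝ) - t) * g t := by
  have hσ := sig_pos N
  have hn := norm_sig_lt N
  have hv : cv N (sig N : ℝ) = 1 := by
    rw [cv_ofReal N hσ.le (sig_lt N), vR_eq_one]; simp
  have hf : AnalyticAt ℂ (fun t => 1 - cv N t) (sig N : ℝ) :=
    AnalyticAt.fun_sub analyticAt_const (analyticAt_cv hn N)
  have heq : ∀ t, 1 - cv N t =
      ((sig N : ℝ) - t) * -dslope (fun t => 1 - cv N t) (sig N : ℝ) t := by
    intro t
    have := sub_smul_dslope (fun t => 1 - cv N t) ((sig N : ℝ) : ℂ) t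
    rw [hv, sub_self, sub_zero, smul_eq_mul] at this
    rw [← this]; ring
  have hg := (analyticAt_dslope hf).fun_neg
  refine ⟨_, hg, ?_, heq⟩
  have hcont : Tendsto (fun r : ℝ => (-dslope (fun t => 1 - cv N t) (sig N : ℝ) (r : ℂ)).re)
      (𝓝[<] sig N) (𝓝 (-dslope (fun t => 1 - cv N t) (sig N : ℝ) (sig N : ℝ)).re) := by
    have h1 := hg.continuousAt.comp (f := fun r : ℝ => (r : ℂ)) (x := sig N)
      Complex.continuous_ofReal.continuousAt
    exact (Complex.continuous_re.continuousAt.comp h1).tendsto.mono_left nhdsWithin_le_nhds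
  have hle : 1 / sig N ≤ (-dslope (fun t => 1 - cv N t) (sig N : ℝ) (sig N : ℝ)).re := by
    refine ge_of_tendsto hcont ?_
    filter_upwards [Ioo_mem_nhdsLT hσ] with r hr
    have h1 := heq r
    rw [cv_ofReal N hr.1.le (hr.2.trans (sig_lt N))] at h1
    have h2 : 0 < sig N - r := by linarith [hr.2]
    have h3 : -dslope (fun t => 1 - cv N t) (sig N : ℝ) (r : ℂ) =
        (((1 - vR N r) / (sig N - r) : ℝ) : ℂ) := by
      have : ((sig N : ℝ) : ℂ) - r ≠ 0 := by exact_mod_cast h2.ne'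
      push_cast
      rw [eq_div_iff this, h1]; ring
    rw [h3, Complex.ofReal_re, div_le_div_iff₀ hσ h2]
    have := vR_le_div hr.1 hr.2
    rw [le_div_iff₀ hσ] at this
    linarith
  exact lt_of_lt_of_le (by positivity) hle

theorem mul_im_pos {A B : ℂ} (h1 : 0 < A.re) (h2 : 0 < A.im) (h3 : 0 < B.re) (h4 : 0 < B.im) :
    0 < (A * B).im := by
  rw [Complex.mul_im]; positivity

theorem rho_lt_XR {k N : ℕ} (hk : k ≤ N) : rho < XR k (sig N) := by
  have h1 := rho_lt_critX (sig_pos N).le (sig_lt N)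
  refine h1.trans_le ?_
  by_contra! h
  have := (XR_lt_critX_iff k (sig_pos N).le (sig_lt N).le).mp h
  exact absurd this (not_lt.mpr (strictMono_sig.monotone hk))

/-- Near σ_N the factors t / (1 - t) and 4 X / (1 - X)² are close to positive reals, and both lie
above the axis when t does; then so does their product. -/
theorem eventually_cv_im {k N : ℕ} (hk : k ≤ N) : ∀ᶠ t in 𝓝 ((sig N : ℝ) : ℂ),
    (0 < t.im → 0 < (cv k t).im) ∧ (t.im < 0 → (cv k t).im < 0) := by
  have hσ := sig_pos N
  have hlt := sig_lt N
  have hn := norm_sig_lt N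
  have hX := rho_lt_XR hk
  have hX1 := XR_lt_one k hσ.le hlt
  have hXr := cX_ofReal k hσ.le hlt
  have c1 : ContinuousAt (cX k) (sig N : ℝ) := (analyticAt_cX hn k).continuousAt
  have e1 : ∀ᶠ t in 𝓝 ((sig N : ℝ) : ℂ), rho < ‖cX k t‖ := by
    refine c1.norm.eventually_const_lt ?_
    simp only [hXr, Complex.norm_real]
    exact hX.trans_le (le_abs_self _)
  have e2 : ∀ᶠ t in 𝓝 ((sig N : ℝ) : ℂ), 0 < (t / (1 - t)).re := by
    have : ContinuousAt (fun t : ℂ => t / (1 - t)) (sig N : ℝ) :=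
      continuousAt_id.div (continuousAt_const.sub continuousAt_id) (one_sub_ne_zero hn)
    refine (Complex.continuous_re.continuousAt.comp this).eventually_const_lt ?_
    have : ((sig N : ℝ) : ℂ) / (1 - (sig N : ℝ)) = ((sig N / (1 - sig N) : ℝ) : ℂ) := by
      push_cast; rfl
    simp only [Function.comp, this, Complex.ofReal_re]
    exact div_pos hσ (by linarith [rho_lt])
  have e3 : ∀ᶠ t in 𝓝 ((sig N : ℝ) : ℂ), 0 < (4 * cX k t / (1 - cX k t) ^ 2).re := by
    have : ContinuousAt (fun t : ℂ => 4 * cX k t / (1 - cX k t) ^ 2) (sig N : ℝ) :=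
      (continuousAt_const.mul c1).div ((continuousAt_const.sub c1).pow 2)
        (pow_ne_zero 2 (one_sub_ne_zero_of_norm (norm_cX_lt_one k hn)))
    refine (Complex.continuous_re.continuousAt.comp this).eventually_const_lt ?_
    have : 4 * cX k (sig N : ℝ) / (1 - cX k (sig N : ℝ)) ^ 2 =
        ((4 * XR k (sig N) / (1 - XR k (sig N)) ^ 2 : ℝ) : ℂ) := by
      rw [hXr]; push_cast; rfl
    simp only [Function.comp, this, Complex.ofReal_re]
    have : 0 < 1 - XR k (sig N) := by linarith
    have := rho_pos.trans hX
    positivity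
  have key : ∀ᶠ t in 𝓝 ((sig N : ℝ) : ℂ), ‖t‖ < rho ∧ (0 < t.im → 0 < (cv k t).im) := by
    filter_upwards [e1, e2, e3, eventually_norm_lt hn] with t h1 h2 h3 h4
    refine ⟨h4, fun him => ?_⟩
    rw [cv_eq_mul]
    exact mul_im_pos h2 (im_div_one_sub him) h3
      (im_koebe (norm_cX_lt_one k h4) (cX_im_pos k h4 him h1.le))
  have hconj := Complex.continuous_conj.tendsto ((sig N : ℝ) : ℂ)
  rw [Complex.conj_ofReal] at hconj
  filter_upwards [key, hconj.eventually key] with t h1 h2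
  refine ⟨h1.2, fun him => ?_⟩
  have := h2.2 (by simpa using him)
  rw [cv_conj k h1.1] at this
  simpa using this

/-- The discriminant and σ_N - t have imaginary parts of the same sign near σ_N, so the principal
root of the product splits. -/
theorem exists_cw_eq (N : ℕ) : ∃ κ : ℂ → ℂ, AnalyticAt ℂ κ (sig N : ℝ) ∧ κ (sig N : ℝ) ≠ 0 ∧
    ∀ᶠ t in 𝓝 ((sig N : ℝ) : ℂ), t.im ≠ 0 ∨ t.re < sig N →
      cw N t = κ t * ((sig N : ℝ) - t).sqrt := by
  obtain ⟨g, hg, hgre, heq⟩ := exists_discriminant_factor N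
  have hgs : g (sig N : ℝ) ∈ Complex.slitPlane := Complex.mem_slitPlane_iff.mpr (.inl hgre)
  refine ⟨fun t => (g t).sqrt, analyticAt_csqrt hg hgs, fun h => ?_, ?_⟩
  · have := csqrt_re_pos hgs
    simp only at h
    rw [h] at this
    simp at this
  have e1 : ∀ᶠ t in 𝓝 ((sig N : ℝ) : ℂ), g t ∈ Complex.slitPlane :=
    hg.continuousAt.eventually_mem (Complex.isOpen_slitPlane.mem_nhds hgs)
  have e2 : ∀ᶠ t in 𝓝 ((sig N : ℝ) : ℂ), 0 < t.re :=
    Complex.continuous_re.continuousAt.eventually_const_lt (by simpa using sig_pos N)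
  filter_upwards [e1, e2, eventually_cv_im (le_refl N)] with t h1 h2 h3 ht
  have him : (1 - cv N t).im = -(cv N t).im := by simp
  rw [cw, heq, mul_comm (g t).sqrt]
  refine csqrt_mul h1 ?_
  rw [← heq, him]
  simp only [Complex.sub_im, Complex.ofReal_im, Complex.sub_re, Complex.ofReal_re, zero_sub]
  rcases lt_trichotomy t.im 0 with h | h | h
  · right; left
    exact ⟨by linarith, by linarith [h3.2 h]⟩
  · right; right
    have hlt : t.re < sig N := ht.resolve_left (not_not.mpr h)
    have htr : t = (t.re : ℂ) := Complex.ext (by simp) (by simp [h])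
    refine ⟨by linarith, by linarith, one_sub_mem_slitPlane ?_⟩
    have hr := hlt.trans (sig_lt N)
    have h4 : ‖t‖ ≤ t.re := by
      rw [htr, Complex.norm_real, Complex.ofReal_re, Real.norm_eq_abs, abs_of_pos h2]
    exact (norm_cv_le N h4 hr).trans_lt ((vR_lt_one_iff h2.le hr).mpr hlt)
  · left
    exact ⟨by linarith, by linarith [h3.1 h]⟩

/-- The kernels beyond N are still subcritical at σ_N, and x_k ≤ `xbar` < 1 excludes poles. -/
theorem analyticAt_cS_succ_sig {N : ℕ} (hstar : xbar (sig N) * (2 - cR (sig N)) < 1) :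
    AnalyticAt ℂ (cS (N + 1)) (sig N : ℝ) := by
  have hσ := sig_pos N
  have hlt := sig_lt N
  refine analyticAt_cS (norm_sig_lt N) fun k hk => ?_
  have hk' : sig N < sig k := strictMono_sig (by omega)
  constructor
  · refine one_sub_mem_slitPlane ?_
    rw [cv_ofReal k hσ.le hlt, Complex.norm_real, Real.norm_eq_abs, abs_of_nonneg]
    · exact (vR_lt_one_iff hσ.le hlt).mpr hk'
    · have := XR_nonneg k hσ.le hlt.le
      have : 0 < 1 - sig N := by linarith [rho_lt]
      unfold vR; positivity
  · rw [cx_ofReal k hσ.le hk'.le]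
    have h1 := xR_le_xbar k hσ hk'.le
    have h2 := xbar_lt_one hσ hlt hstar
    have : (1 : ℝ) - xR k (sig N) ≠ 0 := by linarith
    exact_mod_cast this

theorem cX_sig_ne_zero (k N : ℕ) : cX k (sig N : ℝ) ≠ 0 := by
  rw [cX_ofReal k (sig_pos N).le (sig_lt N)]
  exact_mod_cast (XR_pos k (sig_pos N) (sig_lt N).le).ne'

theorem eventually_cX_ne_zero (k N : ℕ) : ∀ᶠ t in 𝓝 ((sig N : ℝ) : ℂ), cX k t ≠ 0 :=
  (analyticAt_cX (norm_sig_lt N) k).continuousAt.eventually_ne (cX_sig_ne_zero k N)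

/-- The singular expansion of the solution at the branch point of its first kernel. -/
theorem exists_cS_eq {N : ℕ} (hstar : xbar (sig N) * (2 - cR (sig N)) < 1) :
    ∃ f g : ℂ → ℂ, AnalyticAt ℂ f (sig N : ℝ) ∧ AnalyticAt ℂ g (sig N : ℝ) ∧
      g (sig N : ℝ) ≠ 0 ∧ ∀ᶠ t in 𝓝 ((sig N : ℝ) : ℂ), t.im ≠ 0 ∨ t.re < sig N →
        cS N t = f t + g t * ((sig N : ℝ) - t).sqrt := by
  have hσ := sig_pos N
  have hlt := sig_lt N
  have hn := norm_sig_lt N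
  obtain ⟨κ, hκ, hκ0, hw⟩ := exists_cw_eq N
  have hS := analyticAt_cS_succ_sig hstar
  have hA := analyticAt_cA N hn
  have hX := analyticAt_cX hn N
  have hX0 := cX_sig_ne_zero N N
  have hc := analyticAt_cc hn
  have hAσ : cA N (sig N : ℝ) = (xR N (sig N) : ℝ) := by
    have h := cx_eq N hn
    rw [cw_ofReal N hσ.le le_rfl, vR_eq_one, sub_self, Real.sqrt_zero, Complex.ofReal_zero,
      sub_zero, mul_one] at h
    rw [← h, cx_ofReal N hσ.le le_rfl]
  have hx1 : xR N (sig N) < 1 :=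
    (xR_le_xbar N hσ le_rfl).trans_lt (xbar_lt_one hσ hlt hstar)
  have hA1 : 1 - cA N (sig N : ℝ) ≠ 0 := by
    rw [hAσ]
    have : (1 : ℝ) - xR N (sig N) ≠ 0 := by linarith
    exact_mod_cast this
  have hA0 : cA N (sig N : ℝ) ≠ 0 := by
    have h1 : ch (sig N : ℝ) ≠ 0 := by
      rw [ch_ofReal hσ.le hlt]; exact_mod_cast (hR_pos hlt.le).ne'
    have h2 := one_sub_ne_zero hn
    have h3 := one_sub_ne_zero_of_norm (norm_cX_lt_one N hn)
    unfold cA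
    exact mul_ne_zero h1 (div_ne_zero (mul_ne_zero h2 h3) two_ne_zero)
  -- S_N = (n₁ x + n₀) / (1 - x) with x = A (1 - κ r) and r = √(σ_N - t). `D` is 1 - x times its
  -- conjugate under r ↦ -r; rationalising leaves -A κ (n₁ + n₀) / D as coefficient of r.
  set n₁ : ℂ → ℂ := fun t => (1 - cc t) / cX N t - cc t * cS (N + 1) t with hn₁
  set n₀ : ℂ → ℂ := fun t => cc t ^ 2 * cS (N + 1) t with hn₀
  set D : ℂ → ℂ := fun t => (1 - cA N t) ^ 2 - cA N t ^ 2 * κ t ^ 2 * ((sig N : ℝ) - t) with hD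
  have an₁ : AnalyticAt ℂ n₁ (sig N : ℝ) :=
    AnalyticAt.fun_sub (AnalyticAt.fun_div (AnalyticAt.fun_sub analyticAt_const hc) hX hX0)
      (AnalyticAt.fun_mul hc hS)
  have an₀ : AnalyticAt ℂ n₀ (sig N : ℝ) := AnalyticAt.fun_mul (hc.fun_pow 2) hS
  have aD : AnalyticAt ℂ D (sig N : ℝ) :=
    AnalyticAt.fun_sub ((AnalyticAt.fun_sub analyticAt_const hA).fun_pow 2)
      (AnalyticAt.fun_mul (AnalyticAt.fun_mul (hA.fun_pow 2) (hκ.fun_pow 2)) (by fun_prop))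
  have hDσ : D (sig N : ℝ) ≠ 0 := by
    simp only [hD, sub_self, mul_zero, sub_zero]
    exact pow_ne_zero 2 hA1
  refine ⟨fun t => ((n₁ t * cA N t + n₀ t) * (1 - cA N t) +
      n₁ t * cA N t ^ 2 * κ t ^ 2 * ((sig N : ℝ) - t)) / D t,
    fun t => -(cA N t * κ t * (n₁ t + n₀ t)) / D t, ?_, ?_, ?_, ?_⟩
  · refine AnalyticAt.fun_div (AnalyticAt.fun_add ?_ ?_) aD hDσ
    · exact AnalyticAt.fun_mul (AnalyticAt.fun_add (AnalyticAt.fun_mul an₁ hA) an₀)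
        (AnalyticAt.fun_sub analyticAt_const hA)
    · exact AnalyticAt.fun_mul (AnalyticAt.fun_mul (AnalyticAt.fun_mul an₁ (hA.fun_pow 2))
        (hκ.fun_pow 2)) (by fun_prop)
  · exact AnalyticAt.fun_div (AnalyticAt.fun_mul (AnalyticAt.fun_mul hA hκ)
      (AnalyticAt.fun_add an₁ an₀)).fun_neg aD hDσ
  · refine div_ne_zero (neg_ne_zero.mpr (mul_ne_zero (mul_ne_zero hA0 hκ0) ?_)) hDσ
    -- n₁ + n₀ is a nonzero multiple of P - c y with y = X_{N+1} S_{N+1} in [0, 1]; it is nonzero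
    -- because c < P.
    obtain ⟨y, ⟨hy0, hy1⟩, hy⟩ := cX_mul_cS_mem (n := N + 1) hσ
      (fun k hk => strictMono_sig.monotone (by omega)) hstar
    have hP0 := PR_pos hσ hlt.le
    have hcP := cR_lt_PR hσ hlt
    have hc1 := cR_lt_one hσ.le hlt
    have hX1 : cX (N + 1) (sig N : ℝ) = cP (sig N : ℝ) * cX N (sig N : ℝ) := by
      rw [cX, cX, pow_succ]; ring
    rw [hX1, cP_ofReal hσ.le hlt] at hy
    have hPc : (PR (sig N) : ℂ) ≠ 0 := by exact_mod_cast hP0.ne'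
    have e : (n₁ (sig N : ℝ) + n₀ (sig N : ℝ)) * cX N (sig N : ℝ) * PR (sig N) =
        (((1 - cR (sig N)) * (PR (sig N) - cR (sig N) * y) : ℝ) : ℂ) := by
      simp only [hn₁, hn₀, cc_ofReal hσ.le hlt]
      push_cast
      rw [hy]
      field_simp
      ring
    intro h0
    rw [h0, zero_mul, zero_mul] at e
    have h1 : (1 - cR (sig N)) * (PR (sig N) - cR (sig N) * y) = 0 := by exact_mod_cast e.symm
    have h2 : 0 < PR (sig N) - cR (sig N) * y := by
      nlinarith [cR_nonneg hσ.le hlt]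
    exact (mul_pos (by linarith) h2).ne' h1
  · filter_upwards [hw, aD.continuousAt.eventually_ne hDσ, eventually_cX_ne_zero N N,
      eventually_norm_lt hn] with t h1 h2 h3 h4 ht
    have hr2 : ((sig N : ℝ) - t).sqrt ^ 2 = (sig N : ℝ) - t := csqrt_sq _
    have hx := cx_eq N h4
    rw [h1 ht] at hx
    rw [cS_rec N h4, ca_eq N h3, cm, hx]
    have hD' : D t = (1 - cA N t * (1 - κ t * ((sig N : ℝ) - t).sqrt)) *
        (1 - cA N t - cA N t * κ t * ((sig N : ℝ) - t).sqrt) := by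
      simp only [hD]
      linear_combination (cA N t) ^ 2 * κ t ^ 2 * hr2
    have hne : 1 - cA N t * (1 - κ t * ((sig N : ℝ) - t).sqrt) ≠ 0 := fun h => h2 (by
      rw [hD', h, zero_mul])
    have hnum : (1 - cc t) * (cA N t * (1 - κ t * ((sig N : ℝ) - t).sqrt) / cX N t) +
        cc t * (cc t - cA N t * (1 - κ t * ((sig N : ℝ) - t).sqrt)) * cS (N + 1) t =
        n₁ t * (cA N t * (1 - κ t * ((sig N : ℝ) - t).sqrt)) + n₀ t := by
      simp only [hn₁, hn₀]; ring
    rw [div_mul_eq_mul_div, ← add_div, hnum, div_mul_eq_mul_div, ← add_div,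
      div_eq_div_iff hne h2]
    simp only [hD]
    generalize ((sig N : ℝ) - t).sqrt = r at *
    rw [← hr2]
    ring

theorem HasSqrtSingularityWithin.add_mul {G : ℂ → ℂ} {S : Set ℂ} {s : ℂ} {a m H : ℂ → ℂ}
    (hG : HasSqrtSingularityWithin G S s) (ha : AnalyticAt ℂ a s) (hm : AnalyticAt ℂ m s)
    (hm0 : m s ≠ 0) (h : ∀ᶠ t in 𝓝[S] s, H t = a t + m t * G t) :
    HasSqrtSingularityWithin H S s := by
  obtain ⟨f, g, hf, hg, hg0, he⟩ := hG
  refine ⟨fun t => a t + m t * f t, fun t => m t * g t,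
    AnalyticAt.fun_add ha (AnalyticAt.fun_mul hm hf), AnalyticAt.fun_mul hm hg,
    mul_ne_zero hm0 hg0, ?_⟩
  filter_upwards [h, he] with t h1 h2
  rw [h1, h2]; ring

theorem hasSqrtSingularityWithin_cS {N : ℕ} (hstar : xbar (sig N) * (2 - cR (sig N)) < 1)
    {S : Set ℂ} (hS : ∀ t ∈ S, t.im ≠ 0 ∨ t.re < sig N) :
    HasSqrtSingularityWithin (cS N) S (sig N : ℝ) := by
  obtain ⟨f, g, hf, hg, hg0, he⟩ := exists_cS_eq hstar
  refine ⟨f, g, hf, hg, hg0, ?_⟩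
  filter_upwards [nhdsWithin_le_nhds he, self_mem_nhdsWithin] with t h1 h2
  rw [h1 (hS t h2), Complex.sqrt, one_div]

/-- Passing an earlier branch point: the square root continues analytically from above. -/
theorem hasSqrtSingularityWithin_cS_of_succ {j N : ℕ} (hj : j < N)
    (h : HasSqrtSingularityWithin (cS (j + 1)) {t | 0 < t.im} (sig N : ℝ)) :
    HasSqrtSingularityWithin (cS j) {t | 0 < t.im} (sig N : ℝ) := by
  have hσ := sig_pos N
  have hlt := sig_lt N
  have hn := norm_sig_lt N
  have hjσ : sig j < sig N := strictMono_sig hj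
  have hv1 : 1 < vR j (sig N) := by
    refine lt_of_le_of_ne (not_lt.mp fun h => ?_) fun h => ?_
    · exact absurd ((vR_lt_one_iff hσ.le hlt).mp h) (not_lt.mpr hjσ.le)
    · have h1 := vR_le_div_mul j (sig_pos j) hjσ.le hlt
      rw [vR_eq_one, ← h, mul_one, le_div_iff₀ hσ] at h1
      linarith
  have hvσ := cv_ofReal j hσ.le hlt
  -- Beyond σ_j the discriminant is negative; approached from the upper half-plane, its principal
  -- root is -i √(cv - 1), which is analytic at σ_N.
  set w : ℂ → ℂ := fun t => -Complex.I * (cv j t - 1).sqrt with hw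
  have hwσ : w (sig N : ℝ) = -Complex.I * (√(vR j (sig N) - 1) : ℝ) := by
    have := csqrt_ofReal (sub_nonneg.mpr hv1.le)
    push_cast at this
    simp only [hw, hvσ, this]
  have aw : AnalyticAt ℂ w (sig N : ℝ) := by
    refine AnalyticAt.fun_mul analyticAt_const (analyticAt_csqrt
      (AnalyticAt.fun_sub (analyticAt_cv hn j) analyticAt_const) ?_)
    rw [hvσ, Complex.mem_slitPlane_iff]
    left
    simpa using hv1
  set x : ℂ → ℂ := fun t => cA j t * (1 - w t) with hx
  have hA := analyticAt_cA j hn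
  have ax : AnalyticAt ℂ x (sig N : ℝ) :=
    AnalyticAt.fun_mul hA (AnalyticAt.fun_sub analyticAt_const aw)
  have hAσ : ∃ A : ℝ, 0 < A ∧ cA j (sig N : ℝ) = A := by
    refine ⟨hR (sig N) * ((1 - sig N) * (1 - XR j (sig N)) / 2), ?_, ?_⟩
    · have h1 := hR_pos hlt.le
      have h2 : 0 < 1 - sig N := by linarith [rho_lt]
      have h3 : 0 < 1 - XR j (sig N) := by linarith [XR_lt_one j hσ.le hlt]
      positivity
    · rw [cA, ch_ofReal hσ.le hlt, cX_ofReal j hσ.le hlt]; push_cast; rfl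
  -- The root is a nonzero imaginary number, so x is not real, whereas 1 and c are: the multiplier
  -- has neither a pole nor a zero at σ_N.
  have hxim : (x (sig N : ℝ)).im ≠ 0 := by
    obtain ⟨A, hA0, hA⟩ := hAσ
    simp only [hx, hwσ, hA]
    have : 0 < √(vR j (sig N) - 1) := Real.sqrt_pos.mpr (by linarith)
    simp
    exact ⟨hA0.ne', this.ne'⟩
  have hx1 : 1 - x (sig N : ℝ) ≠ 0 := fun h => hxim (by
    rw [sub_eq_zero] at h; rw [← h]; simp)
  have hcx : cc (sig N : ℝ) - x (sig N : ℝ) ≠ 0 := fun h => hxim (by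
    rw [sub_eq_zero] at h; rw [← h, cc_ofReal hσ.le hlt]; simp)
  have hc := analyticAt_cc hn
  have hc0 : cc (sig N : ℝ) ≠ 0 := by
    rw [cc_ofReal hσ.le hlt]; exact_mod_cast (cR_pos hσ hlt).ne'
  have a1x := AnalyticAt.fun_sub (analyticAt_const (v := (1 : ℂ))) ax
  refine h.add_mul (a := fun t => (1 - cc t) * (x t / cX j t) / (1 - x t))
    (m := fun t => cc t * (cc t - x t) / (1 - x t)) ?_ ?_ ?_ ?_
  · exact AnalyticAt.fun_div (AnalyticAt.fun_mul (AnalyticAt.fun_sub analyticAt_const hc)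
      (AnalyticAt.fun_div ax (analyticAt_cX hn j) (cX_sig_ne_zero j N))) a1x hx1
  · exact AnalyticAt.fun_div (AnalyticAt.fun_mul hc (AnalyticAt.fun_sub hc ax)) a1x hx1
  · exact div_ne_zero (mul_ne_zero hc0 hcx) hx1
  · filter_upwards [nhdsWithin_le_nhds (eventually_cv_im hj.le), self_mem_nhdsWithin,
      nhdsWithin_le_nhds (eventually_cX_ne_zero j N),
      nhdsWithin_le_nhds (eventually_norm_lt hn)] with t h1 h2 h3 h4
    have hwt : cw j t = w t := by
      have : 0 < (cv j t - 1).im := by simpa using h1.1 h2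
      rw [cw, ← neg_sub, csqrt_neg_of_im_pos this]
    have hxt : cx j t = x t := by rw [cx_eq j h4, hwt]
    rw [cS_rec j h4, ca_eq j h3, cm, hxt]

theorem hasSqrtSingularityWithin_cS_zero {N : ℕ}
    (hstar : xbar (sig N) * (2 - cR (sig N)) < 1) :
    HasSqrtSingularityWithin (cS 0) {t | 0 < t.im} (sig N : ℝ) := by
  have key : ∀ d ≤ N, HasSqrtSingularityWithin (cS (N - d)) {t | 0 < t.im} (sig N : ℝ) := by
    intro d
    induction d with
    | zero => exact fun _ => hasSqrtSingularityWithin_cS hstar fun t ht => .inl (ne_of_gt ht)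
    | succ d ih =>
      intro hd
      refine hasSqrtSingularityWithin_cS_of_succ (by omega) ?_
      rw [show N - (d + 1) + 1 = N - d by omega]
      exact ih (by omega)
  simpa using key N le_rfl

theorem analyticAt_conj_conj {f : ℂ → ℂ} {s : ℝ} (hf : AnalyticAt ℂ f s) :
    AnalyticAt ℂ (fun t => (starRingEnd ℂ) (f ((starRingEnd ℂ) t))) s := by
  rw [Complex.analyticAt_iff_eventually_differentiableAt] at hf ⊢
  have hconj := Complex.continuous_conj.tendsto (s : ℂ)
  rw [Complex.conj_ofReal] at hconj
  filter_upwards [hconj.eventually hf] with t ht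
  have := ht.conj_conj
  rwa [Complex.conj_conj] at this

theorem HasSqrtSingularityWithin.conj {G : ℂ → ℂ} {s : ℝ}
    (h : HasSqrtSingularityWithin G {t | 0 < t.im} s)
    (hG : ∀ᶠ t in 𝓝[{t | t.im < 0}] (s : ℂ), G t = (starRingEnd ℂ) (G ((starRingEnd ℂ) t))) :
    HasSqrtSingularityWithin G {t | t.im < 0} s := by
  obtain ⟨f, g, hf, hg, hg0, he⟩ := h
  refine ⟨_, _, analyticAt_conj_conj hf, analyticAt_conj_conj hg, ?_, ?_⟩
  · simpa using hg0
  · have hconj : Tendsto (starRingEnd ℂ) (𝓝[{t | t.im < 0}] (s : ℂ)) (𝓝[{t | 0 < t.im}] (s : ℂ)) := by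
      refine tendsto_nhdsWithin_iff.mpr ⟨?_, ?_⟩
      · have hconj := Complex.continuous_conj.tendsto (s : ℂ)
        rw [Complex.conj_ofReal] at hconj
        exact hconj.mono_left nhdsWithin_le_nhds
      · filter_upwards [self_mem_nhdsWithin] with t ht
        simpa using ht
    filter_upwards [hG, hconj.eventually he, self_mem_nhdsWithin] with t h1 h2 h3
    rw [h1, h2]
    have h4 : (s : ℂ) - t ∈ Complex.slitPlane := by
      rw [Complex.mem_slitPlane_iff]
      right
      simpa using (ne_of_lt h3)
    have h5 := csqrt_conj h4
    rw [map_sub, Complex.conj_ofReal] at h5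
    rw [one_div]
    simp only [Complex.sqrt] at h5
    rw [h5]
    simp

/-- The analytic continuation of the generating function of generic polygons. -/
noncomputable def cF (t : ℂ) : ℂ := t * cS 0 t

theorem hasSqrtSingularityOnSlit_cF {N : ℕ} (hstar : xbar (sig N) * (2 - cR (sig N)) < 1) :
    HasSqrtSingularityOnSlit cF (sig N) := by
  have hσ : ((sig N : ℝ) : ℂ) ≠ 0 := by exact_mod_cast (sig_pos N).ne'
  have hup : HasSqrtSingularityWithin cF {t | 0 < t.im} (sig N : ℝ) :=
    (hasSqrtSingularityWithin_cS_zero hstar).add_mul (a := fun _ => 0) (m := fun t => t)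
      analyticAt_const analyticAt_id hσ (.of_forall fun t => by simp [cF])
  refine ⟨hup, hup.conj ?_⟩
  filter_upwards [self_mem_nhdsWithin, nhdsWithin_le_nhds (eventually_norm_lt (norm_sig_lt N))]
    with t h1 h2
  rw [cF, cF, cS_conj 0 h2 fun k => one_sub_cv_mem_of_im_ne_zero k h2 (ne_of_lt h1)]
  simp

theorem hasSqrtSingularityWithin_cF :
    HasSqrtSingularityWithin cF (slitDisc (sig 0) rho) (sig 0 : ℝ) := by
  have hσ : ((sig 0 : ℝ) : ℂ) ≠ 0 := by exact_mod_cast (sig_pos 0).ne'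
  refine (hasSqrtSingularityWithin_cS xbar_sig_zero (S := slitDisc (sig 0) rho) ?_).add_mul
    (a := fun _ => 0) (m := fun t => t) analyticAt_const analyticAt_id hσ
    (.of_forall fun t => by simp [cF])
  rintro t ⟨h1, h2⟩
  by_contra! h
  obtain ⟨him, hre⟩ := h
  have htr : (t.re : ℂ) = t := Complex.ext (by simp) (by simp [him])
  refine h2 ⟨t.re, ⟨hre, ?_⟩, htr⟩
  rw [mem_ball_zero_iff] at h1
  exact (le_abs_self _).trans_lt ((Complex.abs_re_le_norm t).trans_lt h1)

theorem infinite_sqrt_singularities : {N : ℕ | HasSqrtSingularityOnSlit cF (sig N)}.Infinite := by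
  obtain ⟨K, hK⟩ := eventually_atTop.mp eventually_xbar_sig
  refine Set.infinite_of_injective_forall_mem (f := fun n => K + n) (fun a b h => by simpa using h)
    fun n => hasSqrtSingularityOnSlit_cF (hK _ (by omega))

end PrudentPolygon

/-! ### Power series, differential equations and square root singularities -/

namespace PrudentPolygon

open Set Filter Topology

/-- The power series `Q` converges near `0` to the function `G`. -/
def Represents (Q : PowerSeries ℂ) (G : ℂ → ℂ) : Prop :=
  ∀ᶠ t in 𝓝 (0 : ℂ), HasSum (fun n => PowerSeries.coeff n Q * t ^ n) (G t)

theorem represents_iff {Q : PowerSeries ℂ} {G : ℂ → ℂ} : Represents Q G ↔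
    HasFPowerSeriesAt G (FormalMultilinearSeries.ofScalars ℂ fun n => PowerSeries.coeff n Q) 0 := by
  simp only [Represents, hasFPowerSeriesAt_iff, FormalMultilinearSeries.coeff_ofScalars,
    smul_eq_mul, zero_add, mul_comm]

theorem represents_iff_coeff {Q : PowerSeries ℂ} {G : ℂ → ℂ} : Represents Q G ↔
    AnalyticAt ℂ G 0 ∧ ∀ n, PowerSeries.coeff n Q = iteratedDeriv n G 0 / n.factorial := by
  rw [represents_iff]
  constructor
  · intro h
    have ha : AnalyticAt ℂ G 0 := ⟨_, h⟩
    refine ⟨ha, fun n => ?_⟩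
    have e := congrArg (fun p => p.coeff n) (h.eq_formalMultilinearSeries ha.hasFPowerSeriesAt)
    simpa only [FormalMultilinearSeries.coeff_ofScalars] using e
  · rintro ⟨ha, h⟩
    simp only [h]
    exact ha.hasFPowerSeriesAt

theorem Represents.derivative {Q : PowerSeries ℂ} {G : ℂ → ℂ} (h : Represents Q G) :
    Represents (PowerSeries.derivative ℂ Q) (deriv G) := by
  rw [represents_iff_coeff] at h ⊢
  refine ⟨h.1.deriv, fun n => ?_⟩
  rw [PowerSeries.coeff_derivative, h.2, iteratedDeriv_succ', Nat.factorial_succ]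
  have h1 : (n : ℂ) + 1 ≠ 0 := by exact_mod_cast Nat.succ_ne_zero n
  have h2 : (n.factorial : ℂ) ≠ 0 := by exact_mod_cast n.factorial_ne_zero
  push_cast
  field_simp

theorem Represents.iterate_derivative {Q : PowerSeries ℂ} {G : ℂ → ℂ} (h : Represents Q G)
    (i : ℕ) : Represents ((PowerSeries.derivative ℂ)^[i] Q) (deriv^[i] G) := by
  induction i with
  | zero => exact h
  | succ i ih =>
    rw [Function.iterate_succ_apply', Function.iterate_succ_apply']
    exact ih.derivative

theorem Represents.add {Q₁ Q₂ : PowerSeries ℂ} {G₁ G₂ : ℂ → ℂ} (h₁ : Represents Q₁ G₁)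
    (h₂ : Represents Q₂ G₂) : Represents (Q₁ + Q₂) fun t => G₁ t + G₂ t := by
  filter_upwards [h₁, h₂] with t e₁ e₂
  simp only [map_add, add_mul]
  exact e₁.add e₂

theorem Represents.C_mul {Q : PowerSeries ℂ} {G : ℂ → ℂ} (a : ℂ) (h : Represents Q G) :
    Represents (PowerSeries.C a * Q) fun t => a * G t := by
  filter_upwards [h] with t e
  simp only [PowerSeries.coeff_C_mul, mul_assoc]
  exact e.mul_left a

theorem Represents.X_mul {Q : PowerSeries ℂ} {G : ℂ → ℂ} (h : Represents Q G) :
    Represents (PowerSeries.X * Q) fun t => t * G t := by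
  filter_upwards [h] with t e
  rw [← hasSum_nat_add_iff' 1]
  simp only [PowerSeries.coeff_succ_X_mul, Finset.sum_range_one, PowerSeries.coeff_zero_X_mul,
    zero_mul, sub_zero]
  have := e.mul_left t
  have e2 : (fun n => PowerSeries.coeff n Q * t ^ (n + 1)) =
      fun n => t * (PowerSeries.coeff n Q * t ^ n) := by ext n; ring
  rwa [e2]

theorem Represents.polynomial_mul {Q : PowerSeries ℂ} {G : ℂ → ℂ} (p : Polynomial ℂ)
    (h : Represents Q G) : Represents ((p : PowerSeries ℂ) * Q) fun t => p.eval t * G t := by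
  induction p using Polynomial.induction_on with
  | C a => simpa using h.C_mul a
  | add p q hp hq => simpa [add_mul] using hp.add hq
  | monomial n a ih =>
    have := ih.X_mul
    have e1 : ((Polynomial.C a * Polynomial.X ^ (n + 1) : Polynomial ℂ) : PowerSeries ℂ) * Q =
        PowerSeries.X * (((Polynomial.C a * Polynomial.X ^ n : Polynomial ℂ) : PowerSeries ℂ) * Q) := by
      simp; ring
    rw [e1]
    convert this using 2
    simp; ring

theorem represents_zero : Represents 0 fun _ => 0 :=
  .of_forall fun t => by simp

theorem Represents.sum {ι : Type*} (s : Finset ι) {Q : ι → PowerSeries ℂ} {G : ι → ℂ → ℂ}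
    (h : ∀ i ∈ s, Represents (Q i) (G i)) :
    Represents (∑ i ∈ s, Q i) fun t => ∑ i ∈ s, G i t := by
  classical
  induction s using Finset.induction_on with
  | empty => simpa using represents_zero
  | insert a s ha ih =>
    simp only [Finset.sum_insert ha]
    exact (h a (Finset.mem_insert_self _ _)).add
      (ih fun i hi => h i (Finset.mem_insert_of_mem hi))

/-- Convergence at ε gives a positive radius, and the identity theorem along ε / (n + 1) identifies
the sum with `G`. -/
theorem represents_of_hasSum_real {Q : PowerSeries ℂ} {G : ℂ → ℂ} (hG : AnalyticAt ℂ G 0) {ε : ℝ}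
    (hε : 0 < ε) (h : ∀ t : ℝ, 0 < t → t ≤ ε →
      HasSum (fun n => PowerSeries.coeff n Q * (t : ℂ) ^ n) (G t)) : Represents Q G := by
  set p := FormalMultilinearSeries.ofScalars ℂ fun n => PowerSeries.coeff n Q with hp
  have hrad : 0 < p.radius := by
    refine lt_of_lt_of_le ?_ (p.le_radius_of_summable_norm (r := ⟨ε, hε.le⟩) ?_)
    · exact ENNReal.coe_pos.mpr (show (0 : NNReal) < ⟨ε, hε.le⟩ from hε)
    · have := (h ε hε le_rfl).summable.norm
      refine this.congr fun n => ?_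
      rw [hp, FormalMultilinearSeries.ofScalars_norm, norm_mul, norm_pow, Complex.norm_real,
        Real.norm_eq_abs, abs_of_pos hε]
      rfl
  have hfp : HasFPowerSeriesAt p.sum p 0 := (p.hasFPowerSeriesOnBall hrad).hasFPowerSeriesAt
  have hsum := hfp
  rw [hp, ← represents_iff] at hsum
  have hlim : Tendsto (fun n : ℕ => ((ε / (n + 1) : ℝ) : ℂ)) atTop (𝓝[≠] 0) := by
    refine tendsto_nhdsWithin_iff.mpr ⟨?_, .of_forall fun n => ?_⟩
    · have : Tendsto (fun n : ℕ => ε / ((n : ℝ) + 1)) atTop (𝓝 0) := by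
        simpa [div_eq_mul_inv] using tendsto_one_div_add_atTop_nhds_zero_nat.const_mul ε
      have h2 := (Complex.continuous_ofReal.tendsto (0 : ℝ)).comp this
      rw [Complex.ofReal_zero] at h2
      exact h2
    · have : (0 : ℝ) < ε / (n + 1) := by positivity
      simp only [mem_compl_iff, mem_singleton_iff]
      exact_mod_cast this.ne'
  have hev : ∀ᶠ n : ℕ in atTop, p.sum ((ε / (n + 1) : ℝ) : ℂ) = G ((ε / (n + 1) : ℝ) : ℂ) := by
    have h1 := (hlim.mono_right nhdsWithin_le_nhds).eventually hsum
    filter_upwards [h1] with n hn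
    refine hn.unique (h _ (by positivity) ?_)
    rw [div_le_iff₀ (by positivity)]
    nlinarith [(Nat.cast_nonneg n : (0 : ℝ) ≤ n)]
  have hfreq : ∃ᶠ z in 𝓝[≠] (0 : ℂ), p.sum z = G z := hlim.frequently hev.frequently
  have heq := (AnalyticAt.frequently_eq_iff_eventually_eq ⟨_, hfp⟩ hG).mp hfreq
  rw [represents_iff]
  exact hfp.congr heq

/-- The differential equation of a D-finite series, with nonzero leading coefficient. -/
theorem IsDFinite.exists_leading {Q : PowerSeries ℂ} (h : IsDFinite Q) :
    ∃ (m : ℕ) (P : ℕ → Polynomial ℂ), P m ≠ 0 ∧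
      ∑ i ∈ Finset.range (m + 1), (P i : PowerSeries ℂ) * (PowerSeries.derivative ℂ)^[i] Q = 0 := by
  classical
  obtain ⟨d, p, hp, hsum⟩ := h
  set P : ℕ → Polynomial ℂ := fun i => if hi : i < d + 1 then p ⟨i, hi⟩ else 0 with hP
  have hPi : ∀ i : Fin (d + 1), P i = p i := fun i => dif_pos i.2
  have hex : ∃ i, i < d + 1 ∧ P i ≠ 0 := by
    by_contra! h0
    refine hp (funext fun i => ?_)
    rw [← hPi]; exact h0 i i.2
  have hS : ((Finset.range (d + 1)).filter fun i => P i ≠ 0).Nonempty := by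
    obtain ⟨i, h1, h2⟩ := hex
    exact ⟨i, by simp only [Finset.mem_filter, Finset.mem_range]; exact ⟨h1, h2⟩⟩
  obtain ⟨hm1, hm2⟩ := Finset.mem_filter.mp (Finset.max'_mem _ hS)
  refine ⟨_, P, hm2, ?_⟩
  have e : ∑ i : Fin (d + 1), (p i : PowerSeries ℂ) * (PowerSeries.derivative ℂ)^[(i : ℕ)] Q =
      ∑ i ∈ Finset.range (d + 1), (P i : PowerSeries ℂ) * (PowerSeries.derivative ℂ)^[i] Q := by
    rw [Finset.sum_range]
    exact Finset.sum_congr rfl fun i _ => by rw [hPi]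
  rw [e] at hsum
  rw [← hsum]
  refine Finset.sum_subset (fun i hi => ?_) fun i hi1 hi2 => ?_
  · rw [Finset.mem_range] at *; omega
  · have : P i = 0 := by
      by_contra h0
      have hmem : i ∈ (Finset.range (d + 1)).filter fun i => P i ≠ 0 :=
        Finset.mem_filter.mpr ⟨hi1, h0⟩
      have := Finset.le_max' _ i hmem
      rw [Finset.mem_range] at hi2
      omega
    simp [this]

section local_expansion

/-- The analytic numerators of the derivatives of `g(t) √(s - t)`. -/
noncomputable def sqrtNumerator (s : ℂ) (g : ℂ → ℂ) : ℕ → ℂ → ℂ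
  | 0 => g
  | i + 1 => fun t => deriv (sqrtNumerator s g i) t * (s - t) + sqrtNumerator s g i t * (i - 1 / 2)

variable {s : ℂ} {g : ℂ → ℂ}

theorem analyticAt_sqrtNumerator (hg : AnalyticAt ℂ g s) (i : ℕ) :
    AnalyticAt ℂ (sqrtNumerator s g i) s := by
  induction i with
  | zero => exact hg
  | succ i ih =>
    exact AnalyticAt.fun_add (AnalyticAt.fun_mul ih.deriv (by fun_prop))
      (AnalyticAt.fun_mul ih analyticAt_const)

theorem sqrtNumerator_ne_zero (hg0 : g s ≠ 0) (i : ℕ) : sqrtNumerator s g i s ≠ 0 := by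
  induction i with
  | zero => exact hg0
  | succ i ih =>
    simp only [sqrtNumerator, sub_self, mul_zero, zero_add]
    refine mul_ne_zero ih fun h => ?_
    have h1 : (2 * i : ℂ) = 1 := by linear_combination 2 * h
    have h2 : 2 * i = 1 := by exact_mod_cast h1
    omega

theorem isOpen_upper : IsOpen {t : ℂ | 0 < t.im} := isOpen_lt continuous_const Complex.continuous_im

theorem eventually_eventually_upper {p : ℂ → Prop} (h : ∀ᶠ t in 𝓝[{t | 0 < t.im}] s, p t) :
    ∀ᶠ t in 𝓝[{t | 0 < t.im}] s, ∀ᶠ z in 𝓝 t, p z := by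
  rw [← eventually_eventually_nhdsWithin] at h
  filter_upwards [h, self_mem_nhdsWithin] with t h1 h2
  rwa [isOpen_upper.nhdsWithin_eq h2] at h1

theorem analyticAt_csqrt_sub {s : ℝ} {t : ℂ} (ht : 0 < t.im) :
    AnalyticAt ℂ (fun z => ((s : ℂ) - z).sqrt) t := by
  refine analyticAt_csqrt (by fun_prop) ?_
  rw [Complex.mem_slitPlane_iff]
  right
  simpa using ht.ne'

/-- The i-th derivative of g √(s - t) is √(s - t) times its numerator over (s - t)^i; denominators
are cleared. -/
theorem iterate_deriv_eq {s : ℝ} {G f : ℂ → ℂ} (hf : AnalyticAt ℂ f s) (hg : AnalyticAt ℂ g s)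
    (h : ∀ᶠ t in 𝓝[{t | 0 < t.im}] (s : ℂ), G t = f t + g t * ((s : ℂ) - t).sqrt) (i : ℕ) :
    ∀ᶠ t in 𝓝[{t | 0 < t.im}] (s : ℂ), AnalyticAt ℂ (deriv^[i] G) t ∧
      ((s : ℂ) - t) ^ i * (deriv^[i] G t - deriv^[i] f t) =
        ((s : ℂ) - t).sqrt * sqrtNumerator s g i t := by
  have hfi := fun i => (hf.iterated_deriv i).eventually_analyticAt
  have hgi := fun i => (analyticAt_sqrtNumerator hg i).eventually_analyticAt
  have hGan : ∀ᶠ t in 𝓝[{t | 0 < t.im}] (s : ℂ), AnalyticAt ℂ G t := by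
    filter_upwards [eventually_eventually_upper h, self_mem_nhdsWithin,
      nhdsWithin_le_nhds (hfi 0), nhdsWithin_le_nhds (hgi 0)] with t h1 h2 h3 h4
    exact (AnalyticAt.fun_add h3 (AnalyticAt.fun_mul h4 (analyticAt_csqrt_sub h2))).congr
      (h1.mono fun z hz => hz.symm)
  induction i with
  | zero =>
    filter_upwards [h, hGan] with t h1 h2
    refine ⟨h2, ?_⟩
    simp only [pow_zero, Function.iterate_zero, id, sqrtNumerator, h1]
    ring
  | succ i ih =>
    filter_upwards [eventually_eventually_upper ih, self_mem_nhdsWithin,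
      nhdsWithin_le_nhds (hfi i), nhdsWithin_le_nhds (hgi i)] with t h1 h2 h3 h4
    have hGi := h1.self_of_nhds.1
    refine ⟨?_, ?_⟩
    · rw [Function.iterate_succ_apply']; exact hGi.deriv
    rw [Function.iterate_succ_apply', Function.iterate_succ_apply']
    have hval := h1.self_of_nhds.2
    set z := (s : ℂ) - t with hz
    have dz : HasDerivAt (fun t => (s : ℂ) - t) (-1) t := by
      simpa using (hasDerivAt_id t).const_sub (s : ℂ)
    have dr : HasDerivAt (fun t => ((s : ℂ) - t).sqrt) (deriv (fun t => ((s : ℂ) - t).sqrt) t) t :=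
      (analyticAt_csqrt_sub h2).differentiableAt.hasDerivAt
    set r' := deriv (fun t => ((s : ℂ) - t).sqrt) t with hr'
    have hr2 : z.sqrt ^ 2 = z := csqrt_sq z
    -- The derivative of the root is found implicitly, from its square.
    have hrr : 2 * z.sqrt * r' = -1 := by
      have d2 := dr.fun_pow 2
      simp only [csqrt_sq] at d2
      have := d2.unique dz
      simpa using this
    have dL := (dz.fun_pow i).fun_mul
      (hGi.differentiableAt.hasDerivAt.fun_sub h3.differentiableAt.hasDerivAt)
    have dR := dr.fun_mul h4.differentiableAt.hasDerivAt
    have hE : (fun t => ((s : ℂ) - t) ^ i * (deriv^[i] G t - deriv^[i] f t)) =ᶠ[𝓝 t]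
        fun t => ((s : ℂ) - t).sqrt * sqrtNumerator s g i t := h1.mono fun _ hz => hz.2
    have hU := dL.unique (dR.congr_of_eventuallyEq hE)
    have hpow : z * ((i : ℂ) * z ^ (i - 1)) = i * z ^ i := by
      rcases i with _ | i
      · simp
      · rw [Nat.add_sub_cancel, pow_succ]; ring
    simp only [sqrtNumerator]
    rw [← hz] at hU ⊢
    linear_combination z * hU + (deriv^[i] G t - deriv^[i] f t) * hpow + i * hval +
      sqrtNumerator s g i t * (1 / 2 * z.sqrt * hrr - r' * hr2)

/-- Multiplied by (s - t)^m, the equation becomes A + √(s - t) B = 0 with A, B analytic at s. Both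
must vanish at s, and only the derivative of order m contributes to B(s). -/
theorem leading_eval_eq_zero {s : ℝ} {G : ℂ → ℂ} {m : ℕ} {P : ℕ → Polynomial ℂ}
    (hG : HasSqrtSingularityWithin G {t | 0 < t.im} s)
    (h0 : ∀ᶠ t in 𝓝[{t | 0 < t.im}] (s : ℂ),
      ∑ i ∈ Finset.range (m + 1), (P i).eval t * deriv^[i] G t = 0) : (P m).eval (s : ℂ) = 0 := by
  obtain ⟨f, g, hf, hg, hg0, he⟩ := hG
  have he' : ∀ᶠ t in 𝓝[{t | 0 < t.im}] (s : ℂ), G t = f t + g t * ((s : ℂ) - t).sqrt := by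
    filter_upwards [he] with t ht
    rw [ht, Complex.sqrt, one_div]
  have hder := fun i => iterate_deriv_eq hf hg he' i
  set A : ℂ → ℂ := fun t => ∑ i ∈ Finset.range (m + 1),
    (P i).eval t * (((s : ℂ) - t) ^ m * deriv^[i] f t) with hA
  set B : ℂ → ℂ := fun t => ∑ i ∈ Finset.range (m + 1),
    (P i).eval t * (((s : ℂ) - t) ^ (m - i) * sqrtNumerator s g i t) with hB
  have aP : ∀ i, AnalyticAt ℂ (fun t => (P i).eval t) (s : ℂ) := fun i =>
    AnalyticOnNhd.eval_polynomial (P i) _ (mem_univ _)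
  have aA : AnalyticAt ℂ A s := Finset.analyticAt_fun_sum _ fun i _ =>
    AnalyticAt.fun_mul (aP i) (AnalyticAt.fun_mul (by fun_prop) (hf.iterated_deriv i))
  have aB : AnalyticAt ℂ B s := Finset.analyticAt_fun_sum _ fun i _ =>
    AnalyticAt.fun_mul (aP i) (AnalyticAt.fun_mul (by fun_prop) (analyticAt_sqrtNumerator hg i))
  have hAB : ∀ᶠ t in 𝓝[{t | 0 < t.im}] (s : ℂ), A t + ((s : ℂ) - t).sqrt * B t = 0 := by
    have hall : ∀ᶠ t in 𝓝[{t | 0 < t.im}] (s : ℂ), ∀ i ∈ Finset.range (m + 1),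
        ((s : ℂ) - t) ^ i * (deriv^[i] G t - deriv^[i] f t) =
          ((s : ℂ) - t).sqrt * sqrtNumerator s g i t := by
      rw [Filter.eventually_all_finset]
      exact fun i _ => (hder i).mono fun t ht => ht.2
    filter_upwards [h0, hall] with t h1 h2
    have e : A t + ((s : ℂ) - t).sqrt * B t = ((s : ℂ) - t) ^ m *
        ∑ i ∈ Finset.range (m + 1), (P i).eval t * deriv^[i] G t := by
      simp only [hA, hB]
      rw [Finset.mul_sum, Finset.mul_sum, ← Finset.sum_add_distrib]
      refine Finset.sum_congr rfl fun i hi => ?_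
      have hpow : ((s : ℂ) - t) ^ m = ((s : ℂ) - t) ^ (m - i) * ((s : ℂ) - t) ^ i := by
        rw [← pow_add]
        congr 1
        rw [Finset.mem_range] at hi
        omega
      linear_combination -(P i).eval t * ((s : ℂ) - t) ^ (m - i) * h2 i hi -
        (P i).eval t * (deriv^[i] G t - deriv^[i] f t) * hpow
    rw [e, h1, mul_zero]
  have hr0 : Tendsto (fun t => ((s : ℂ) - t).sqrt) (𝓝[{t | 0 < t.im}] (s : ℂ)) (𝓝 0) := by
    have h1 : Tendsto (fun t : ℂ => √‖(s : ℂ) - t‖) (𝓝 (s : ℂ)) (𝓝 0) := by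
      have : ContinuousAt (fun t : ℂ => √‖(s : ℂ) - t‖) (s : ℂ) := by fun_prop
      simpa [ContinuousAt] using this
    refine squeeze_zero_norm (fun t => ?_) (h1.mono_left nhdsWithin_le_nhds)
    apply Real.le_sqrt_of_sq_le
    rw [← norm_pow, csqrt_sq]
  have hne : (𝓝[{t : ℂ | 0 < t.im}] (s : ℂ)).NeBot := by
    rw [← mem_closure_iff_nhdsWithin_neBot, Complex.closure_setOfPred_lt_im]
    simp
  have tA : Tendsto A (𝓝[{t | 0 < t.im}] (s : ℂ)) (𝓝 (A s)) :=
    aA.continuousAt.tendsto.mono_left nhdsWithin_le_nhds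
  have tB : Tendsto B (𝓝[{t | 0 < t.im}] (s : ℂ)) (𝓝 (B s)) :=
    aB.continuousAt.tendsto.mono_left nhdsWithin_le_nhds
  have hAs : A s = 0 := by
    have h1 := tA.add (hr0.mul tB)
    rw [zero_mul, add_zero] at h1
    exact tendsto_nhds_unique h1 (tendsto_const_nhds.congr' (hAB.mono fun t ht => ht.symm))
  -- As A vanishes at s, it is divisible by s - t; cancelling one root shows that B is √(s - t)
  -- times an analytic function.
  have hBs : B s = 0 := by
    have a1 := analyticAt_dslope aA
    have t1 : Tendsto (dslope A s) (𝓝[{t | 0 < t.im}] (s : ℂ)) (𝓝 (dslope A s s)) :=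
      a1.continuousAt.tendsto.mono_left nhdsWithin_le_nhds
    have h1 := hr0.mul t1
    rw [zero_mul] at h1
    refine tendsto_nhds_unique tB (h1.congr' ?_)
    filter_upwards [hAB, self_mem_nhdsWithin] with t h2 h3
    have hd := sub_smul_dslope A (s : ℂ) t
    rw [hAs, sub_zero, smul_eq_mul] at hd
    have hr2 := csqrt_sq ((s : ℂ) - t)
    have hrne : ((s : ℂ) - t).sqrt ≠ 0 := fun h => by
      rw [h] at hr2
      have := congrArg Complex.im hr2
      simp at this
      exact (ne_of_gt h3) this
    refine mul_left_cancel₀ hrne ?_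
    linear_combination (-1 : ℂ) * h2 - hd + dslope A s t * hr2
  have hBval : B s = (P m).eval (s : ℂ) * sqrtNumerator s g m s := by
    simp only [hB, sub_self]
    rw [Finset.sum_range_succ, Finset.sum_eq_zero, zero_add, Nat.sub_self, pow_zero, one_mul]
    intro i hi
    rw [Finset.mem_range] at hi
    rw [zero_pow (by omega)]
    ring
  rw [hBval] at hBs
  exact (mul_eq_zero.mp hBs).resolve_right (sqrtNumerator_ne_zero hg0 m)

end local_expansion

/-- The slit disc is star-shaped about 0: shrinking a point of the disc cannot bring it onto the
outward slit. -/
theorem isPreconnected_slitDisc {σ ρ : ℝ} (hσ : 0 < σ) (hρ : 0 < ρ) :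
    IsPreconnected (slitDisc σ ρ) := by
  have h0 : (0 : ℂ) ∈ slitDisc σ ρ := by
    refine ⟨by simpa using hρ, ?_⟩
    rintro ⟨x, hx, e⟩
    have : x = 0 := by exact_mod_cast e
    linarith [hx.1]
  refine (StarConvex.isPathConnected (a := (0 : ℂ)) ?_ h0).isConnected.isPreconnected
  rw [starConvex_zero_iff]
  rintro t ⟨h1, h2⟩ a ha0 ha1
  rw [mem_ball_zero_iff] at h1
  refine ⟨?_, ?_⟩
  · rw [mem_ball_zero_iff, norm_smul, Real.norm_eq_abs, abs_of_nonneg ha0]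
    nlinarith [norm_nonneg t]
  · rintro ⟨x, hx, e⟩
    have hre : x = a * t.re := by simpa using congrArg Complex.re e
    have him : 0 = a * t.im := by simpa using congrArg Complex.im e
    have ha : 0 < a := by
      refine lt_of_le_of_ne ha0 fun h => ?_
      rw [← h, zero_mul] at hre
      linarith [hx.1]
    have him' : t.im = 0 := (mul_eq_zero.mp him.symm).resolve_left ha.ne'
    refine h2 ⟨t.re, ⟨?_, (Complex.re_le_norm t).trans_lt h1⟩,
      Complex.ext (by simp) (by simp [him'])⟩
    have h3 : 0 < t.re := by
      by_contra! h
      nlinarith [hx.1]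
    nlinarith [hx.1]

/-- A function with infinitely many square root singularities on its slit is not D-finite. -/
theorem not_isDFinite {Q : PowerSeries ℂ} {G : ℂ → ℂ} {σ : ℕ → ℝ} {ρ : ℝ} (hQ : Represents Q G)
    (hσ0 : 0 < σ 0) (hσ : StrictMono σ) (hσρ : ∀ n, σ n < ρ)
    (hG : MeromorphicOn G (slitDisc (σ 0) ρ))
    (hsing : {N | HasSqrtSingularityWithin G {t | 0 < t.im} (σ N)}.Infinite) : ¬ IsDFinite Q := by
  intro h
  obtain ⟨m, P, hPm, hsum⟩ := h.exists_leading
  have hρ : 0 < ρ := hσ0.trans (hσρ 0)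
  set E : ℂ → ℂ := fun t => ∑ i ∈ Finset.range (m + 1), (P i).eval t * deriv^[i] G t with hE
  have hE0 : ∀ᶠ t in 𝓝 (0 : ℂ), E t = 0 := by
    have := Represents.sum (Finset.range (m + 1)) fun i _ =>
      (hQ.iterate_derivative i).polynomial_mul (P i)
    rw [hsum] at this
    filter_upwards [this, represents_zero] with t h1 h2
    exact h1.unique h2
  have hEm : MeromorphicOn E (slitDisc (σ 0) ρ) := fun t ht =>
    MeromorphicAt.fun_sum fun i _ => ((AnalyticOnNhd.eval_polynomial (P i) t
      (mem_univ _)).meromorphicAt).fun_mul (hG.iterated_deriv (n := i) t ht)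
  have h0mem : (0 : ℂ) ∈ slitDisc (σ 0) ρ := by
    refine ⟨by simpa using hρ, ?_⟩
    rintro ⟨x, hx, e⟩
    have : x = 0 := by exact_mod_cast e
    linarith [hx.1]
  -- Infinite vanishing order at 0 spreads over the connected slit disc, poles included. Beside σ_N
  -- the expression is analytic, so there it vanishes identically.
  have htop : ∀ t ∈ slitDisc (σ 0) ρ, ∀ᶠ z in 𝓝[≠] t, E z = 0 := by
    intro t ht
    rw [← meromorphicOrderAt_eq_top_iff]
    by_contra hne
    have := hEm.meromorphicOrderAt_ne_top_of_isPreconnected (isPreconnected_slitDisc hσ0 hρ) ht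
      h0mem hne
    exact this (meromorphicOrderAt_eq_top_iff.mpr (nhdsWithin_le_nhds hE0))
  have hroot : ∀ N, HasSqrtSingularityWithin G {t | 0 < t.im} (σ N) →
      (P m).eval ((σ N : ℝ) : ℂ) = 0 := by
    intro N hN
    refine leading_eval_eq_zero hN ?_
    obtain ⟨f, g, hf, hg, hg0, he⟩ := hN
    have he' : ∀ᶠ t in 𝓝[{t | 0 < t.im}] ((σ N : ℝ) : ℂ),
        G t = f t + g t * (((σ N : ℝ) : ℂ) - t).sqrt := by
      filter_upwards [he] with t ht
      rw [ht, Complex.sqrt, one_div]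
    have hall : ∀ᶠ t in 𝓝[{t | 0 < t.im}] ((σ N : ℝ) : ℂ), ∀ i ∈ Finset.range (m + 1),
        AnalyticAt ℂ (deriv^[i] G) t := by
      rw [Filter.eventually_all_finset]
      exact fun i _ => (iterate_deriv_eq hf hg he' i).mono fun t ht => ht.1
    have hball : ∀ᶠ t in 𝓝[{t | 0 < t.im}] ((σ N : ℝ) : ℂ), ‖t‖ < ρ := by
      refine nhdsWithin_le_nhds (continuous_norm.continuousAt.eventually_lt_const ?_)
      change ‖((σ N : ℝ) : ℂ)‖ < ρ
      rw [Complex.norm_real, Real.norm_eq_abs, abs_of_pos]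
      · exact hσρ N
      · exact hσ0.trans_le (hσ.monotone (Nat.zero_le N))
    filter_upwards [hall, hball, self_mem_nhdsWithin] with t h1 h2 h3
    have hmem : t ∈ slitDisc (σ 0) ρ := by
      refine ⟨by simpa using h2, ?_⟩
      rintro ⟨x, -, rfl⟩
      simp at h3
    have hEan : AnalyticAt ℂ E t := Finset.analyticAt_fun_sum _ fun i hi =>
      AnalyticAt.fun_mul (AnalyticOnNhd.eval_polynomial (P i) t (mem_univ _)) (h1 i hi)
    have := (hEan.frequently_zero_iff_eventually_zero).mp (htop t hmem).frequently
    exact this.self_of_nhds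
  refine hPm ((P m).eq_zero_of_infinite_isRoot ?_)
  refine (hsing.image (f := fun N => ((σ N : ℝ) : ℂ)) ?_).mono ?_
  · intro a _ b _ hab
    exact hσ.injective (Complex.ofReal_injective hab)
  · rintro _ ⟨N, hN, rfl⟩
    exact hroot N hN

end PrudentPolygon

/-! ### Assembly for both generating functions -/

namespace PrudentPolygon

open Set Filter Topology

theorem analyticAt_cF {t : ℂ} (ht : ‖t‖ ≤ sig 0) (hne : t ≠ (sig 0 : ℝ)) : AnalyticAt ℂ cF t :=
  AnalyticAt.fun_mul analyticAt_id (analyticAt_cS_of_norm_le 0 ht hne)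

theorem analyticOnNhd_cF : AnalyticOnNhd ℂ cF (Metric.ball 0 (sig 0)) := by
  intro t ht
  rw [mem_ball_zero_iff] at ht
  refine analyticAt_cF ht.le ?_
  rintro rfl
  rw [Complex.norm_real, Real.norm_eq_abs, abs_of_pos (sig_pos 0)] at ht
  exact lt_irrefl _ ht

theorem meromorphicOn_cF : MeromorphicOn cF (slitDisc (sig 0) rho) := fun t ht =>
  analyticAt_id.meromorphicAt.fun_mul (meromorphicOn_cS 0 t ht)

theorem represents_seriesR : Represents seriesR cF := by
  refine represents_of_hasSum_real (ε := 1 / 50)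
    (analyticOnNhd_cF 0 (Metric.mem_ball_self (sig_pos 0))) (by norm_num) fun t h0 ht => ?_
  simp only [seriesR, PowerSeries.coeff_mk]
  exact hasSum_genericCount_small h0 ht

theorem hasSum_seriesR {t : ℂ} (ht : t ∈ Metric.ball (0 : ℂ) (sig 0)) :
    HasSum (fun n : ℕ => PowerSeries.coeff n seriesR * t ^ n) (cF t) := by
  have h := Complex.hasSum_taylorSeries_on_ball analyticOnNhd_cF.differentiableOn ht
  have e : (fun n : ℕ => PowerSeries.coeff n seriesR * t ^ n) =
      fun n : ℕ => (n.factorial : ℂ)⁻¹ • (t - 0) ^ n • iteratedDeriv n cF 0 := by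
    ext n
    rw [(represents_iff_coeff.mp represents_seriesR).2, sub_zero, smul_eq_mul, smul_eq_mul]
    ring
  rw [e]
  exact h

/-- The analytic continuation of the generating function of all three-sided polygons. -/
noncomputable def cG (t : ℂ) : ℂ := 2 * (cF t + t ^ 2 / (1 - t) + (t * ch t - t))

/-- The series of all polygons differs from twice the generic one by a function analytic in |t| < ρ,
so it inherits every square root singularity. -/
theorem analyticAt_cG_sub {t : ℂ} (ht : ‖t‖ < rho) :
    AnalyticAt ℂ (fun t => 2 * (t ^ 2 / (1 - t) + (t * ch t - t))) t := by
  have h1 : 1 - t ≠ 0 := fun h => by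
    rw [← sub_eq_zero.mp h, norm_one] at ht
    linarith [rho_lt]
  have h2 := analyticAt_ch ht
  fun_prop (disch := assumption)

theorem cG_eq (t : ℂ) : cG t = 2 * (t ^ 2 / (1 - t) + (t * ch t - t)) + 2 * cF t := by
  unfold cG; ring

theorem represents_seriesPP3 : Represents seriesPP3 cG := by
  refine represents_of_hasSum_real (ε := 1 / 50) ?_ (by norm_num) fun t h0 ht => ?_
  · have h1 := analyticAt_cG_sub (t := 0) (by simpa using (sig_pos 0).trans (sig_lt 0))
    have h2 := analyticOnNhd_cF 0 (Metric.mem_ball_self (sig_pos 0))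
    rw [funext cG_eq]
    exact h1.fun_add (analyticAt_const.fun_mul h2)
  · simp only [seriesPP3, PowerSeries.coeff_mk]
    exact hasSum_threeSidedCount_small h0 ht

theorem meromorphicOn_cG : MeromorphicOn cG (slitDisc (sig 0) rho) := fun t ht => by
  rw [funext cG_eq]
  exact (analyticAt_cG_sub (by simpa using ht.1)).meromorphicAt.fun_add
    (analyticAt_const.meromorphicAt.fun_mul (meromorphicOn_cF t ht))

theorem not_isDFinite_seriesR : ¬ IsDFinite seriesR :=
  not_isDFinite represents_seriesR (sig_pos 0) strictMono_sig sig_lt meromorphicOn_cF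
    (infinite_sqrt_singularities.mono fun _ h => h.1)

theorem not_isDFinite_seriesPP3 : ¬ IsDFinite seriesPP3 :=
  not_isDFinite represents_seriesPP3 (sig_pos 0) strictMono_sig sig_lt meromorphicOn_cG
    (infinite_sqrt_singularities.mono fun N h => h.1.add_mul (analyticAt_cG_sub (norm_sig_lt N))
      analyticAt_const two_ne_zero (.of_forall cG_eq))

end PrudentPolygon

theorem mainTheorem1 :
    ∃ (ρ : ℝ) (σ : ℕ → ℝ),
      -- `ρ` is the unique real root of `1 - 3 t - t ^ 2 - t ^ 3`
      (∀ t : ℝ, 1 - 3 * t - t ^ 2 - t ^ 3 = 0 ↔ t = ρ) ∧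
      0.2955977 ≤ ρ ∧ ρ < 0.2955978 ∧
      -- `σ N` is the unique solution in `(0, ρ)` of `u(t) = q(t) (q(t) ^ 2 t) ^ N`
      (∀ (N : ℕ) (t : ℝ), (0 < t ∧ t < ρ ∧
        PrudentPolygon.u t = PrudentPolygon.q t * (PrudentPolygon.q t ^ 2 * t) ^ N) ↔ t = σ N) ∧
      -- `σ = σ 0 = τ ^ 2` with `τ` the unique real root of `x ^ 5 + 2 x ^ 2 + 3 x - 2`
      (∃ τ : ℝ, (∀ x : ℝ, x ^ 5 + 2 * x ^ 2 + 3 * x - 2 = 0 ↔ x = τ) ∧ σ 0 = τ ^ 2) ∧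
      0.2441312 ≤ σ 0 ∧ σ 0 < 0.2441313 ∧
      StrictMono σ ∧ Filter.Tendsto σ Filter.atTop (nhds ρ) ∧
      -- `F` is the analytic continuation of `R(t, 1, 1)`
      (∃ F : ℂ → ℂ,
        AnalyticOnNhd ℂ F (Metric.ball 0 (σ 0)) ∧
        (∀ t ∈ Metric.ball (0 : ℂ) (σ 0),
          HasSum (fun n : ℕ => PowerSeries.coeff n PrudentPolygon.seriesR * t ^ n) (F t)) ∧
        MeromorphicOn F (PrudentPolygon.slitDisc (σ 0) ρ) ∧
        -- `σ 0` is a square root singularity and the only singularity on the circle `|t| = σ 0`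
        PrudentPolygon.HasSqrtSingularityWithin F (PrudentPolygon.slitDisc (σ 0) ρ) (σ 0) ∧
        (∀ t : ℂ, ‖t‖ = σ 0 → t ≠ σ 0 → AnalyticAt ℂ F t) ∧
        {N : ℕ | PrudentPolygon.HasSqrtSingularityOnSlit F (σ N)}.Infinite) ∧
      ¬ PrudentPolygon.IsDFinite PrudentPolygon.seriesR ∧
      ¬ PrudentPolygon.IsDFinite PrudentPolygon.seriesPP3 := by
  open PrudentPolygon in
  exact ⟨rho, sig, fun t => eq_rho_iff, le_rho, rho_lt, sig_unique,
    ⟨√(sig 0), quintic_iff, (Real.sq_sqrt (sig_pos 0).le).symm⟩, le_sig_zero, sig_zero_lt,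
    strictMono_sig, tendsto_sig,
    ⟨cF, analyticOnNhd_cF, fun t => hasSum_seriesR, meromorphicOn_cF, hasSqrtSingularityWithin_cF,
      fun t ht => analyticAt_cF ht.le, infinite_sqrt_singularities⟩,
    not_isDFinite_seriesR, not_isDFinite_seriesPP3⟩
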